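/- **Setting.** Let $A\in\mathbb R^{n\times d}$ ($d\ge 1$) have rank $d$, let $b\in\mathbb R^n$, let $\mathcal C\subseteq\mathbb R^d$ be closed and convex, let $x^*\in\operatorname{argmin}_{x\in\mathcal C}\|Ax-b\|_2$, and let $\eta\in(0,\tfrac13)$. A Count-Sketch-type sketch is a matrix $S\in\mathbb R^{m\times n}$ in which column $i$ has the entry $v_i\in\mathbb R$ in row $p_i$ and zeros elsewhere. A random Count-Sketch is one in which all $p_i$ are uniform in $\{1,\dots,m\}$, all $v_i$ are uniform in $\{\pm1\}$, and all of these are independent. **Algorithm.** Let $S_1$ be an arbitrary (learned) Count-Sketch-type sketch with $O(d^2)$ rows. Let $S_2$ be a random Count-Sketch with $m_2$ rows, where $Cd^2\le m_2=O(d^2)$. Let $T_1,T_2$ be two random Count-Sketches with a common number $k$ of rows, where $C d^2/\eta^2\le k=\mathrm{poly}(d/\eta)$; they serve as $(1\pm\eta)$-subspace embeddings. Here $C$ is an absolute constant, and $S_2,T_1,T_2$ are independent. For $i=1,2$: * take a QR decomposition $T_iA=Q_iR_i$; * let $\hat Z_{i,1}$ be $\sigma_{\min}(S_iAR_i^{-1})^2$,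 exactly or up to a factor in $[1-\eta,1+\eta]$; * let $\hat Z_{i,2}$ be $\|(S_iAR_i^{-1})^\top(S_iAR_i^{-1})-I\|_{op}$, up to a factor in $[1-\eta,1+\eta]$. Put $i^*=1$ if $\hat Z_{1,2}/\hat Z_{1,1}<\hat Z_{2,2}/\hat Z_{2,1}$, and $i^*=2$ otherwise, where a positive number divided by $0$ is $\infty$. Return a solution $\hat x$ of $$\min_{x\in\mathcal C}\ \tfrac12\|S_{i^*}Ax\|_2^2-\langle A^\top b,x\rangle .$$ **Theorem.** There is an absolute constant $C$ for which the following two assertions hold. (a) With probability at least $0.98$ over $S_2,T_1,T_2$, the algorithm can be carried out, and for each result that it may return, the minimum below is finite and $$\|A(\hat x-x^*)\|_2\le(1+\eta)^4\Big(\min\Big\{\frac{\hat Z_{1,2}}{\hat Z_{1,1}},\frac{\hat Z_{2,2}}{\hat Z_{2,1}}\Big\}+4\eta\Big)\|Ax^*\|_2 .$$ (b) There is one fixed program for a real random-access machine that, for all inputs and all outcomes of the random sketches, halts within $O(\mathrm{nnz}(A)\log\frac1\eta)+\mathrm{poly}(\frac d\eta)$ steps, and that carries out the algorithm whenever this is possible.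 The machine has arithmetic, square roots and comparisons of reals at unit cost. $A$ is given as the list of its nonzero entries, and looking up (or drawing) the nonzero entry of one column of a sketch is one step. The machine may call a solver for quadratic programs $\min_{x\in\mathcal C}\frac12\|Bx\|_2^2-\langle c,x\rangle$, where a call with $B\in\mathbb R^{r\times d}$ is charged $(r+d)^e$ steps for a fixed exponent $e$. The constant in the $O(\cdot)$ and the polynomial depend only on $e$ and on the constants in the bounds on the numbers of rows. -/

import Mathlib

open scoped Matrix

/-! ## Linear algebra -/

namespace HessianSketch

/-- The Euclidean norm of a real vector. -/
noncomputable def l2norm {k : ℕ} (v : Fin k → ℝ) : ℝ := ‖WithLp.toLp 2 v‖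

/-- The spectral norm (Euclidean operator norm) of a square matrix. -/
noncomputable def opNorm {d : ℕ} (M : Matrix (Fin d) (Fin d) ℝ) : ℝ :=
  ‖Matrix.toEuclideanCLM (n := Fin d) (𝕜 := ℝ) M‖

/-- `σ_min(B)`, the least of the `d` singular values of a matrix with `d` columns, that is the
minimum of `‖B x‖` over the unit sphere of `ℝ^d`. -/
noncomputable def sigmaMin {k d : ℕ} (B : Matrix (Fin k) (Fin d) ℝ) : ℝ :=
  sInf {r : ℝ | ∃ x : Fin d → ℝ, l2norm x = 1 ∧ r = l2norm (B *ᵥ x)}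

/-- The number of nonzero entries of a matrix. -/
noncomputable def nnz {n d : ℕ} (A : Matrix (Fin n) (Fin d) ℝ) : ℕ :=
  Nat.card {q : Fin n × Fin d // A q.1 q.2 ≠ 0}

/-- `(Q, R)` is a (thin) QR decomposition of `M`. -/
structure IsQR {k d : ℕ} (M Q : Matrix (Fin k) (Fin d) ℝ) (R : Matrix (Fin d) (Fin d) ℝ) :
    Prop where
  eq_mul : M = Q * R
  orthonormal : Qᵀ * Q = 1
  upper : ∀ i j : Fin d, j < i → R i j = 0

/-- `x` is a solution of `min_{x ∈ 𝒞} ½ ‖B x‖² - ⟨c, x⟩`. -/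
def IsSolution {k d : ℕ} (𝒞 : Set (Fin d → ℝ)) (B : Matrix (Fin k) (Fin d) ℝ)
    (c x : Fin d → ℝ) : Prop :=
  x ∈ 𝒞 ∧ ∀ z ∈ 𝒞,
    1 / 2 * l2norm (B *ᵥ x) ^ 2 - c ⬝ᵥ x ≤ 1 / 2 * l2norm (B *ᵥ z) ^ 2 - c ⬝ᵥ z

/-! ## Sketches -/

/-- A Count-Sketch-type sketch with `m` rows and `n` columns: column `i` has the entry `val i`
in row `pos i` and zeros elsewhere. -/
structure CSType (m n : ℕ) where
  pos : Fin n → Fin m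
  val : Fin n → ℝ

/-- The sketching matrix. -/
def CSType.mat {m n : ℕ} (S : CSType m n) : Matrix (Fin m) (Fin n) ℝ :=
  fun r i => if S.pos i = r then S.val i else 0

/-- The sample space of a random Count-Sketch: a row and a sign for each column. Under the uniform
distribution rows and signs are uniform and all of them are independent. -/
abbrev CSRand (m n : ℕ) : Type := (Fin n → Fin m) × (Fin n → Bool)

/-- The Count-Sketch of an outcome. -/
def CSRand.sketch {m n : ℕ} (ω : CSRand m n) : CSType m n where
  pos := ω.1
  val i := if ω.2 i then 1 else -1

/-! ## The algorithm -/

/-- `z₁, z₂` are possible return values of `Estimate(S, A)`, with accuracy `η` and with the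
matrix `T` as its subspace embedding: `z₁` is a `(1 ± η)`-approximation (possibly the exact value)
of `σ_min(S A R⁻¹)²`, and `z₂` one of `‖(S A R⁻¹)ᵀ (S A R⁻¹) - I‖`. -/
def IsEstimate {n d m k : ℕ} (η : ℝ) (A : Matrix (Fin n) (Fin d) ℝ)
    (S : Matrix (Fin m) (Fin n) ℝ) (T : Matrix (Fin k) (Fin n) ℝ) (z₁ z₂ : ℝ) : Prop :=
  ∃ (Q : Matrix (Fin k) (Fin d) ℝ) (R : Matrix (Fin d) (Fin d) ℝ),
    IsQR (T * A) Q R ∧ IsUnit R.det ∧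
    |z₁ - sigmaMin (S * A * R⁻¹) ^ 2| ≤ η * sigmaMin (S * A * R⁻¹) ^ 2 ∧
    |z₂ - opNorm ((S * A * R⁻¹)ᵀ * (S * A * R⁻¹) - 1)| ≤
      η * opNorm ((S * A * R⁻¹)ᵀ * (S * A * R⁻¹) - 1)

/-- What a run of the algorithm produces: the four estimates and the returned vector. -/
structure Output (d : ℕ) where
  z₁₁ : ℝ
  z₁₂ : ℝ
  z₂₁ : ℝ
  z₂₂ : ℝ
  x : Fin d → ℝ

/-- The quotient of two nonnegative reals, `∞` if a positive number is divided by zero. -/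
noncomputable def ratio (a b : ℝ) : ENNReal := ENNReal.ofReal a / ENNReal.ofReal b

/-- `o` is a possible result of the algorithm: estimate for `S₁` (with `T₁`) and for `S₂`
(with `T₂`), then solve `min_{x ∈ 𝒞} ½ ‖S A x‖² - ⟨Aᵀ b, x⟩` for the better of the two. -/
def IsRun {n d m₁ m₂ k : ℕ} (η : ℝ) (A : Matrix (Fin n) (Fin d) ℝ) (b : Fin n → ℝ)
    (𝒞 : Set (Fin d → ℝ)) (S₁ : Matrix (Fin m₁) (Fin n) ℝ) (S₂ : Matrix (Fin m₂) (Fin n) ℝ)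
    (T₁ T₂ : Matrix (Fin k) (Fin n) ℝ) (o : Output d) : Prop :=
  IsEstimate η A S₁ T₁ o.z₁₁ o.z₁₂ ∧ IsEstimate η A S₂ T₂ o.z₂₁ o.z₂₂ ∧
  (ratio o.z₁₂ o.z₁₁ < ratio o.z₂₂ o.z₂₁ → IsSolution 𝒞 (S₁ * A) (Aᵀ *ᵥ b) o.x) ∧
  (¬ ratio o.z₁₂ o.z₁₁ < ratio o.z₂₂ o.z₂₁ → IsSolution 𝒞 (S₂ * A) (Aᵀ *ᵥ b) o.x)

/-! ## The machine model

A real random-access machine with structured programs. Its memory consists of integer variables,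
one-dimensional integer arrays and two-dimensional real arrays, all of them named by numbers that
are fixed in the program; array cells are addressed through integer variables. Each operation
and each test costs one step. Real numbers are subject to arithmetic, square roots and comparison
only. The only other means is a call to a solver for quadratic programs over the constraint set. -/

/-- The memory of the machine. -/
structure Mem where
  /-- integer variables -/
  nv : ℕ → ℕ
  /-- integer arrays -/
  na : ℕ → ℕ → ℕ
  /-- real arrays -/
  ra : ℕ → ℕ → ℕ → ℝ

/-- The cell `arr[i, j]` of a real array, where `i` and `j` are integer variables. -/
structure Ref where
  arr : ℕ
  i : ℕ
  j : ℕ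

/-- The content of a real cell. -/
def Mem.get (s : Mem) (r : Ref) : ℝ := s.ra r.arr (s.nv r.i) (s.nv r.j)

/-- Write a real cell. -/
noncomputable def Mem.set (s : Mem) (r : Ref) (v : ℝ) : Mem :=
  { s with ra := fun a i j =>
      if a = r.arr ∧ i = s.nv r.i ∧ j = s.nv r.j then v else s.ra a i j }

/-- Write an integer variable. -/
def Mem.setVar (s : Mem) (x v : ℕ) : Mem := { s with nv := Function.update s.nv x v }

/-- Basic operations; lower-case letters name integer variables, `arr` an integer array. -/
inductive Op where
  | const (x k : ℕ)
  | add (x y z : ℕ)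
  | sub (x y z : ℕ)
  | load (x arr i : ℕ)
  | store (arr i x : ℕ)
  | rconst (r : Ref) (k : ℕ)
  | radd (r s t : Ref)
  | rsub (r s t : Ref)
  | rmul (r s t : Ref)
  | rdiv (r s t : Ref)
  | rsqrt (r s : Ref)

/-- The effect of a basic operation (subtraction of integers is truncated at zero). -/
noncomputable def Op.eval : Op → Mem → Mem
  | .const x k, m => m.setVar x k
  | .add x y z, m => m.setVar x (m.nv y + m.nv z)
  | .sub x y z, m => m.setVar x (m.nv y - m.nv z)
  | .load x arr i, m => m.setVar x (m.na arr (m.nv i))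
  | .store arr i x, m =>
      { m with na := fun a l => if a = arr ∧ l = m.nv i then m.nv x else m.na a l }
  | .rconst r k, m => m.set r k
  | .radd r s t, m => m.set r (m.get s + m.get t)
  | .rsub r s t, m => m.set r (m.get s - m.get t)
  | .rmul r s t, m => m.set r (m.get s * m.get t)
  | .rdiv r s t, m => m.set r (m.get s / m.get t)
  | .rsqrt r s, m => m.set r (Real.sqrt (m.get s))

/-- Tests: comparison of two integer variables, or of two real cells. -/
inductive Test where
  | lt (x y : ℕ)
  | rlt (r s : Ref)

/-- The truth value of a test. -/
def Test.holds : Test → Mem → Prop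
  | .lt x y, m => m.nv x < m.nv y
  | .rlt r s, m => m.get r < m.get s

/-- Programs. `solve B k c x` submits the matrix in the real array `B`, with as many rows as the
integer variable `k` says, and the vector in column `0` of the real array `c` to the solver, and
writes the answer to column `0` of the real array `x`. -/
inductive Prog where
  | op (o : Op)
  | solve (B k c x : ℕ)
  | seq (p q : Prog)
  | ite (t : Test) (p q : Prog)
  | while (t : Test) (p : Prog)

/-- A solver for quadratic programs in `d` variables: a quadratic form `½ ‖B x‖²`, given by `B`,
and a linear form `⟨c, x⟩`, given by `c`, are mapped to a point. -/
abbrev Solver (d : ℕ) : Type :=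
  (k : ℕ) → Matrix (Fin k) (Fin d) ℝ → (Fin d → ℝ) → (Fin d → ℝ)

/-- The solver is correct for the constraint set `𝒞`. -/
def Solver.CorrectFor {d : ℕ} (sol : Solver d) (𝒞 : Set (Fin d → ℝ)) : Prop :=
  ∀ (k : ℕ) (B : Matrix (Fin k) (Fin d) ℝ) (c : Fin d → ℝ),
    (∃ x, IsSolution 𝒞 B c x) → IsSolution 𝒞 B c (sol k B c)

/-- The memory after a call of the solver. -/
def Solver.call {d : ℕ} (sol : Solver d) (B k c x : ℕ) (s : Mem) : Mem :=
  let ans : Fin d → ℝ :=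
    sol (s.nv k) (fun i j => s.ra B i j) (fun j => s.ra c j 0)
  { s with ra := fun a i j =>
      if h : i < d then (if a = x ∧ j = 0 then ans ⟨i, h⟩ else s.ra a i j) else s.ra a i j }

/-- `Exec sol e p s t s'`: started in memory `s`, the program `p` halts after exactly `t` steps
in memory `s'`. A call of the solver with a matrix of `k` rows and `d` columns is charged
`(k + d) ^ e` steps. -/
inductive Exec {d : ℕ} (sol : Solver d) (e : ℕ) : Prog → Mem → ℕ → Mem → Prop where
  | op (o : Op) (s : Mem) : Exec sol e (.op o) s 1 (o.eval s)
  | solve (B k c x : ℕ) (s : Mem) :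
      Exec sol e (.solve B k c x) s ((s.nv k + d) ^ e) (sol.call B k c x s)
  | seq {p q : Prog} {s s' s'' : Mem} {t t' : ℕ} (h : Exec sol e p s t s')
      (h' : Exec sol e q s' t' s'') : Exec sol e (.seq p q) s (t + t') s''
  | ite_true {c : Test} {p q : Prog} {s s' : Mem} {t : ℕ} (hc : c.holds s)
      (h : Exec sol e p s t s') : Exec sol e (.ite c p q) s (1 + t) s'
  | ite_false {c : Test} {p q : Prog} {s s' : Mem} {t : ℕ} (hc : ¬ c.holds s)
      (h : Exec sol e q s t s') : Exec sol e (.ite c p q) s (1 + t) s'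
  | while_true {c : Test} {p : Prog} {s s' s'' : Mem} {t t' : ℕ} (hc : c.holds s)
      (h : Exec sol e p s t s') (h' : Exec sol e (.while c p) s' t' s'') :
      Exec sol e (.while c p) s (1 + t + t') s''
  | while_false {c : Test} {p : Prog} {s : Mem} (hc : ¬ c.holds s) :
      Exec sol e (.while c p) s 1 s

/-- A finite list of numbers as the content of an array; the remaining cells are zero. -/
def fill {α : Type} [Zero α] {k : ℕ} (f : Fin k → α) (i : ℕ) : α :=
  if h : i < k then f ⟨i, h⟩ else 0

/-- A list of reals in column `0` of a real array; the remaining cells are zero. -/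
def fillCol {k : ℕ} (f : Fin k → ℝ) (i j : ℕ) : ℝ := if j = 0 then fill f i else 0

/-- The initial memory. The matrix `A` is given as the list `ent` of its nonzero entries, in any
order; each sketch is given by the row and the value of the nonzero entry of each column, so that
looking one of them up (for a random sketch: drawing it) is one step. All cells
that hold no input are zero. -/
noncomputable def initMem {n d m₁ m₂ k : ℕ} (η : ℝ) (A : Matrix (Fin n) (Fin d) ℝ)
    (b : Fin n → ℝ) (ent : Fin (nnz A) ≃ {q : Fin n × Fin d // A q.1 q.2 ≠ 0})
    (S₁ : CSType m₁ n) (S₂ : CSType m₂ n) (T₁ T₂ : CSType k n) : Mem where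
  nv
    | 0 => n
    | 1 => d
    | 2 => nnz A
    | 3 => m₁
    | 4 => m₂
    | 5 => k
    | _ => 0
  na
    | 0 => fill fun l => ((ent l).1.1 : ℕ)
    | 1 => fill fun l => ((ent l).1.2 : ℕ)
    | 2 => fill fun i => (S₁.pos i : ℕ)
    | 3 => fill fun i => (S₂.pos i : ℕ)
    | 4 => fill fun i => (T₁.pos i : ℕ)
    | 5 => fill fun i => (T₂.pos i : ℕ)
    | _ => fun _ => 0
  ra
    | 0 => fillCol fun l => A (ent l).1.1 (ent l).1.2
    | 1 => fillCol b
    | 2 => fillCol S₁.val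
    | 3 => fillCol S₂.val
    | 4 => fillCol T₁.val
    | 5 => fillCol T₂.val
    | 6 => fillCol fun _ : Fin 1 => η
    | _ => fun _ _ => 0

/-- The result that a halted program leaves in the memory: the returned vector in column `0` of
the real array `7`, the four estimates in the real array `8`. -/
def Mem.output (s : Mem) (d : ℕ) : Output d where
  z₁₁ := s.ra 8 0 0
  z₁₂ := s.ra 8 0 1
  z₂₁ := s.ra 8 1 0
  z₂₂ := s.ra 8 1 1
  x i := s.ra 7 i 0

end HessianSketch

/-!
**Sketches embed.** Let `A = U W` with orthonormal columns in `U`. The matrix `(SU)ᵀ(SU) - 1` of a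
random Count-Sketch `S` with `m` rows has entries that are off-diagonal quadratic forms in the
signs, restricted to the pairs of columns that share a row. Its expected squared Frobenius norm is
at most `2 d² / m` (`sum_frobenius_distortion_le`), so by Markov's inequality `S` preserves inner
products on the column space of `A` up to the relative error `ε`, except with probability
`2 d² / (m ε²)` (`card_not_isEmbedding_le`). With `ε = 1 / 2` for `S₂` and `ε = η / 10` for `T₁` and
`T₂`, all three are embeddings with probability at least `0.98` (`uniformOn_isEmbedding_ge`).

**The error bound.** Put `B = S A R⁻¹`, where `T A = Q R` and `T` is an embedding, and let `x̂`
solve the program sketched by `S`. The variational inequalities of `x̂` and `x*` add up to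
`‖S A Δ‖² ≤ ⟨A x*, A Δ⟩ - ⟨S A x*, S A Δ⟩`, for `Δ = x̂ - x*`. The left-hand side is at least
`σ_min(B)² ‖R Δ‖²`, and `⟨A x*, A Δ⟩` differs by the embedding error from `⟨R x*, R Δ⟩`, which
differs from `⟨S A x*, S A Δ⟩` by at most `‖BᵀB - 1‖ ‖R x*‖ ‖R Δ‖`. Because
`1 ≤ σ_min(B)² + ‖BᵀB - 1‖` (`one_le_sigmaMin_sq_add_opNorm`), the embedding error is a small
multiple of the quantities that are present anyway, whatever the size of `σ_min(B)`
(`error_bound_scalar`, `IsEstimate.error_le`). A rank-deficient `S₁ A` has an infinite ratio and is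
never selected when `S₂` is an embedding (`isRun_of_isEmbedding`).

**The program.** One pass over the nonzero entries of `A` for each of the four sketches, and one for
`Aᵀb`, produce matrices of polynomial size. With `G = (SA)ᵀ(SA)` and `H = (TA)ᵀ(TA) = RᵀR`, the
matrix `H⁻¹G` is similar to `BᵀB`, hence `(tr (G⁻¹H)^(2^k))^(1/2^k)` and
`(tr (H⁻¹G - 1)^(2^k))^(1/2^k)` approximate `σ_min(B)⁻²` and `‖BᵀB - 1‖` up to the factor
`d^(1/2^k) ≤ 1 + η` (`isEstimate_rootTrace`). Here `k` is the number of rows of `T`, and the program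
performs `k` squarings and `k` square roots. The inverses are computed by Gauss–Jordan elimination
without pivoting, which on a singular Gram matrix returns zero, as the ratio `∞` requires
(`gaussJordan_eq_inv`). The ratios are compared by cross multiplication, and the solver is called
once (`exec_algorithmProg`, `time_le`). If a run exists but the embeddings fail, then the selected
program still has a solution (`exists_isSolution_of_isRun`).
-/

namespace HessianSketch

open Matrix

/-! ### Norms, Gram matrices and singular values -/

section Norms

variable {n m k d : ℕ}

lemma l2norm_nonneg (v : Fin k → ℝ) : 0 ≤ l2norm v := norm_nonneg _

lemma l2norm_sq (v : Fin k → ℝ) : l2norm v ^ 2 = v ⬝ᵥ v := by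
  rw [l2norm, EuclideanSpace.real_norm_sq_eq]
  simp [dotProduct, sq]

lemma l2norm_eq_zero {v : Fin k → ℝ} : l2norm v = 0 ↔ v = 0 := by
  simp [l2norm]

lemma l2norm_smul (a : ℝ) (v : Fin k → ℝ) : l2norm (a • v) = |a| * l2norm v := by
  rw [l2norm, WithLp.toLp_smul, norm_smul, Real.norm_eq_abs, l2norm]

lemma abs_dotProduct_le (v w : Fin k → ℝ) : |v ⬝ᵥ w| ≤ l2norm v * l2norm w := by
  have h := abs_real_inner_le_norm (WithLp.toLp 2 w) (WithLp.toLp 2 v)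
  rw [EuclideanSpace.inner_eq_star_dotProduct] at h
  simpa [l2norm, mul_comm] using h

lemma dotProduct_le (v w : Fin k → ℝ) : v ⬝ᵥ w ≤ l2norm v * l2norm w :=
  (le_abs_self _).trans (abs_dotProduct_le v w)

lemma opNorm_nonneg (M : Matrix (Fin d) (Fin d) ℝ) : 0 ≤ opNorm M := norm_nonneg _

lemma l2norm_mulVec_le (M : Matrix (Fin d) (Fin d) ℝ) (x : Fin d → ℝ) :
    l2norm (M *ᵥ x) ≤ opNorm M * l2norm x := by
  have h := (Matrix.toEuclideanCLM (n := Fin d) (𝕜 := ℝ) M).le_opNorm (WithLp.toLp 2 x)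
  rwa [Matrix.toEuclideanCLM_toLp] at h

lemma opNorm_le {M : Matrix (Fin d) (Fin d) ℝ} {c : ℝ} (hc : 0 ≤ c)
    (h : ∀ x, l2norm (M *ᵥ x) ≤ c * l2norm x) : opNorm M ≤ c := by
  refine ContinuousLinearMap.opNorm_le_bound _ hc fun x => ?_
  have := h x.ofLp
  rwa [l2norm, ← Matrix.toEuclideanCLM_toLp] at this

lemma abs_dotProduct_mulVec_le (M : Matrix (Fin d) (Fin d) ℝ) (x y : Fin d → ℝ) :
    |x ⬝ᵥ M *ᵥ y| ≤ opNorm M * l2norm x * l2norm y := by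
  refine (abs_dotProduct_le _ _).trans ?_
  have := mul_le_mul_of_nonneg_left (l2norm_mulVec_le M y) (l2norm_nonneg x)
  linarith

/-- The adjoint identity `⟨B x, C y⟩ = ⟨x, Bᵀ C y⟩`. -/
lemma mulVec_dotProduct_mulVec (B C : Matrix (Fin k) (Fin d) ℝ) (x y : Fin d → ℝ) :
    (B *ᵥ x) ⬝ᵥ (C *ᵥ y) = x ⬝ᵥ (Bᵀ * C) *ᵥ y := by
  rw [← Matrix.mulVec_mulVec, Matrix.dotProduct_mulVec x, Matrix.vecMul_transpose]

lemma bddBelow_sphere_image (B : Matrix (Fin k) (Fin d) ℝ) :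
    BddBelow {r : ℝ | ∃ x : Fin d → ℝ, l2norm x = 1 ∧ r = l2norm (B *ᵥ x)} :=
  ⟨0, by rintro r ⟨x, -, rfl⟩; exact l2norm_nonneg _⟩

lemma sphere_image_nonempty (hd : 0 < d) (B : Matrix (Fin k) (Fin d) ℝ) :
    {r : ℝ | ∃ x : Fin d → ℝ, l2norm x = 1 ∧ r = l2norm (B *ᵥ x)}.Nonempty :=
  ⟨_, Pi.single ⟨0, hd⟩ 1, by simp [l2norm], rfl⟩

lemma sigmaMin_nonneg (B : Matrix (Fin k) (Fin d) ℝ) : 0 ≤ sigmaMin B :=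
  Real.sInf_nonneg (by rintro r ⟨x, -, rfl⟩; exact l2norm_nonneg _)

lemma sigmaMin_mul_le (B : Matrix (Fin k) (Fin d) ℝ) (x : Fin d → ℝ) :
    sigmaMin B * l2norm x ≤ l2norm (B *ᵥ x) := by
  rcases eq_or_ne (l2norm x) 0 with h | h
  · rw [h, mul_zero]; exact l2norm_nonneg _
  · have hx : 0 < l2norm x := lt_of_le_of_ne (l2norm_nonneg _) (Ne.symm h)
    have : sigmaMin B ≤ l2norm (B *ᵥ ((l2norm x)⁻¹ • x)) :=
      csInf_le (bddBelow_sphere_image B) ⟨_, by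
        rw [l2norm_smul, abs_of_pos (inv_pos.2 hx), inv_mul_cancel₀ h], rfl⟩
    rw [Matrix.mulVec_smul, l2norm_smul, abs_of_pos (inv_pos.2 hx)] at this
    rw [← le_div_iff₀ hx, div_eq_inv_mul]
    exact this

lemma le_sigmaMin (hd : 0 < d) {B : Matrix (Fin k) (Fin d) ℝ} {c : ℝ}
    (h : ∀ x, c * l2norm x ≤ l2norm (B *ᵥ x)) : c ≤ sigmaMin B := by
  refine le_csInf (sphere_image_nonempty hd B) ?_
  rintro r ⟨x, hx, rfl⟩
  simpa [hx] using h x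

/-- A kernel vector forces `σ_min = 0`. -/
lemma sigmaMin_eq_zero {B : Matrix (Fin k) (Fin d) ℝ} {x : Fin d → ℝ} (hx : x ≠ 0)
    (h : B *ᵥ x = 0) : sigmaMin B = 0 := by
  have h1 := sigmaMin_mul_le B x
  rw [h, l2norm_eq_zero.2 rfl] at h1
  have h2 : 0 < l2norm x :=
    lt_of_le_of_ne (l2norm_nonneg _) (fun h => hx (l2norm_eq_zero.1 h.symm))
  have h3 := sigmaMin_nonneg B
  by_contra h4
  have : 0 < sigmaMin B := lt_of_le_of_ne h3 (Ne.symm h4)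
  have := mul_pos this h2
  linarith

/-- `B` is injective as soon as `σ_min(B M) ≠ 0` for some invertible `M`. -/
lemma injective_of_sigmaMin_ne_zero {B : Matrix (Fin k) (Fin d) ℝ}
    {R : Matrix (Fin d) (Fin d) ℝ} (hR : IsUnit R.det) (h : sigmaMin (B * R⁻¹) ≠ 0) :
    Function.Injective B.mulVec := by
  refine (injective_iff_map_eq_zero B.mulVecLin).2 fun x hx => ?_
  by_contra hx0
  refine h (sigmaMin_eq_zero (x := R *ᵥ x) (fun h0 => hx0 ?_) ?_)
  · have := congrArg (R⁻¹ *ᵥ ·) h0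
    simpa [Matrix.mulVec_mulVec, Matrix.nonsing_inv_mul _ hR] using this
  · simpa [Matrix.mulVec_mulVec, Matrix.mul_assoc, Matrix.nonsing_inv_mul _ hR] using hx

/-- The quadratic form of `BᵀB - 1` at a vector that nearly minimises `‖B x‖` shows that a small
least singular value comes with a large distortion. -/
lemma one_le_sigmaMin_sq_add_opNorm (hd : 0 < d) (B : Matrix (Fin k) (Fin d) ℝ) :
    1 ≤ sigmaMin B ^ 2 + opNorm (Bᵀ * B - 1) := by
  by_contra! hlt
  set p := opNorm (Bᵀ * B - 1) with hp
  have hp1 : 0 < 1 - p := by nlinarith [sq_nonneg (sigmaMin B)]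
  have : Real.sqrt (1 - p) ≤ sigmaMin B := by
    refine le_sigmaMin hd fun x => ?_
    have h1 := neg_le_of_abs_le (abs_dotProduct_mulVec_le (Bᵀ * B - 1) x x)
    rw [Matrix.sub_mulVec, dotProduct_sub, ← mulVec_dotProduct_mulVec, Matrix.one_mulVec,
      ← l2norm_sq, ← l2norm_sq] at h1
    refine abs_le_of_sq_le_sq' ?_ (l2norm_nonneg _) |>.2
    rw [mul_pow, Real.sq_sqrt hp1.le]
    nlinarith
  have h2 := mul_self_le_mul_self (Real.sqrt_nonneg _) this
  rw [Real.mul_self_sqrt hp1.le] at h2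
  nlinarith

/-- For a matrix `B` with invertible Gram matrix, `σ_min(B)² = 1 / ‖(BᵀB)⁻¹‖`. -/
lemma opNorm_inv_gram (hd : 0 < d) {B : Matrix (Fin k) (Fin d) ℝ} (hB : IsUnit (Bᵀ * B).det) :
    0 < sigmaMin B ^ 2 ∧ opNorm (Bᵀ * B)⁻¹ = (sigmaMin B ^ 2)⁻¹ := by
  set W := (Bᵀ * B)⁻¹ with hW
  have hNW : Bᵀ * B * W = 1 := Matrix.mul_nonsing_inv _ hB
  have hWN : W * (Bᵀ * B) = 1 := Matrix.nonsing_inv_mul _ hB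
  have hWT : Wᵀ = W := by
    rw [hW, Matrix.transpose_nonsing_inv, Matrix.transpose_mul, Matrix.transpose_transpose]
  have hform : ∀ x : Fin d → ℝ, l2norm ((B * W) *ᵥ x) ^ 2 = x ⬝ᵥ W *ᵥ x := by
    intro x
    rw [l2norm_sq, mulVec_dotProduct_mulVec, Matrix.transpose_mul, hWT, Matrix.mul_assoc,
      ← Matrix.mul_assoc Bᵀ, hNW, Matrix.mul_one]
  -- Cauchy–Schwarz for `⟨x, x⟩ = ⟨B W x, B x⟩`
  have hlow : ∀ x : Fin d → ℝ, l2norm x ^ 2 ≤ opNorm W * l2norm (B *ᵥ x) ^ 2 := by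
    intro x
    have h1 : l2norm x ^ 2 = ((B * W) *ᵥ x) ⬝ᵥ (B *ᵥ x) := by
      rw [mulVec_dotProduct_mulVec, Matrix.transpose_mul, hWT, Matrix.mul_assoc, hWN,
        Matrix.one_mulVec, l2norm_sq]
    have h2 := dotProduct_le ((B * W) *ᵥ x) (B *ᵥ x)
    rw [← h1] at h2
    have h3 : l2norm ((B * W) *ᵥ x) ^ 2 ≤ opNorm W * l2norm x ^ 2 := by
      rw [hform]
      have := le_of_abs_le (abs_dotProduct_mulVec_le W x x)
      linarith
    rcases (sq_nonneg (l2norm x)).eq_or_lt with h0 | h0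
    · rw [← h0]; exact mul_nonneg (opNorm_nonneg _) (sq_nonneg _)
    · have h4 : (l2norm x ^ 2) ^ 2 ≤ (opNorm W * l2norm x ^ 2) * l2norm (B *ᵥ x) ^ 2 := by
        calc (l2norm x ^ 2) ^ 2 ≤ (l2norm ((B * W) *ᵥ x) * l2norm (B *ᵥ x)) ^ 2 :=
              pow_le_pow_left₀ h0.le h2 2
          _ = l2norm ((B * W) *ᵥ x) ^ 2 * l2norm (B *ᵥ x) ^ 2 := by ring
          _ ≤ _ := by gcongr
      nlinarith
  have hpos : 0 < opNorm W := by
    refine lt_of_le_of_ne (opNorm_nonneg _) fun h0 => ?_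
    obtain ⟨-, x, hx, -⟩ := sphere_image_nonempty hd B
    have := hlow x
    rw [← h0, hx] at this
    norm_num at this
  have hle : (opNorm W)⁻¹ ≤ sigmaMin B ^ 2 := by
    have : Real.sqrt (opNorm W)⁻¹ ≤ sigmaMin B := by
      refine le_sigmaMin hd fun x => ?_
      refine abs_le_of_sq_le_sq' ?_ (l2norm_nonneg _) |>.2
      rw [mul_pow, Real.sq_sqrt (inv_nonneg.2 hpos.le), inv_mul_le_iff₀ hpos]
      exact hlow x
    have := pow_le_pow_left₀ (Real.sqrt_nonneg _) this 2
    rwa [Real.sq_sqrt (inv_nonneg.2 hpos.le)] at this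
  have hs : 0 < sigmaMin B ^ 2 := (inv_pos.2 hpos).trans_le hle
  refine ⟨hs, le_antisymm ?_ ?_⟩
  · refine opNorm_le (inv_nonneg.2 hs.le) fun x => ?_
    rw [le_inv_mul_iff₀ hs]
    have h1 := pow_le_pow_left₀ (mul_nonneg (sigmaMin_nonneg B) (l2norm_nonneg _))
      (sigmaMin_mul_le B (W *ᵥ x)) 2
    rw [Matrix.mulVec_mulVec, hform, mul_pow] at h1
    have h2 := dotProduct_le x (W *ᵥ x)
    rcases (l2norm_nonneg (W *ᵥ x)).eq_or_lt with h0 | h0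
    · rw [← h0, mul_zero]; exact l2norm_nonneg _
    · nlinarith
  · rw [inv_le_comm₀ hs hpos]
    exact hle

/-- The Gram matrix of an injective matrix is invertible. -/
lemma isUnit_det_gram {B : Matrix (Fin k) (Fin d) ℝ} (hB : Function.Injective B.mulVec) :
    IsUnit (Bᵀ * B).det := by
  have := (Matrix.PosDef.conjTranspose_mul_self B hB).isUnit
  rw [Matrix.conjTranspose_eq_transpose_of_trivial] at this
  exact (Matrix.isUnit_iff_isUnit_det _).1 this

lemma injective_of_isUnit_det_gram {B : Matrix (Fin k) (Fin d) ℝ} (hB : IsUnit (Bᵀ * B).det) :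
    Function.Injective B.mulVec := by
  have h := Matrix.mulVec_injective_iff_isUnit.2 ((Matrix.isUnit_iff_isUnit_det _).2 hB)
  intro x y hxy
  apply h
  rw [← Matrix.mulVec_mulVec, ← Matrix.mulVec_mulVec]
  exact congrArg (Bᵀ *ᵥ ·) hxy

lemma injective_of_rank_eq {A : Matrix (Fin n) (Fin d) ℝ} (h : A.rank = d) :
    Function.Injective A.mulVec := by
  rw [Matrix.mulVec_injective_iff, linearIndependent_iff_card_eq_finrank_span,
    Set.finrank, ← Matrix.rank_eq_finrank_span_cols, h, Fintype.card_fin]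

/-- An injective matrix has a QR decomposition with invertible `R`; it comes from the `LDLᵀ`
decomposition of the Gram matrix. -/
lemma exists_isQR {M : Matrix (Fin k) (Fin d) ℝ} (hM : Function.Injective M.mulVec) :
    ∃ Q R, IsQR M Q R ∧ IsUnit R.det := by
  have hS := Matrix.PosDef.conjTranspose_mul_self M hM
  set S := Mᴴ * M with hSdef
  set L := LDL.lowerInv hS with hL
  have hLdet : IsUnit L.det := (Matrix.isUnit_iff_isUnit_det _).1 (isUnit_of_invertible L)
  have hLtdet : IsUnit Lᵀ.det := by rwa [Matrix.det_transpose]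
  have hD := LDL.diag_eq_lowerInv_conj hS
  rw [Matrix.conjTranspose_eq_transpose_of_trivial] at hD
  have hpd : (L * S * Lᵀ).PosDef := by
    have := hS.mul_mul_conjTranspose_same (B := L)
      (Matrix.vecMul_injective_iff_isUnit.2 ((Matrix.isUnit_iff_isUnit_det _).2 hLdet))
    rwa [Matrix.conjTranspose_eq_transpose_of_trivial] at this
  rw [← hL] at hD
  set δ := LDL.diagEntries hS with hδ
  have hDd : L * S * Lᵀ = diagonal δ := hD.symm
  have hδpos : ∀ i, 0 < δ i := by
    intro i
    have := hpd.diag_pos (i := i)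
    rwa [hDd, diagonal_apply_eq] at this
  set s : Fin d → ℝ := fun i => Real.sqrt (δ i) with hs
  have hspos : ∀ i, 0 < s i := fun i => Real.sqrt_pos.2 (hδpos i)
  refine ⟨M * Lᵀ * diagonal (fun i => (s i)⁻¹), diagonal s * Lᵀ⁻¹, ⟨?_, ?_, ?_⟩, ?_⟩
  · have h1 : diagonal (fun i => (s i)⁻¹) * diagonal s = 1 := by
      rw [diagonal_mul_diagonal, ← diagonal_one]
      congr 1; ext i; exact inv_mul_cancel₀ (hspos i).ne'
    rw [Matrix.mul_assoc, ← Matrix.mul_assoc (diagonal _), h1, Matrix.one_mul, Matrix.mul_assoc,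
      Matrix.mul_nonsing_inv _ hLtdet, Matrix.mul_one]
  · have h1 : (M * Lᵀ * diagonal (fun i => (s i)⁻¹))ᵀ * (M * Lᵀ * diagonal (fun i => (s i)⁻¹))
        = diagonal (fun i => (s i)⁻¹) * (L * S * Lᵀ) * diagonal (fun i => (s i)⁻¹) := by
      rw [hSdef, Matrix.conjTranspose_eq_transpose_of_trivial]
      simp only [Matrix.transpose_mul, Matrix.transpose_transpose, diagonal_transpose,
        Matrix.mul_assoc]
    rw [h1, hDd, diagonal_mul_diagonal, diagonal_mul_diagonal, ← diagonal_one]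
    congr 1; ext i
    have : δ i = s i * s i := (Real.mul_self_sqrt (hδpos i).le).symm
    rw [this]
    field_simp [(hspos i).ne']
  · intro i j hij
    have htri : (Lᵀ).BlockTriangular id := fun a b hab => LDL.lowerInv_triangular hS hab
    let _ : Invertible Lᵀ := Matrix.invertibleOfIsUnitDet _ hLtdet
    have := Matrix.blockTriangular_inv_of_blockTriangular htri hij
    rw [diagonal_mul, this, mul_zero]
  · rw [Matrix.det_mul, Matrix.det_diagonal]
    refine IsUnit.mul ?_ ?_
    · exact (Finset.prod_pos fun i _ => hspos i).ne'.isUnit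
    · exact (Matrix.isUnit_nonsing_inv_det_iff).2 hLtdet

/-- A quadratic program with an injective matrix over a nonempty closed set has a solution, because
its objective is continuous and coercive. -/
lemma exists_isSolution {𝒞 : Set (Fin d → ℝ)} (hc : IsClosed 𝒞) {x₀ : Fin d → ℝ} (hx₀ : x₀ ∈ 𝒞)
    {B : Matrix (Fin k) (Fin d) ℝ} (hB : Function.Injective B.mulVec) (c : Fin d → ℝ) :
    ∃ x, IsSolution 𝒞 B c x := by
  set f : (Fin d → ℝ) → ℝ := fun x => 1 / 2 * l2norm (B *ᵥ x) ^ 2 - c ⬝ᵥ x with hf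
  have hcont : Continuous f := by
    have : f = fun x => 1 / 2 * ((B *ᵥ x) ⬝ᵥ (B *ᵥ x)) - c ⬝ᵥ x := by
      ext x; simp only [hf, l2norm_sq]
    rw [this]
    have h1 : Continuous fun x : Fin d → ℝ => B *ᵥ x :=
      continuous_const.matrix_mulVec continuous_id
    exact (continuous_const.mul (h1.dotProduct h1)).sub (continuous_const.dotProduct continuous_id)
  obtain ⟨K, hK, hanti⟩ := LinearMap.exists_antilipschitzWith B.mulVecLin
    (LinearMap.ker_eq_bot.2 hB)
  have hsup : ∀ {r : ℕ} (v : Fin r → ℝ), ‖v‖ ≤ l2norm v := by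
    intro r v
    refine (pi_norm_le_iff_of_nonneg (l2norm_nonneg v)).2 fun i => ?_
    exact PiLp.norm_apply_le (WithLp.toLp 2 v) i
  have hbd : ∀ x : Fin d → ℝ, ‖x‖ ≤ K * l2norm (B *ᵥ x) := by
    intro x
    have h := hanti.le_mul_dist x 0
    simp only [dist_zero_right, map_zero, Matrix.mulVecLin_apply] at h
    exact h.trans (mul_le_mul_of_nonneg_left (hsup _) K.2)
  set a : ℝ := ∑ i, |c i| with ha
  have ha0 : 0 ≤ a := Finset.sum_nonneg fun i _ => abs_nonneg _
  have hlin : ∀ x : Fin d → ℝ, c ⬝ᵥ x ≤ a * ‖x‖ := by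
    intro x
    rw [dotProduct, ha, Finset.sum_mul]
    refine Finset.sum_le_sum fun i _ => ?_
    calc c i * x i ≤ |c i * x i| := le_abs_self _
      _ = |c i| * ‖x i‖ := by rw [abs_mul, Real.norm_eq_abs]
      _ ≤ |c i| * ‖x‖ := by gcongr; exact norm_le_pi_norm x i
  have hK' : (0 : ℝ) < K := hK
  obtain ⟨x, hx, hmin⟩ := ContinuousOn.exists_isMinOn' (f := f) hcont.continuousOn hc hx₀ (by
    refine Filter.Eventually.filter_mono inf_le_left ?_
    filter_upwards [(tendsto_norm_cocompact_atTop (E := Fin d → ℝ)).eventually_ge_atTop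
      (2 * (K : ℝ) ^ 2 * (a + |f x₀|) + 1)] with x hx
    have h1 := hbd x
    have h2 := hlin x
    have h3 : ‖x‖ ^ 2 ≤ (K : ℝ) ^ 2 * l2norm (B *ᵥ x) ^ 2 := by
      rw [← mul_pow]; exact pow_le_pow_left₀ (norm_nonneg _) h1 2
    have h4 := le_abs_self (f x₀)
    have h5 := abs_nonneg (f x₀)
    have hx1 : 1 ≤ ‖x‖ := le_trans (by nlinarith [sq_nonneg (K : ℝ)]) hx
    have h6 : (a + |f x₀|) * ‖x‖ ≤ 1 / 2 * l2norm (B *ᵥ x) ^ 2 := by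
      have h7 : 2 * (K : ℝ) ^ 2 * (a + |f x₀|) * ‖x‖ ≤ (K : ℝ) ^ 2 * l2norm (B *ᵥ x) ^ 2 := by
        nlinarith
      have h8 : (0 : ℝ) < (K : ℝ) ^ 2 := by positivity
      nlinarith
    have h9 : |f x₀| ≤ |f x₀| * ‖x‖ := by nlinarith
    show f x₀ ≤ 1 / 2 * l2norm (B *ᵥ x) ^ 2 - c ⬝ᵥ x
    nlinarith)
  exact ⟨x, hx, fun z hz => hmin hz⟩

end Norms

end HessianSketch

namespace HessianSketch

open Matrix

/-! ### Random Count-Sketches are subspace embeddings -/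

section SecondMoment

variable {n m d k : ℕ}

/-- The sign `±1` encoded by a Boolean. -/
def boolSign (c : Bool) : ℝ := if c then 1 else -1

lemma boolSign_mul_self (c : Bool) : boolSign c * boolSign c = 1 := by
  cases c <;> simp [boolSign]

lemma boolSign_not (c : Bool) : boolSign (!c) = -boolSign c := by
  cases c <;> simp [boolSign]

/-- A function of the signs that changes sign with one of them has mean zero. -/
lemma sum_eq_zero_of_flip (i : Fin n) (F : (Fin n → Bool) → ℝ)
    (h : ∀ v, F (Function.update v i (!v i)) = -F v) : ∑ v, F v = 0 := by
  have hinv : Function.Involutive fun v : Fin n → Bool => Function.update v i (!v i) := by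
    intro v
    simp
  have h1 : ∑ v, F v = ∑ v, F (Function.update v i (!v i)) :=
    (Equiv.sum_comp hinv.toPerm F).symm
  simp only [h, Finset.sum_neg_distrib] at h1
  linarith

/-- A product of four signs has mean zero unless its factors pair up. -/
lemma sum_sign_mul_four {i j k l : Fin n} (hij : i ≠ j) (hkl : k ≠ l)
    (h1 : ¬ (i = k ∧ j = l)) (h2 : ¬ (i = l ∧ j = k)) :
    ∑ v : Fin n → Bool,
      boolSign (v i) * boolSign (v j) * (boolSign (v k) * boolSign (v l)) = 0 := by
  by_cases hi : i ≠ k ∧ i ≠ l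
  · refine sum_eq_zero_of_flip i _ fun v => ?_
    rw [Function.update_self, Function.update_of_ne hij.symm, Function.update_of_ne hi.1.symm,
      Function.update_of_ne hi.2.symm, boolSign_not]
    ring
  · have hj : j ≠ k ∧ j ≠ l := by
      constructor <;> rintro rfl <;> grind
    refine sum_eq_zero_of_flip j _ fun v => ?_
    rw [Function.update_self, Function.update_of_ne hij, Function.update_of_ne hj.1.symm,
      Function.update_of_ne hj.2.symm, boolSign_not]
    ring

/-- Second moment of an off-diagonal quadratic form in random signs. -/
lemma sum_sign_quadratic_sq_le (c : Fin n → Fin n → ℝ) (hc : ∀ i, c i i = 0) :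
    ∑ v : Fin n → Bool, (∑ i, ∑ j, c i j * (boolSign (v i) * boolSign (v j))) ^ 2 ≤
      2 ^ n * (2 * ∑ i, ∑ j, c i j ^ 2) := by
  have key : ∀ i j k l : Fin n,
      ∑ v : Fin n → Bool, (c i j * (boolSign (v i) * boolSign (v j))) *
        (c k l * (boolSign (v k) * boolSign (v l))) =
      2 ^ n * ((if i = k then if j = l then c i j * c k l else 0 else 0) +
        if i = l then if j = k then c i j * c k l else 0 else 0) := by
    intro i j k l
    have hsum : ∑ v : Fin n → Bool, (c i j * (boolSign (v i) * boolSign (v j))) *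
        (c k l * (boolSign (v k) * boolSign (v l))) = c i j * c k l *
        ∑ v : Fin n → Bool,
          boolSign (v i) * boolSign (v j) * (boolSign (v k) * boolSign (v l)) := by
      rw [Finset.mul_sum]
      exact Finset.sum_congr rfl fun v _ => by ring
    rw [hsum]
    rcases eq_or_ne i j with rfl | hij
    · simp [hc]
    rcases eq_or_ne k l with rfl | hkl
    · simp [hc]
    by_cases h1 : i = k ∧ j = l
    · obtain ⟨rfl, rfl⟩ := h1
      have : ∀ v : Fin n → Bool,
          boolSign (v i) * boolSign (v j) * (boolSign (v i) * boolSign (v j)) = 1 := fun v => by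
        rw [mul_mul_mul_comm, boolSign_mul_self, boolSign_mul_self, one_mul]
      simp [this, hij, mul_comm]
    by_cases h2 : i = l ∧ j = k
    · obtain ⟨rfl, rfl⟩ := h2
      have : ∀ v : Fin n → Bool,
          boolSign (v i) * boolSign (v j) * (boolSign (v j) * boolSign (v i)) = 1 := fun v => by
        rw [mul_comm (boolSign (v j)), mul_mul_mul_comm, boolSign_mul_self, boolSign_mul_self,
          one_mul]
      simp only [this, Finset.sum_const, Finset.card_univ, Fintype.card_fun, Fintype.card_bool,
        Fintype.card_fin, nsmul_eq_mul, hij, if_false, if_true]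
      push_cast; ring
    rw [sum_sign_mul_four hij hkl h1 h2]
    have e1 : (if i = k then if j = l then c i j * c k l else 0 else 0) = 0 := by
      split_ifs <;> tauto
    have e2 : (if i = l then if j = k then c i j * c k l else 0 else 0) = 0 := by
      split_ifs <;> tauto
    rw [e1, e2]; ring
  have expand : ∑ v : Fin n → Bool, (∑ i, ∑ j, c i j * (boolSign (v i) * boolSign (v j))) ^ 2 =
      ∑ i, ∑ j, ∑ k, ∑ l, ∑ v : Fin n → Bool, (c i j * (boolSign (v i) * boolSign (v j))) *
        (c k l * (boolSign (v k) * boolSign (v l))) := by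
    simp_rw [sq, Finset.sum_mul, Finset.mul_sum]
    rw [Finset.sum_comm]
    refine Finset.sum_congr rfl fun i _ => ?_
    rw [Finset.sum_comm]
    refine Finset.sum_congr rfl fun j _ => ?_
    rw [Finset.sum_comm]
    refine Finset.sum_congr rfl fun k _ => ?_
    rw [Finset.sum_comm]
  rw [expand]
  simp_rw [key, ← Finset.mul_sum, Finset.sum_add_distrib]
  simp only [Finset.sum_ite_eq, Finset.mem_univ, if_true, Finset.sum_ite_irrel,
    Finset.sum_const_zero]
  have hcomm : ∑ i, ∑ j, c j i ^ 2 = ∑ i, ∑ j, c i j ^ 2 := Finset.sum_comm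
  have hle : ∑ i, ∑ j, c i j * c j i ≤ ∑ i, ∑ j, (c i j ^ 2 + c j i ^ 2) / 2 :=
    Finset.sum_le_sum fun i _ => Finset.sum_le_sum fun j _ => by
      nlinarith [sq_nonneg (c i j - c j i)]
  have hsplit : ∑ i, ∑ j, (c i j ^ 2 + c j i ^ 2) / 2 = ∑ i, ∑ j, c i j ^ 2 := by
    simp_rw [add_div, Finset.sum_add_distrib, ← Finset.sum_div]
    rw [hcomm]; ring
  rw [hsplit] at hle
  have hsq : ∑ i, ∑ j, c i j * c i j = ∑ i, ∑ j, c i j ^ 2 := by simp_rw [sq]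
  gcongr
  linarith

/-- Two given columns of a random Count-Sketch share their row with probability `1/m`. -/
lemma card_collision {i j : Fin n} (hij : i ≠ j) :
    (m : ℝ) * ∑ p : Fin n → Fin m, (if p i = p j then (1 : ℝ) else 0) = (m : ℝ) ^ n := by
  have e := Equiv.sum_comp (Equiv.funSplitAt i (Fin m)).symm
    (fun p : Fin n → Fin m => if p i = p j then (1 : ℝ) else 0)
  rw [← e, Fintype.sum_prod_type_right]
  have : ∀ q : {j // j ≠ i} → Fin m, ∑ a : Fin m,
      (if (Equiv.funSplitAt i (Fin m)).symm (a, q) i = (Equiv.funSplitAt i (Fin m)).symm (a, q) j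
        then (1 : ℝ) else 0) = 1 := by
    intro q
    simp [Equiv.funSplitAt, Equiv.piSplitAt, hij.symm]
  simp_rw [this]
  have hcard := Fintype.card_congr (Equiv.funSplitAt i (Fin m))
  rw [Fintype.card_prod, Fintype.card_fin, Fintype.card_fun, Fintype.card_fin,
    Fintype.card_fin] at hcard
  rw [Finset.sum_const, Finset.card_univ, nsmul_eq_mul, mul_one]
  exact_mod_cast hcard.symm

lemma mat_mul_apply (S : CSType m n) (U : Matrix (Fin n) (Fin d) ℝ) (r : Fin m) (a : Fin d) :
    (S.mat * U) r a = ∑ i, if S.pos i = r then S.val i * U i a else 0 := by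
  simp [Matrix.mul_apply, CSType.mat]

/-- The deviation of the Gram matrix of `S U` from the identity. -/
def distortion (S : Matrix (Fin m) (Fin n) ℝ) (U : Matrix (Fin n) (Fin d) ℝ) :
    Matrix (Fin d) (Fin d) ℝ :=
  (S * U)ᵀ * (S * U) - 1

/-- The distortion of an orthonormal system under a Count-Sketch is an off-diagonal quadratic form
in the signs. -/
lemma gram_sub_one_apply {U : Matrix (Fin n) (Fin d) ℝ} (hU : Uᵀ * U = 1) (ω : CSRand m n)
    (a b : Fin d) :
    distortion ω.sketch.mat U a b =
      ∑ i, ∑ j, (if i ≠ j ∧ ω.1 i = ω.1 j then U i a * U j b else 0) *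
        (boolSign (ω.2 i) * boolSign (ω.2 j)) := by
  have h1 : ((ω.sketch.mat * U)ᵀ * (ω.sketch.mat * U)) a b =
      ∑ i, ∑ j, if ω.1 i = ω.1 j then
        boolSign (ω.2 i) * U i a * (boolSign (ω.2 j) * U j b) else 0 := by
    simp only [Matrix.mul_apply (M := (ω.sketch.mat * U)ᵀ), Matrix.transpose_apply, mat_mul_apply,
      Finset.sum_mul_sum]
    rw [Finset.sum_comm]
    refine Finset.sum_congr rfl fun i _ => ?_
    rw [Finset.sum_comm]
    refine Finset.sum_congr rfl fun j _ => ?_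
    rw [Finset.sum_eq_single (ω.1 i)]
    · simp only [CSRand.sketch, if_true, boolSign]
      by_cases h : ω.1 i = ω.1 j
      · simp [h]
      · simp [h, Ne.symm h]
    · intro r _ hr
      simp [CSRand.sketch, hr.symm]
    · simp
  have h2 : (1 : Matrix (Fin d) (Fin d) ℝ) a b = ∑ i, ∑ j, if i = j then U i a * U j b else 0 := by
    rw [← hU]; simp [Matrix.mul_apply]
  rw [distortion, Matrix.sub_apply, h1, h2, ← Finset.sum_sub_distrib]
  refine Finset.sum_congr rfl fun i _ => ?_
  rw [← Finset.sum_sub_distrib]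
  refine Finset.sum_congr rfl fun j _ => ?_
  rcases eq_or_ne i j with rfl | hij
  · have := boolSign_mul_self (ω.2 i)
    simp only [if_true, ne_eq, not_true_eq_false, false_and, if_false, zero_mul]
    linear_combination (U i a * U i b) * this
  · simp only [hij, if_false, ne_eq, not_false_eq_true, true_and, sub_zero]
    split_ifs <;> ring

/-- The expected squared Frobenius distortion of `d` orthonormal vectors under a random
Count-Sketch with `m` rows is at most `2 d² / m`. -/
lemma sum_frobenius_distortion_le (hm : 0 < m) {U : Matrix (Fin n) (Fin d) ℝ}
    (hU : Uᵀ * U = 1) :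
    (m : ℝ) * ∑ ω : CSRand m n, ∑ a, ∑ b,
      distortion ω.sketch.mat U a b ^ 2 ≤
      2 * (d : ℝ) ^ 2 * (Fintype.card (CSRand m n) : ℝ) := by
  set u : Fin n → ℝ := fun i => ∑ a, U i a ^ 2 with hu
  have hu0 : ∀ i, 0 ≤ u i := fun i => Finset.sum_nonneg fun a _ => sq_nonneg _
  have hsumu : ∑ i, u i = d := by
    rw [hu, Finset.sum_comm]
    have : ∀ a, ∑ i, U i a ^ 2 = 1 := by
      intro a
      have := congrFun (congrFun hU a) a
      rw [Matrix.mul_apply, Matrix.one_apply_eq] at this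
      rw [← this]
      exact Finset.sum_congr rfl fun i _ => by rw [Matrix.transpose_apply, sq]
    simp [this]
  have hcard : (Fintype.card (CSRand m n) : ℝ) = (m : ℝ) ^ n * 2 ^ n := by
    simp [CSRand, Fintype.card_prod]
  -- average over the signs, for fixed rows
  have hsign : ∀ p : Fin n → Fin m, ∑ v : Fin n → Bool, ∑ a, ∑ b,
      distortion (CSRand.sketch (p, v)).mat U a b ^ 2 ≤
      2 ^ n * (2 * ∑ i, ∑ j,
        (if i ≠ j then (if p i = p j then 1 else 0) * (u i * u j) else 0)) := by
    intro p
    rw [Finset.sum_comm]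
    have h1 : ∀ a, ∑ v : Fin n → Bool, ∑ b,
        distortion (CSRand.sketch (p, v)).mat U a b ^ 2 ≤
        ∑ b, 2 ^ n * (2 * ∑ i, ∑ j, (if i ≠ j ∧ p i = p j then U i a * U j b else 0) ^ 2) := by
      intro a
      rw [Finset.sum_comm]
      refine Finset.sum_le_sum fun b _ => ?_
      simp_rw [gram_sub_one_apply hU]
      exact sum_sign_quadratic_sq_le
        (fun i j => if i ≠ j ∧ p i = p j then U i a * U j b else 0) (fun i => by simp)
    refine (Finset.sum_le_sum fun a _ => h1 a).trans (le_of_eq ?_)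
    simp_rw [← Finset.mul_sum]
    congr 2
    have h2 : ∀ i j, ∑ a, ∑ b, (if i ≠ j ∧ p i = p j then U i a * U j b else 0) ^ 2 =
        if i ≠ j then (if p i = p j then 1 else 0) * (u i * u j) else 0 := by
      intro i j
      by_cases hij : i ≠ j <;> by_cases hp : p i = p j <;>
        simp [hij, hp, hu, mul_pow, Finset.sum_mul_sum]
    simp_rw [← h2]
    rw [Finset.sum_congr rfl fun a _ => Finset.sum_comm, Finset.sum_comm]
    refine Finset.sum_congr rfl fun i _ => ?_
    rw [Finset.sum_congr rfl fun a _ => Finset.sum_comm, Finset.sum_comm]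
  rw [Fintype.sum_prod_type]
  calc (m : ℝ) * ∑ p : Fin n → Fin m, ∑ v : Fin n → Bool, ∑ a, ∑ b,
        distortion (CSRand.sketch (p, v)).mat U a b ^ 2
      ≤ (m : ℝ) * ∑ p : Fin n → Fin m, 2 ^ n * (2 * ∑ i, ∑ j,
          (if i ≠ j then (if p i = p j then 1 else 0) * (u i * u j) else 0)) := by
        gcongr with p _
        exact hsign p
    _ = 2 ^ n * 2 * ∑ i, ∑ j, (if i ≠ j then (m : ℝ) ^ n * (u i * u j) else 0) := by
        have h3 : ∀ i j : Fin n, (m : ℝ) * ∑ p : Fin n → Fin m,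
            (if i ≠ j then (if p i = p j then 1 else 0) * (u i * u j) else 0) =
            if i ≠ j then (m : ℝ) ^ n * (u i * u j) else 0 := by
          intro i j
          split_ifs with hij
          · rw [← Finset.sum_mul, ← mul_assoc, card_collision hij]
          · simp
        simp_rw [← h3, ← Finset.mul_sum]
        rw [Finset.sum_comm (s := (Finset.univ : Finset (Fin n → Fin m)))]
        rw [Finset.sum_congr rfl fun i _ => Finset.sum_comm]
        ring
    _ ≤ 2 ^ n * 2 * ∑ i, ∑ j, (m : ℝ) ^ n * (u i * u j) := by
        gcongr with i _ j _
        split_ifs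
        · exact le_rfl
        · exact mul_nonneg (by positivity) (mul_nonneg (hu0 i) (hu0 j))
    _ = 2 * (d : ℝ) ^ 2 * (Fintype.card (CSRand m n) : ℝ) := by
        simp_rw [← Finset.mul_sum]
        rw [← Finset.sum_mul, hsumu, hcard]
        ring

/-- The spectral norm is at most the Frobenius norm. -/
lemma l2norm_mulVec_sq_le_frobenius (E : Matrix (Fin k) (Fin d) ℝ) (x : Fin d → ℝ) :
    l2norm (E *ᵥ x) ^ 2 ≤ (∑ a, ∑ b, E a b ^ 2) * l2norm x ^ 2 := by
  rw [l2norm_sq, dotProduct, Finset.sum_mul]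
  refine Finset.sum_le_sum fun a _ => ?_
  have h := Finset.sum_mul_sq_le_sq_mul_sq Finset.univ (E a) x
  rw [l2norm_sq]
  simp only [Matrix.mulVec, dotProduct, ← sq]
  exact h

/-- `S` preserves inner products on the column space of `A` up to the relative error `ε`. -/
def IsEmbedding (ε : ℝ) (A : Matrix (Fin n) (Fin d) ℝ) (S : Matrix (Fin m) (Fin n) ℝ) : Prop :=
  ∀ x y : Fin d → ℝ, |((S * A) *ᵥ x) ⬝ᵥ ((S * A) *ᵥ y) - (A *ᵥ x) ⬝ᵥ (A *ᵥ y)| ≤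
    ε * l2norm (A *ᵥ x) * l2norm (A *ᵥ y)

lemma IsEmbedding.abs_sq_sub_sq_le {ε : ℝ} {A : Matrix (Fin n) (Fin d) ℝ}
    {S : Matrix (Fin m) (Fin n) ℝ} (h : IsEmbedding ε A S) (x : Fin d → ℝ) :
    |l2norm ((S * A) *ᵥ x) ^ 2 - l2norm (A *ᵥ x) ^ 2| ≤ ε * l2norm (A *ᵥ x) ^ 2 := by
  have := h x x
  rw [← l2norm_sq, ← l2norm_sq] at this
  linarith

lemma IsEmbedding.injective {ε : ℝ} (hε : ε < 1) {A : Matrix (Fin n) (Fin d) ℝ}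
    {S : Matrix (Fin m) (Fin n) ℝ} (h : IsEmbedding ε A S) (hA : Function.Injective A.mulVec) :
    Function.Injective (S * A).mulVec := by
  refine (injective_iff_map_eq_zero (S * A).mulVecLin).2 fun x hx => ?_
  rw [Matrix.mulVecLin_apply] at hx
  have h1 := (abs_le.1 (h.abs_sq_sub_sq_le x)).1
  rw [hx, l2norm_eq_zero.2 rfl] at h1
  have h2 : l2norm (A *ᵥ x) = 0 := by
    by_contra hne
    have : 0 < l2norm (A *ᵥ x) ^ 2 := by positivity
    nlinarith
  exact hA ((l2norm_eq_zero.1 h2).trans (Matrix.mulVec_zero A).symm)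

lemma isEmbedding_of_frobenius_le {ε : ℝ} (hε : 0 ≤ ε) {A U : Matrix (Fin n) (Fin d) ℝ}
    {W : Matrix (Fin d) (Fin d) ℝ} (hA : A = U * W) (hU : Uᵀ * U = 1)
    {S : Matrix (Fin m) (Fin n) ℝ}
    (h : ∑ a, ∑ b, distortion S U a b ^ 2 ≤ ε ^ 2) : IsEmbedding ε A S := by
  intro x y
  have hn : ∀ x, l2norm (A *ᵥ x) = l2norm (W *ᵥ x) := fun x => by
    have : l2norm (A *ᵥ x) ^ 2 = l2norm (W *ᵥ x) ^ 2 := by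
      rw [hA, ← Matrix.mulVec_mulVec, l2norm_sq, l2norm_sq, mulVec_dotProduct_mulVec, hU,
        Matrix.one_mulVec]
    exact (pow_left_inj₀ (l2norm_nonneg _) (l2norm_nonneg _) two_ne_zero).1 this
  have he : ((S * A) *ᵥ x) ⬝ᵥ ((S * A) *ᵥ y) - (A *ᵥ x) ⬝ᵥ (A *ᵥ y) =
      (W *ᵥ x) ⬝ᵥ distortion S U *ᵥ (W *ᵥ y) := by
    rw [distortion, Matrix.sub_mulVec, dotProduct_sub, ← mulVec_dotProduct_mulVec,
      Matrix.one_mulVec, hA, ← Matrix.mul_assoc, ← Matrix.mulVec_mulVec x (S * U),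
      ← Matrix.mulVec_mulVec y (S * U), ← Matrix.mulVec_mulVec x U, ← Matrix.mulVec_mulVec y U,
      mulVec_dotProduct_mulVec U U, hU, Matrix.one_mulVec]
  rw [he, hn, hn]
  have h1 : l2norm (distortion S U *ᵥ (W *ᵥ y)) ≤ ε * l2norm (W *ᵥ y) := by
    refine abs_le_of_sq_le_sq' ?_ (mul_nonneg hε (l2norm_nonneg _)) |>.2
    rw [mul_pow]
    exact (l2norm_mulVec_sq_le_frobenius _ _).trans (by gcongr)
  refine (abs_dotProduct_le _ _).trans ?_
  have := mul_le_mul_of_nonneg_left h1 (l2norm_nonneg (W *ᵥ x))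
  linarith

open scoped Classical in
/-- Markov's inequality: the outcomes for which a Count-Sketch with `m` rows fails to be an
`ε`-embedding are at most a `2 d² / (m ε²)` part. -/
lemma card_not_isEmbedding_le (hm : 0 < m) {ε : ℝ} (hε : 0 ≤ ε)
    {A : Matrix (Fin n) (Fin d) ℝ} (hA : Function.Injective A.mulVec) :
    ((Finset.univ.filter fun ω : CSRand m n => ¬ IsEmbedding ε A ω.sketch.mat).card : ℝ) *
      (m * ε ^ 2) ≤ 2 * (d : ℝ) ^ 2 * (Fintype.card (CSRand m n) : ℝ) := by
  obtain ⟨U, W, hUW, -⟩ := exists_isQR hA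
  refine le_trans ?_ (sum_frobenius_distortion_le hm hUW.orthonormal)
  have : ((Finset.univ.filter fun ω : CSRand m n => ¬ IsEmbedding ε A ω.sketch.mat).card : ℝ) *
      ε ^ 2 ≤ ∑ ω : CSRand m n, ∑ a, ∑ b,
        distortion ω.sketch.mat U a b ^ 2 := by
    rw [← nsmul_eq_mul, ← Finset.sum_const]
    refine (Finset.sum_le_sum fun ω hω => ?_).trans
      (Finset.sum_le_sum_of_subset_of_nonneg (Finset.filter_subset _ _) fun ω _ _ =>
        Finset.sum_nonneg fun a _ => Finset.sum_nonneg fun b _ => sq_nonneg _)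
    by_contra! hlt
    exact (Finset.mem_filter.1 hω).2
      (isEmbedding_of_frobenius_le hε hUW.eq_mul hUW.orthonormal hlt.le)
  calc _ = (m : ℝ) * (_ * ε ^ 2) := by ring
    _ ≤ _ := mul_le_mul_of_nonneg_left this (Nat.cast_nonneg m)

end SecondMoment

end HessianSketch

namespace HessianSketch

open Matrix

/-! ### The error of the sketched solution -/

section ErrorBound

variable {n d m k m₁ m₂ : ℕ} {η : ℝ}

lemma nonneg_of_forall_small {g q : ℝ} (h : ∀ t : ℝ, 0 < t → t ≤ 1 → 0 ≤ t * g + t ^ 2 * q) :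
    0 ≤ g := by
  by_contra! hg
  have hq : 0 < |q| + 1 := by positivity
  set t := min 1 (-g / (2 * (|q| + 1))) with ht
  have ht0 : 0 < t := lt_min one_pos (by apply div_pos <;> linarith)
  have h1 := h t ht0 (min_le_left _ _)
  have h2 : t * (2 * (|q| + 1)) ≤ -g := by
    rw [← le_div_iff₀ (by positivity)]; exact min_le_right _ _
  have h3 : t * q ≤ t * (|q| + 1) := by
    gcongr; linarith [le_abs_self q]
  nlinarith

/-- The variational inequality at a solution of a convex quadratic program. -/
lemma IsSolution.variational {𝒞 : Set (Fin d → ℝ)} (hconv : Convex ℝ 𝒞)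
    {B : Matrix (Fin k) (Fin d) ℝ} {c x z : Fin d → ℝ} (h : IsSolution 𝒞 B c x) (hz : z ∈ 𝒞) :
    c ⬝ᵥ (z - x) ≤ (B *ᵥ x) ⬝ᵥ (B *ᵥ (z - x)) := by
  rw [← sub_nonneg]
  refine nonneg_of_forall_small (q := 1 / 2 * l2norm (B *ᵥ (z - x)) ^ 2) fun t ht0 ht1 => ?_
  have hmem : x + t • (z - x) ∈ 𝒞 :=
    hconv.add_smul_sub_mem h.1 hz ⟨ht0.le, ht1⟩
  have h1 := h.2 _ hmem
  rw [l2norm_sq, l2norm_sq, Matrix.mulVec_add, Matrix.mulVec_smul] at h1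
  simp only [add_dotProduct, dotProduct_add, smul_dotProduct, dotProduct_smul, smul_eq_mul] at h1
  rw [dotProduct_comm (B *ᵥ (z - x)) (B *ᵥ x)] at h1
  rw [l2norm_sq]
  linarith

/-- The variational inequality at a constrained least-squares minimiser. -/
lemma leastSquares_variational {𝒞 : Set (Fin d → ℝ)} (hconv : Convex ℝ 𝒞)
    {A : Matrix (Fin n) (Fin d) ℝ} {b : Fin n → ℝ} {xs z : Fin d → ℝ} (hxs : xs ∈ 𝒞)
    (hopt : ∀ x ∈ 𝒞, l2norm (A *ᵥ xs - b) ≤ l2norm (A *ᵥ x - b)) (hz : z ∈ 𝒞) :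
    b ⬝ᵥ (A *ᵥ (z - xs)) ≤ (A *ᵥ xs) ⬝ᵥ (A *ᵥ (z - xs)) := by
  have hsol : IsSolution 𝒞 A (Aᵀ *ᵥ b) xs := by
    refine ⟨hxs, fun x hx => ?_⟩
    have h1 := pow_le_pow_left₀ (l2norm_nonneg _) (hopt x hx) 2
    have hc : ∀ y, (Aᵀ *ᵥ b) ⬝ᵥ y = (A *ᵥ y) ⬝ᵥ b := fun y => by
      rw [dotProduct_comm, Matrix.dotProduct_mulVec, Matrix.vecMul_transpose]
    rw [l2norm_sq, l2norm_sq] at h1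
    rw [l2norm_sq, l2norm_sq, hc, hc]
    simp only [sub_dotProduct, dotProduct_sub] at h1
    rw [dotProduct_comm b (A *ᵥ xs), dotProduct_comm b (A *ᵥ x)] at h1
    linarith
  have := hsol.variational hconv hz
  rwa [dotProduct_comm, Matrix.dotProduct_mulVec, Matrix.vecMul_transpose, dotProduct_comm] at this

/-- The two comparisons of constants that the factor `(1 + η)⁴` pays for. -/
lemma error_constants (hη : 0 < η) (hη3 : η < 1 / 3) :
    (1 + η / 5) * (1 + η) ≤ (1 - η / 10) * (1 - η) * (1 + η) ^ 4 ∧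
    η / 10 * (1 - η) ≤ (1 - η / 10) * (1 - η) * (1 + η) ^ 4 * (4 * η) := by
  have hη2 : 0 ≤ η * (1 / 3 - η) := by nlinarith
  constructor
  · have h51 : 1 + η / 5 ≤ (1 - η / 10) * (1 - η) * (1 + η) ^ 3 := by
      have : 1 + η / 2 ≤ (1 - η) * (1 + η) ^ 3 := by
        have e3 : η ^ 3 ≤ η / 9 := by nlinarith
        have e4 : η ^ 4 ≤ η / 27 := by
          calc η ^ 4 = η ^ 3 * η := by ring
            _ ≤ η / 9 * (1 / 3) := by gcongr
            _ = η / 27 := by ring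
        linarith
      have h52 : 0 ≤ 1 - η / 10 := by linarith
      have h53 := mul_le_mul_of_nonneg_left this h52
      have h54 : 1 + η / 5 ≤ (1 - η / 10) * (1 + η / 2) := by nlinarith
      linarith
    have := mul_le_mul_of_nonneg_right h51 (by linarith : 0 ≤ 1 + η)
    linarith
  · have h61 : (1 : ℝ) ≤ (1 + η) ^ 4 := one_le_pow₀ (by linarith)
    have h60 : 0 ≤ (1 - η / 10) * (1 - η) := by apply mul_nonneg <;> linarith
    have h62 : (1 - η / 10) * (1 - η) * 1 * (4 * η) ≤
        (1 - η / 10) * (1 - η) * (1 + η) ^ 4 * (4 * η) := by gcongr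
    have h63 : 0 ≤ (1 - η) * (η * (39 / 10 - 2 / 5 * η)) := by
      apply mul_nonneg <;> [skip; apply mul_nonneg] <;> linarith
    linarith

/-- The scalar inequality behind the error bound: `t = ‖A(x̂ - x*)‖`, `a = ‖A x*‖`, while `y` and
`w` are the lengths of the images of the same vectors under the embedding, `s = σ_min²` and `p` is
the distortion. Because `s + p ≥ 1`, the embedding error `ε` is absorbed by `ε s + ε p`. -/
lemma error_bound_scalar {s p t a y w z₁ z₂ : ℝ} (hη : 0 < η) (hη3 : η < 1 / 3)
    (hs : 0 < s) (hp : 0 ≤ p) (hsp : 1 ≤ s + p) (ht : 0 ≤ t) (ha : 0 ≤ a)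
    (hmain : s * y ^ 2 ≤ η / 10 * a * t + p * w * y)
    (hyt : |y ^ 2 - t ^ 2| ≤ η / 10 * t ^ 2) (hwa : |w ^ 2 - a ^ 2| ≤ η / 10 * a ^ 2)
    (hz₁ : |z₁ - s| ≤ η * s) (hz₂ : |z₂ - p| ≤ η * p) :
    t ≤ (1 + η) ^ 4 * (z₂ / z₁ + 4 * η) * a := by
  rw [abs_le] at hyt hwa hz₁ hz₂
  have hz₁0 : 0 < z₁ := by nlinarith
  have hz₂0 : 0 ≤ z₂ := by nlinarith
  set ρ := z₂ / z₁ with hρ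
  have hρ0 : 0 ≤ ρ := div_nonneg hz₂0 hz₁0.le
  have hρz : z₂ = ρ * z₁ := by rw [hρ]; field_simp
  have hpρ : (1 - η) * p ≤ ρ * ((1 + η) * s) := by
    have : ρ * z₁ ≤ ρ * ((1 + η) * s) := by gcongr; linarith
    linarith
  rcases ht.eq_or_lt with h0 | ht0
  · rw [← h0]; positivity
  have hwy : w * y ≤ (1 + η / 10) * (a * t) := by
    refine abs_le_of_sq_le_sq' ?_ (by positivity) |>.2
    calc (w * y) ^ 2 = w ^ 2 * y ^ 2 := by ring
      _ ≤ ((1 + η / 10) * a ^ 2) * ((1 + η / 10) * t ^ 2) := by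
          gcongr <;> linarith
      _ = _ := by ring
  have h1 : s * (1 - η / 10) * t ≤ (η / 10 + p * (1 + η / 10)) * a := by
    have h2 : s * ((1 - η / 10) * t ^ 2) ≤ s * y ^ 2 := by gcongr; linarith
    have h3 : p * (w * y) ≤ p * ((1 + η / 10) * (a * t)) := by gcongr
    have h4 : (s * (1 - η / 10) * t) * t ≤ ((η / 10 + p * (1 + η / 10)) * a) * t := by nlinarith
    exact le_of_mul_le_mul_right h4 ht0
  have h2 : s * (1 - η / 10) * t ≤ (η / 10 * s + (1 + η / 5) * p) * a := by
    refine h1.trans (mul_le_mul_of_nonneg_right ?_ ha)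
    nlinarith
  have h3 : s * ((1 - η / 10) * (1 - η) * t) ≤
      s * ((η / 10 * (1 - η) + (1 + η / 5) * (1 + η) * ρ) * a) := by
    have h4 : (1 - η) * (s * (1 - η / 10) * t) ≤
        (1 - η) * ((η / 10 * s + (1 + η / 5) * p) * a) :=
      mul_le_mul_of_nonneg_left h2 (by linarith)
    have h5 : (1 + η / 5) * a * ((1 - η) * p) ≤ (1 + η / 5) * a * (ρ * ((1 + η) * s)) := by
      gcongr
    linarith
  have h4 : (1 - η / 10) * (1 - η) * t ≤
      (η / 10 * (1 - η) + (1 + η / 5) * (1 + η) * ρ) * a := le_of_mul_le_mul_left h3 hs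
  have hc : 0 < (1 - η / 10) * (1 - η) := by apply mul_pos <;> linarith
  obtain ⟨h5, h6⟩ := error_constants hη hη3
  have h7 : (1 - η / 10) * (1 - η) * t ≤
      (1 - η / 10) * (1 - η) * ((1 + η) ^ 4 * (ρ + 4 * η) * a) := by
    refine h4.trans ?_
    have := mul_le_mul_of_nonneg_right h5 hρ0
    have h8 : η / 10 * (1 - η) + (1 + η / 5) * (1 + η) * ρ ≤
        (1 - η / 10) * (1 - η) * (1 + η) ^ 4 * (ρ + 4 * η) := by linarith
    have := mul_le_mul_of_nonneg_right h8 ha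
    linarith
  exact le_of_mul_le_mul_left h7 hc

lemma isUnit_det_gram_mul_inv {B : Matrix (Fin k) (Fin d) ℝ} {R : Matrix (Fin d) (Fin d) ℝ}
    (hR : IsUnit R.det) (hB : Function.Injective B.mulVec) :
    IsUnit ((B * R⁻¹)ᵀ * (B * R⁻¹)).det := by
  have h := isUnit_det_gram hB
  have hRi : IsUnit (R⁻¹).det := Matrix.isUnit_nonsing_inv_det_iff.2 hR
  have : (B * R⁻¹)ᵀ * (B * R⁻¹) = (R⁻¹)ᵀ * (Bᵀ * B) * R⁻¹ := by
    simp only [Matrix.transpose_mul, Matrix.mul_assoc]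
  rw [this, Matrix.det_mul, Matrix.det_mul, Matrix.det_transpose]
  exact (hRi.mul h).mul hRi

/-- An estimate certifies rank deficiency: its ratio is infinite exactly if `S A` is not
injective. -/
lemma IsEstimate.ratio_eq_top_iff (hd : 0 < d) (hη : 0 < η) (hη3 : η < 1 / 3)
    {A : Matrix (Fin n) (Fin d) ℝ} {S : Matrix (Fin m) (Fin n) ℝ} {T : Matrix (Fin k) (Fin n) ℝ}
    {z₁ z₂ : ℝ} (h : IsEstimate η A S T z₁ z₂) :
    ratio z₂ z₁ = ⊤ ↔ ¬ Function.Injective (S * A).mulVec := by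
  obtain ⟨Q, R, -, hR, h1, h2⟩ := h
  have hnn := opNorm_nonneg ((S * A * R⁻¹)ᵀ * (S * A * R⁻¹) - 1)
  have hsum := one_le_sigmaMin_sq_add_opNorm hd (S * A * R⁻¹)
  rw [abs_le] at h1 h2
  constructor
  · intro ht hinj
    have hs := (opNorm_inv_gram hd (isUnit_det_gram_mul_inv hR hinj)).1
    have hz : 0 < z₁ := by nlinarith
    exact (ENNReal.div_lt_top ENNReal.ofReal_ne_top (by simpa using hz)).ne ht
  · intro hinj
    have hs : sigmaMin (S * A * R⁻¹) = 0 := by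
      by_contra hne
      exact hinj (injective_of_sigmaMin_ne_zero hR hne)
    rw [hs] at h1 hsum
    have hz₁ : z₁ = 0 := by linarith
    have hz₂ : 0 < z₂ := by nlinarith
    rw [ratio, hz₁, ENNReal.ofReal_zero, ENNReal.div_zero]
    simpa using hz₂

lemma IsEstimate.exists_isSolution (hd : 0 < d) (hη : 0 < η) (hη3 : η < 1 / 3)
    {A : Matrix (Fin n) (Fin d) ℝ} {S : Matrix (Fin m) (Fin n) ℝ} {T : Matrix (Fin k) (Fin n) ℝ}
    {z₁ z₂ : ℝ} (h : IsEstimate η A S T z₁ z₂) (hr : ratio z₂ z₁ ≠ ⊤)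
    {𝒞 : Set (Fin d → ℝ)} (hc : IsClosed 𝒞) {x₀ : Fin d → ℝ} (hx₀ : x₀ ∈ 𝒞) (c : Fin d → ℝ) :
    ∃ x, IsSolution 𝒞 (S * A) c x := by
  refine HessianSketch.exists_isSolution hc hx₀ ?_ c
  by_contra hinj
  exact hr ((h.ratio_eq_top_iff hd hη hη3).2 hinj)

lemma exists_isEstimate (hη : 0 < η) {A : Matrix (Fin n) (Fin d) ℝ} (S : Matrix (Fin m) (Fin n) ℝ)
    {T : Matrix (Fin k) (Fin n) ℝ} (hT : Function.Injective (T * A).mulVec) :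
    ∃ z₁ z₂, IsEstimate η A S T z₁ z₂ := by
  obtain ⟨Q, R, hQR, hR⟩ := exists_isQR hT
  refine ⟨sigmaMin (S * A * R⁻¹) ^ 2, opNorm ((S * A * R⁻¹)ᵀ * (S * A * R⁻¹) - 1),
    Q, R, hQR, hR, ?_, ?_⟩
  · rw [sub_self, abs_zero]; positivity
  · rw [sub_self, abs_zero]; exact mul_nonneg hη.le (opNorm_nonneg _)

lemma toReal_ratio {a b : ℝ} (ha : 0 ≤ a) (hb : 0 ≤ b) : (ratio a b).toReal = a / b := by
  rw [ratio, ENNReal.toReal_div, ENNReal.toReal_ofReal ha, ENNReal.toReal_ofReal hb]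

/-- If `T` is an embedding, the solution of the program sketched by `S` has an error controlled by
the ratio of the two estimates for `S`. -/
lemma IsEstimate.error_le (hd : 0 < d) (hη : 0 < η) (hη3 : η < 1 / 3)
    {A : Matrix (Fin n) (Fin d) ℝ} {S : Matrix (Fin m) (Fin n) ℝ} {T : Matrix (Fin k) (Fin n) ℝ}
    {z₁ z₂ : ℝ} (h : IsEstimate η A S T z₁ z₂) (hr : ratio z₂ z₁ ≠ ⊤)
    (hT : IsEmbedding (η / 10) A T) {𝒞 : Set (Fin d → ℝ)} (hconv : Convex ℝ 𝒞) {b : Fin n → ℝ}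
    {xs x : Fin d → ℝ} (hxs : xs ∈ 𝒞)
    (hopt : ∀ x ∈ 𝒞, l2norm (A *ᵥ xs - b) ≤ l2norm (A *ᵥ x - b))
    (hx : IsSolution 𝒞 (S * A) (Aᵀ *ᵥ b) x) :
    l2norm (A *ᵥ (x - xs)) ≤
      (1 + η) ^ 4 * ((ratio z₂ z₁).toReal + 4 * η) * l2norm (A *ᵥ xs) := by
  have hinj : Function.Injective (S * A).mulVec := by
    by_contra hinj
    exact hr ((h.ratio_eq_top_iff hd hη hη3).2 hinj)
  obtain ⟨Q, R, hQR, hR, h1, h2⟩ := h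
  set B := S * A * R⁻¹ with hB
  have hs : 0 < sigmaMin B ^ 2 := (opNorm_inv_gram hd (isUnit_det_gram_mul_inv hR hinj)).1
  have hp := opNorm_nonneg (Bᵀ * B - 1)
  have hsum := one_le_sigmaMin_sq_add_opNorm hd B
  have hz₁ : 0 ≤ z₁ := by have := (abs_le.1 h1).1; nlinarith
  have hz₂ : 0 ≤ z₂ := by have := (abs_le.1 h2).1; nlinarith
  rw [toReal_ratio hz₂ hz₁]
  set Δ := x - xs with hΔ
  have hSA : ∀ y, (S * A) *ᵥ y = B *ᵥ (R *ᵥ y) := fun y => by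
    rw [Matrix.mulVec_mulVec, hB, Matrix.mul_assoc, Matrix.nonsing_inv_mul _ hR, Matrix.mul_one]
  have hTdot : ∀ y z, ((T * A) *ᵥ y) ⬝ᵥ ((T * A) *ᵥ z) = (R *ᵥ y) ⬝ᵥ (R *ᵥ z) := fun y z => by
    rw [hQR.eq_mul, ← Matrix.mulVec_mulVec, ← Matrix.mulVec_mulVec, mulVec_dotProduct_mulVec,
      hQR.orthonormal, Matrix.one_mulVec]
  have hTn : ∀ y, |l2norm (R *ᵥ y) ^ 2 - l2norm (A *ᵥ y) ^ 2| ≤ η / 10 * l2norm (A *ᵥ y) ^ 2 :=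
    fun y => by
      have := hT.abs_sq_sub_sq_le y
      rwa [l2norm_sq ((T * A) *ᵥ y), hTdot, ← l2norm_sq] at this
  refine error_bound_scalar hη hη3 hs hp hsum (l2norm_nonneg _) (l2norm_nonneg _)
    (y := l2norm (R *ᵥ Δ)) (w := l2norm (R *ᵥ xs)) ?_ (hTn Δ) (hTn xs) h1 h2
  have v1 := hx.variational hconv hxs
  have v2 := leastSquares_variational hconv hxs hopt hx.1
  have hneg : xs - x = -Δ := by rw [hΔ, neg_sub]
  rw [hneg, Matrix.mulVec_neg, dotProduct_neg, dotProduct_neg, dotProduct_comm (Aᵀ *ᵥ b),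
    Matrix.dotProduct_mulVec, Matrix.vecMul_transpose, dotProduct_comm _ b] at v1
  have hxe : x = xs + Δ := by rw [hΔ]; abel
  have v3 : ((S * A) *ᵥ x) ⬝ᵥ ((S * A) *ᵥ Δ) =
      ((S * A) *ᵥ xs) ⬝ᵥ ((S * A) *ᵥ Δ) + l2norm ((S * A) *ᵥ Δ) ^ 2 := by
    conv_lhs => rw [hxe]
    rw [Matrix.mulVec_add, add_dotProduct, l2norm_sq]
  have e1 := le_of_abs_le ((abs_sub_comm _ _).trans_le (hT xs Δ))
  rw [hTdot] at e1
  have e2 := (abs_le.1 (abs_dotProduct_mulVec_le (Bᵀ * B - 1) (R *ᵥ xs) (R *ᵥ Δ))).1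
  rw [Matrix.sub_mulVec, dotProduct_sub, ← mulVec_dotProduct_mulVec, Matrix.one_mulVec, ← hSA,
    ← hSA] at e2
  have e3 := pow_le_pow_left₀ (mul_nonneg (sigmaMin_nonneg B) (l2norm_nonneg _))
    (sigmaMin_mul_le B (R *ᵥ Δ)) 2
  rw [← hSA, mul_pow] at e3
  linarith

/-- A run of the algorithm exists, and obeys the error bound, if the three random sketches embed
the column space of `A`. -/
lemma isRun_of_isEmbedding (hd : 0 < d) (hη : 0 < η) (hη3 : η < 1 / 3)
    {A : Matrix (Fin n) (Fin d) ℝ} (hA : Function.Injective A.mulVec)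
    {S₁ : Matrix (Fin m₁) (Fin n) ℝ} {S₂ : Matrix (Fin m₂) (Fin n) ℝ}
    {T₁ T₂ : Matrix (Fin k) (Fin n) ℝ} (hS₂ : IsEmbedding (1 / 2) A S₂)
    (hT₁ : IsEmbedding (η / 10) A T₁) (hT₂ : IsEmbedding (η / 10) A T₂)
    {𝒞 : Set (Fin d → ℝ)} (hconv : Convex ℝ 𝒞) (hclosed : IsClosed 𝒞) {b : Fin n → ℝ}
    {xs : Fin d → ℝ} (hxs : xs ∈ 𝒞)
    (hopt : ∀ x ∈ 𝒞, l2norm (A *ᵥ xs - b) ≤ l2norm (A *ᵥ x - b)) :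
    (∃ o : Output d, IsRun η A b 𝒞 S₁ S₂ T₁ T₂ o) ∧
      ∀ o : Output d, IsRun η A b 𝒞 S₁ S₂ T₁ T₂ o →
        min (ratio o.z₁₂ o.z₁₁) (ratio o.z₂₂ o.z₂₁) ≠ ⊤ ∧
        l2norm (A *ᵥ (o.x - xs)) ≤
          (1 + η) ^ 4 * ((min (ratio o.z₁₂ o.z₁₁) (ratio o.z₂₂ o.z₂₁)).toReal + 4 * η) *
            l2norm (A *ᵥ xs) := by
  have hSA := hS₂.injective (by norm_num) hA
  constructor
  · obtain ⟨z₁₁, z₁₂, h₁⟩ := exists_isEstimate hη S₁ (hT₁.injective (by linarith) hA)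
    obtain ⟨z₂₁, z₂₂, h₂⟩ := exists_isEstimate hη S₂ (hT₂.injective (by linarith) hA)
    by_cases hlt : ratio z₁₂ z₁₁ < ratio z₂₂ z₂₁
    · obtain ⟨x, hx⟩ := h₁.exists_isSolution hd hη hη3 hlt.ne_top hclosed hxs (Aᵀ *ᵥ b)
      exact ⟨⟨z₁₁, z₁₂, z₂₁, z₂₂, x⟩, h₁, h₂, fun _ => hx, fun h => absurd hlt h⟩
    · obtain ⟨x, hx⟩ := exists_isSolution hclosed hxs hSA (Aᵀ *ᵥ b)
      exact ⟨⟨z₁₁, z₁₂, z₂₁, z₂₂, x⟩, h₁, h₂, fun h => absurd h hlt, fun _ => hx⟩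
  · rintro o ⟨h₁, h₂, hlt, hge⟩
    have hr₂ : ratio o.z₂₂ o.z₂₁ ≠ ⊤ := fun h => (h₂.ratio_eq_top_iff hd hη hη3).1 h hSA
    refine ⟨ne_top_of_le_ne_top hr₂ (min_le_right _ _), ?_⟩
    by_cases h : ratio o.z₁₂ o.z₁₁ < ratio o.z₂₂ o.z₂₁
    · rw [min_eq_left h.le]
      exact h₁.error_le hd hη hη3 h.ne_top hT₁ hconv hxs hopt (hlt h)
    · rw [min_eq_right (not_lt.1 h)]
      exact h₂.error_le hd hη hη3 hr₂ hT₂ hconv hxs hopt (hge h)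

/-- With `30000 d²` and `30000 (d / η)²` rows, all three random sketches are embeddings with
probability at least `0.98`. -/
lemma uniformOn_isEmbedding_ge {η : ℝ} (hd : 0 < d) (hη : 0 < η) {A : Matrix (Fin n) (Fin d) ℝ}
    (hA : Function.Injective A.mulVec) (hm : 0 < m) (hk : 0 < k) (hmd : 30000 * d ^ 2 ≤ m)
    (hkd : (30000 : ℝ) * (d / η) ^ 2 ≤ k)
    {E : Set (CSRand m n × CSRand k n × CSRand k n)}
    (hE : ∀ ω : CSRand m n × CSRand k n × CSRand k n, IsEmbedding (1 / 2) A ω.1.sketch.mat →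
      IsEmbedding (η / 10) A ω.2.1.sketch.mat → IsEmbedding (η / 10) A ω.2.2.sketch.mat →
      ω ∈ E) :
    ENNReal.ofReal 0.98 ≤ ProbabilityTheory.uniformOn Set.univ E := by
  classical
  set G₁ := Finset.univ.filter fun ω : CSRand m n => ¬ IsEmbedding (1 / 2) A ω.sketch.mat with hG₁
  set G₂ := Finset.univ.filter fun ω : CSRand k n => ¬ IsEmbedding (η / 10) A ω.sketch.mat with hG₂
  set a : ℝ := (Fintype.card (CSRand m n) : ℝ) with ha
  set c : ℝ := (Fintype.card (CSRand k n) : ℝ) with hc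
  have hd' : (0 : ℝ) < d := by exact_mod_cast hd
  have hd1 : (0 : ℝ) < (d : ℝ) ^ 2 := by positivity
  have ha0 : 0 < a := by
    have : Nonempty (Fin m) := ⟨⟨0, hm⟩⟩
    exact Nat.cast_pos.2 Fintype.card_pos
  have hc0 : 0 < c := by
    have : Nonempty (Fin k) := ⟨⟨0, hk⟩⟩
    exact Nat.cast_pos.2 Fintype.card_pos
  -- the failure probability `2 d² / (m ε²)` is at most `2 / 7500` for `ε = 1 / 2`, and at most
  -- `2 / 300` for `ε = η / 10`
  have h₁ : (G₁.card : ℝ) ≤ a / 1000 := by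
    have h := card_not_isEmbedding_le hm (ε := 1 / 2) (by norm_num) hA
    have hmd' : (30000 : ℝ) * d ^ 2 ≤ m := by exact_mod_cast hmd
    have h2 : (G₁.card : ℝ) * (7500 * d ^ 2) ≤ 2 * d ^ 2 * a :=
      le_trans (mul_le_mul_of_nonneg_left (by linarith) (Nat.cast_nonneg _)) h
    have : (d : ℝ) ^ 2 * (G₁.card * 7500) ≤ d ^ 2 * (2 * a) := by linarith
    have := le_of_mul_le_mul_left this hd1
    linarith
  have h₂ : (G₂.card : ℝ) ≤ c * (7 / 1000) := by
    have h := card_not_isEmbedding_le hk (ε := η / 10) (by positivity) hA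
    have h2 : (300 : ℝ) * d ^ 2 ≤ k * (η / 10) ^ 2 := by
      calc (300 : ℝ) * d ^ 2 = 30000 * (d / η) ^ 2 * (η / 10) ^ 2 := by field_simp; ring
        _ ≤ _ := by gcongr
    have h3 : (G₂.card : ℝ) * (300 * d ^ 2) ≤ 2 * d ^ 2 * c :=
      le_trans (by gcongr) h
    have : (d : ℝ) ^ 2 * (G₂.card * 300) ≤ d ^ 2 * (2 * c) := by linarith
    have := le_of_mul_le_mul_left this hd1
    linarith
  rw [ProbabilityTheory.uniformOn_univ]
  set F : Finset (CSRand m n × CSRand k n × CSRand k n) := Finset.univ.filter (· ∈ E) with hF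
  have hEF : E = (F : Set _) := by ext; simp [hF]
  rw [hEF, MeasureTheory.Measure.count_apply_finset]
  have hcover : (Finset.univ : Finset (CSRand m n × CSRand k n × CSRand k n)) ⊆
      F ∪ (G₁ ×ˢ Finset.univ ∪ (Finset.univ ×ˢ (G₂ ×ˢ Finset.univ) ∪
        Finset.univ ×ˢ (Finset.univ ×ˢ G₂))) := by
    intro ω _
    simp only [Finset.mem_union, Finset.mem_product, Finset.mem_univ, true_and, and_true, hF, hG₁,
      hG₂, Finset.mem_filter]
    have := hE ω
    tauto
  have hcard := (Finset.card_le_card hcover).trans ((Finset.card_union_le _ _).trans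
    (Nat.add_le_add_left ((Finset.card_union_le _ _).trans
      (Nat.add_le_add_left (Finset.card_union_le _ _) _)) _))
  simp only [Finset.card_product, Finset.card_univ] at hcard
  have hcardR : (Fintype.card (CSRand m n × CSRand k n × CSRand k n) : ℝ) ≤
      F.card + (G₁.card * (c * c) + (a * (G₂.card * c) + a * (c * G₂.card))) := by
    have hprod : Fintype.card (CSRand k n × CSRand k n) =
        Fintype.card (CSRand k n) * Fintype.card (CSRand k n) := Fintype.card_prod _ _
    rw [hprod] at hcard
    rw [ha, hc]
    exact_mod_cast hcard
  have htot : (Fintype.card (CSRand m n × CSRand k n × CSRand k n) : ℝ) = a * (c * c) := by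
    rw [Fintype.card_prod (CSRand m n) (CSRand k n × CSRand k n),
      Fintype.card_prod (CSRand k n) (CSRand k n), Nat.cast_mul, Nat.cast_mul]
  have hFr : 0.98 * (a * (c * c)) ≤ (F.card : ℝ) := by
    rw [htot] at hcardR
    have e1 : (G₁.card : ℝ) * (c * c) ≤ a / 1000 * (c * c) := by gcongr
    have e2 : a * ((G₂.card : ℝ) * c) ≤ a * (c * (7 / 1000) * c) := by gcongr
    have e3 : a * (c * (G₂.card : ℝ)) ≤ a * (c * (c * (7 / 1000))) := by gcongr
    norm_num
    nlinarith
  have hne : Fintype.card (CSRand m n × CSRand k n × CSRand k n) ≠ 0 := by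
    intro h0
    rw [h0, Nat.cast_zero] at htot
    exact absurd htot (by positivity)
  rw [ENNReal.le_div_iff_mul_le (Or.inl (Nat.cast_ne_zero.2 hne))
    (Or.inl (ENNReal.natCast_ne_top _))]
  have : (Fintype.card (CSRand m n × CSRand k n × CSRand k n) : ENNReal) =
      ENNReal.ofReal (a * (c * c)) := by
    rw [← htot, ENNReal.ofReal_natCast]
  rw [this, ← ENNReal.ofReal_mul (by norm_num), ← ENNReal.ofReal_natCast]
  exact ENNReal.ofReal_le_ofReal hFr

end ErrorBound

end HessianSketch

namespace HessianSketch

open Matrix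

/-! ### Exact inversion and power iteration -/

section Numerics

variable {n d m k : ℕ} {η : ℝ}

/-- One step of Gauss–Jordan elimination on the `j`-th column of `G`, applied to the accumulated
product `X` of the elimination matrices. A vanishing pivot turns `X` into the zero matrix. -/
noncomputable def gaussJordanStep (G : Matrix (Fin d) (Fin d) ℝ) (j : Fin d)
    (X : Matrix (Fin d) (Fin d) ℝ) : Matrix (Fin d) (Fin d) ℝ :=
  fun i l => (X * G) j j * ((X * G) j j)⁻¹ * X i l -
    ((X * G) i j - (1 : Matrix (Fin d) (Fin d) ℝ) i j) * ((X * G) j j)⁻¹ * X j l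

/-- The product of the first `t` elimination matrices. -/
noncomputable def gaussJordan (G : Matrix (Fin d) (Fin d) ℝ) : ℕ → Matrix (Fin d) (Fin d) ℝ
  | 0 => 1
  | t + 1 => if h : t < d then gaussJordanStep G ⟨t, h⟩ (gaussJordan G t) else gaussJordan G t

/-- The matrix whose first `t` columns are those of `G` and whose other columns are those of the
identity; the elimination inverts these matrices one after the other. -/
def leadingColumns (G : Matrix (Fin d) (Fin d) ℝ) (t : ℕ) : Matrix (Fin d) (Fin d) ℝ :=
  fun i l => if (l : ℕ) < t then G i l else (1 : Matrix (Fin d) (Fin d) ℝ) i l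

lemma mul_leadingColumns_apply (X G : Matrix (Fin d) (Fin d) ℝ) (t : ℕ) (i l : Fin d) :
    (X * leadingColumns G t) i l = if (l : ℕ) < t then (X * G) i l else X i l := by
  split_ifs with h
  · simp [Matrix.mul_apply, leadingColumns, h]
  · simp [Matrix.mul_apply, leadingColumns, h, Matrix.one_apply]

lemma gaussJordanStep_mul {G X : Matrix (Fin d) (Fin d) ℝ} {j : Fin d}
    (hX : X * leadingColumns G j = 1) (hp : (X * G) j j ≠ 0) :
    gaussJordanStep G j X * leadingColumns G (j + 1) = 1 := by
  have hlow : ∀ i l : Fin d, l ≠ j → (X * leadingColumns G (j + 1)) i l =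
      (1 : Matrix (Fin d) (Fin d) ℝ) i l := by
    intro i l hl
    rw [← hX, mul_leadingColumns_apply, mul_leadingColumns_apply]
    have : (l : ℕ) ≠ j := fun h => hl (Fin.ext h)
    have : (l : ℕ) < j + 1 ↔ (l : ℕ) < j := by omega
    simp only [this]
  have hat : ∀ i, (X * leadingColumns G (j + 1)) i j = (X * G) i j := fun i => by
    rw [mul_leadingColumns_apply, if_pos (Nat.lt_succ_self _)]
  ext i l
  have h1 : (gaussJordanStep G j X * leadingColumns G (j + 1)) i l =
      (X * G) j j * ((X * G) j j)⁻¹ * (X * leadingColumns G (j + 1)) i l -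
      ((X * G) i j - (1 : Matrix (Fin d) (Fin d) ℝ) i j) * ((X * G) j j)⁻¹ *
        (X * leadingColumns G (j + 1)) j l := by
    rw [Matrix.mul_apply, Matrix.mul_apply (M := X) (N := leadingColumns G (j + 1)) (i := i),
      Matrix.mul_apply (M := X) (N := leadingColumns G (j + 1)) (i := j), Finset.mul_sum,
      Finset.mul_sum, ← Finset.sum_sub_distrib]
    exact Finset.sum_congr rfl fun a _ => by simp only [gaussJordanStep]; ring
  rw [h1, mul_inv_cancel₀ hp]
  rcases eq_or_ne l j with rfl | hl
  · rw [hat, hat, mul_assoc _ _ ((X * G) l l), inv_mul_cancel₀ hp]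
    ring
  · rw [hlow i l hl, hlow j l hl, Matrix.one_apply_ne hl.symm]
    ring

lemma gaussJordan_mul_or_eq_zero (G : Matrix (Fin d) (Fin d) ℝ) {t : ℕ} (ht : t ≤ d) :
    gaussJordan G t * leadingColumns G t = 1 ∨ gaussJordan G t = 0 := by
  induction t with
  | zero =>
    left
    ext i l
    simp [gaussJordan, leadingColumns]
  | succ t ih =>
    have htd : t < d := ht
    rw [gaussJordan, dif_pos htd]
    rcases ih htd.le with h | h
    · by_cases hp : (gaussJordan G t * G) ⟨t, htd⟩ ⟨t, htd⟩ = 0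
      · right
        ext i l
        simp [gaussJordanStep, hp]
      · exact Or.inl (gaussJordanStep_mul (j := ⟨t, htd⟩) h hp)
    · right
      ext i l
      simp [gaussJordanStep, h]

/-- Positive definiteness keeps the pivots away from zero: a kernel vector of `leadingColumns G t`,
cut off after `t` coordinates, is isotropic for `G`. -/
lemma leadingColumns_mulVec_injective {G : Matrix (Fin d) (Fin d) ℝ} (hG : G.PosDef) (t : ℕ) :
    Function.Injective (leadingColumns G t).mulVec := by
  refine (injective_iff_map_eq_zero (leadingColumns G t).mulVecLin).2 fun y hy => ?_
  rw [Matrix.mulVecLin_apply] at hy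
  set y' : Fin d → ℝ := fun l => if (l : ℕ) < t then y l else 0 with hy'
  have hcoord : ∀ i, (leadingColumns G t *ᵥ y) i =
      (G *ᵥ y') i + if (i : ℕ) < t then 0 else y i := by
    intro i
    have : ∀ l, leadingColumns G t i l * y l =
        G i l * y' l + if i = l then (if (i : ℕ) < t then 0 else y i) else 0 := by
      intro l
      rcases eq_or_ne i l with rfl | hil
      · by_cases h : (i : ℕ) < t <;> simp [leadingColumns, hy', h]
      · by_cases h : (l : ℕ) < t <;> simp [leadingColumns, hy', h, hil]
    simp only [Matrix.mulVec, dotProduct, this, Finset.sum_add_distrib, Finset.sum_ite_eq,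
      Finset.mem_univ, if_true]
  have hzero : y' = 0 := by
    by_contra hne
    have hpos := hG.dotProduct_mulVec_pos hne
    have : star y' ⬝ᵥ G *ᵥ y' = 0 := by
      refine Finset.sum_eq_zero fun i _ => ?_
      by_cases h : (i : ℕ) < t
      · have := hcoord i
        rw [hy, if_pos h, Pi.zero_apply, add_zero] at this
        rw [← this, mul_zero]
      · simp [hy', h]
    linarith
  ext i
  by_cases h : (i : ℕ) < t
  · have := congrFun hzero i
    simpa [hy', h] using this
  · have := hcoord i
    rw [hy, hzero, if_neg h] at this
    simpa using this.symm

/-- For a positive semidefinite matrix, elimination without pivoting computes the inverse, and the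
zero matrix if there is no inverse. -/
lemma gaussJordan_eq_inv {G : Matrix (Fin d) (Fin d) ℝ} (hG : G.PosSemidef) :
    gaussJordan G d = G⁻¹ := by
  have hfull : leadingColumns G d = G := by
    ext i l
    simp [leadingColumns]
  have hor := gaussJordan_mul_or_eq_zero G le_rfl
  rw [hfull] at hor
  by_cases hu : IsUnit G
  · have hpd := hG.posDef_iff_isUnit.2 hu
    have hmul : ∀ t ≤ d, gaussJordan G t * leadingColumns G t = 1 := by
      intro t
      induction t with
      | zero => intro _; ext i l; simp [gaussJordan, leadingColumns]
      | succ t ih =>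
        intro ht
        have htd : t < d := ht
        rw [gaussJordan, dif_pos htd]
        have h := ih htd.le
        refine gaussJordanStep_mul (j := ⟨t, htd⟩) h fun hp => ?_
        -- a zero pivot makes a row of `X * leadingColumns G (t + 1)` vanish
        have hX : IsUnit (gaussJordan G t) := IsUnit.of_mul_eq_one _ h
        have hB := Matrix.mulVec_injective_iff_isUnit.1
          (leadingColumns_mulVec_injective hpd (t + 1))
        have hdet := (Matrix.isUnit_iff_isUnit_det _).1 (hX.mul hB)
        refine hdet.ne_zero (Matrix.det_eq_zero_of_row_eq_zero ⟨t, htd⟩ fun l => ?_)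
        rw [mul_leadingColumns_apply]
        by_cases hl : (l : ℕ) = t
        · have : l = ⟨t, htd⟩ := Fin.ext hl
          rw [if_pos (by omega), this]
          exact hp
        · have h2 : (gaussJordan G t * leadingColumns G t) ⟨t, htd⟩ l = 0 := by
            rw [h, Matrix.one_apply_ne]
            exact fun h3 => hl (congrArg Fin.val h3).symm
          rw [mul_leadingColumns_apply] at h2
          have : (l : ℕ) < t + 1 ↔ (l : ℕ) < t := by omega
          simpa only [this] using h2
    have := hmul d le_rfl
    rw [hfull] at this
    exact (Matrix.inv_eq_left_inv this).symm
  · rw [Matrix.nonsing_inv_apply_not_isUnit _ fun h => hu ((Matrix.isUnit_iff_isUnit_det _).2 h)]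
    exact hor.resolve_left fun h => hu (IsUnit.of_mul_eq_one_right _ h)

/-- The norm estimate `(tr M^(2^k))^(1/2^k)`, computed by `k` squarings and `k` square roots. -/
noncomputable def rootTrace (k : ℕ) (M : Matrix (Fin d) (Fin d) ℝ) : ℝ :=
  Real.sqrt^[k] (M ^ 2 ^ k).trace

lemma iterate_sqrt_nonneg {x : ℝ} (hx : 0 ≤ x) (k : ℕ) : 0 ≤ Real.sqrt^[k] x := by
  cases k with
  | zero => exact hx
  | succ k => rw [Function.iterate_succ_apply']; exact Real.sqrt_nonneg _

lemma iterate_sqrt_pow {x : ℝ} (hx : 0 ≤ x) (k : ℕ) : (Real.sqrt^[k] x) ^ 2 ^ k = x := by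
  induction k with
  | zero => simp
  | succ k ih =>
    rw [Function.iterate_succ_apply', pow_succ', pow_mul, Real.sq_sqrt (iterate_sqrt_nonneg hx k),
      ih]

lemma opNorm_pow_two_pow {M : Matrix (Fin d) (Fin d) ℝ} (hM : Mᵀ = M) (k : ℕ) :
    opNorm (M ^ 2 ^ k) = opNorm M ^ 2 ^ k := by
  have hsa : IsSelfAdjoint (Matrix.toEuclideanCLM (n := Fin d) (𝕜 := ℝ) M) := by
    rw [IsSelfAdjoint, ← map_star, Matrix.star_eq_conjTranspose,
      Matrix.conjTranspose_eq_transpose_of_trivial, hM]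
  rw [opNorm, map_pow, hsa.norm_pow_two_pow, opNorm]

lemma trace_le_opNorm (M : Matrix (Fin d) (Fin d) ℝ) : M.trace ≤ d * opNorm M := by
  have : ∀ i, M i i ≤ opNorm M := fun i => by
    have h := le_of_abs_le (abs_dotProduct_mulVec_le M (Pi.single i 1) (Pi.single i 1))
    simpa [l2norm] using h
  calc M.trace = ∑ i, M i i := rfl
    _ ≤ ∑ _i : Fin d, opNorm M := Finset.sum_le_sum fun i _ => this i
    _ = d * opNorm M := by simp

lemma opNorm_sq_le_trace {M : Matrix (Fin d) (Fin d) ℝ} (hM : Mᵀ = M) :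
    opNorm M ^ 2 ≤ (M ^ 2).trace := by
  have htr : (M ^ 2).trace = ∑ a, ∑ b, M a b ^ 2 := by
    simp only [Matrix.trace, Matrix.diag_apply, sq, Matrix.mul_apply]
    refine Finset.sum_congr rfl fun a _ => Finset.sum_congr rfl fun b _ => ?_
    congr 1
    exact congrFun (congrFun hM.symm b) a
  have h0 : 0 ≤ (M ^ 2).trace := by
    rw [htr]; exact Finset.sum_nonneg fun a _ => Finset.sum_nonneg fun b _ => sq_nonneg _
  have : opNorm M ≤ Real.sqrt (M ^ 2).trace := by
    refine opNorm_le (Real.sqrt_nonneg _) fun x => ?_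
    refine abs_le_of_sq_le_sq' ?_ (mul_nonneg (Real.sqrt_nonneg _) (l2norm_nonneg _)) |>.2
    rw [mul_pow, Real.sq_sqrt h0, htr]
    exact l2norm_mulVec_sq_le_frobenius M x
  have := pow_le_pow_left₀ (opNorm_nonneg M) this 2
  rwa [Real.sq_sqrt h0] at this

/-- For symmetric `M`, the trace of `M^(2^k)` lies between `‖M‖^(2^k)` and `d ‖M‖^(2^k)`. -/
lemma rootTrace_mem {M : Matrix (Fin d) (Fin d) ℝ} (hM : Mᵀ = M) (hk : 0 < k) (hη : 0 ≤ η)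
    (hd : (d : ℝ) ≤ (1 + η) ^ 2 ^ k) :
    opNorm M ≤ rootTrace k M ∧ rootTrace k M ≤ (1 + η) * opNorm M := by
  have hlow : opNorm M ^ 2 ^ k ≤ (M ^ 2 ^ k).trace := by
    obtain ⟨j, rfl⟩ : ∃ j, k = j + 1 := ⟨k - 1, by omega⟩
    have h := opNorm_sq_le_trace (M := M ^ 2 ^ j) (by rw [Matrix.transpose_pow, hM])
    rwa [opNorm_pow_two_pow hM, ← pow_mul, ← pow_mul, ← pow_succ] at h
  have hup : (M ^ 2 ^ k).trace ≤ ((1 + η) * opNorm M) ^ 2 ^ k := by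
    rw [mul_pow, ← opNorm_pow_two_pow hM]
    exact (trace_le_opNorm _).trans (mul_le_mul_of_nonneg_right hd (opNorm_nonneg _))
  have h0 : 0 ≤ (M ^ 2 ^ k).trace := (pow_nonneg (opNorm_nonneg M) _).trans hlow
  have hr := iterate_sqrt_nonneg h0 k
  have hp : 2 ^ k ≠ 0 := by positivity
  rw [← iterate_sqrt_pow h0 k] at hlow hup
  exact ⟨(pow_le_pow_iff_left₀ (opNorm_nonneg M) hr hp).1 hlow,
    (pow_le_pow_iff_left₀ hr (mul_nonneg (by linarith) (opNorm_nonneg M)) hp).1 hup⟩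

lemma rootTrace_conj {R : Matrix (Fin d) (Fin d) ℝ} (hR : IsUnit R.det)
    (M : Matrix (Fin d) (Fin d) ℝ) : rootTrace k (R⁻¹ * M * R) = rootTrace k M := by
  have h : ∀ p : ℕ, (R⁻¹ * M * R) ^ p = R⁻¹ * M ^ p * R := by
    intro p
    induction p with
    | zero => rw [pow_zero, pow_zero, Matrix.mul_one, Matrix.nonsing_inv_mul _ hR]
    | succ p ih =>
      rw [pow_succ, ih, pow_succ]
      calc R⁻¹ * M ^ p * R * (R⁻¹ * M * R) = R⁻¹ * M ^ p * (R * R⁻¹) * M * R := by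
            simp only [Matrix.mul_assoc]
        _ = R⁻¹ * (M ^ p * M) * R := by
            rw [Matrix.mul_nonsing_inv _ hR, Matrix.mul_one]; simp only [Matrix.mul_assoc]
  rw [rootTrace, h, Matrix.trace_mul_comm, ← Matrix.mul_assoc, Matrix.mul_nonsing_inv _ hR,
    Matrix.one_mul, rootTrace]

/-- The estimates that the program computes. With `G = (SA)ᵀ(SA)`, `H = (TA)ᵀ(TA)`, `TA = QR` and
`B = SAR⁻¹`, the matrix `H⁻¹G` is similar to `BᵀB`, so no triangular factor has to be computed. -/
lemma isEstimate_rootTrace (hd : 0 < d) (hη : 0 < η) {r : ℕ} (hr : 0 < r)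
    (hdr : (d : ℝ) ≤ (1 + η) ^ 2 ^ r) {A : Matrix (Fin n) (Fin d) ℝ}
    {S : Matrix (Fin m) (Fin n) ℝ} {T : Matrix (Fin k) (Fin n) ℝ}
    (hT : Function.Injective (T * A).mulVec) :
    IsEstimate η A S T
      (rootTrace r (((S * A)ᵀ * (S * A))⁻¹ * ((T * A)ᵀ * (T * A))))⁻¹
      (rootTrace r (((T * A)ᵀ * (T * A))⁻¹ * ((S * A)ᵀ * (S * A)) - 1)) := by
  obtain ⟨Q, R, hQR, hR⟩ := exists_isQR hT
  refine ⟨Q, R, hQR, hR, ?_⟩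
  set B := S * A * R⁻¹ with hB
  set G := (S * A)ᵀ * (S * A) with hG
  set H := (T * A)ᵀ * (T * A) with hH
  have hRt : IsUnit (Rᵀ).det := by rwa [Matrix.det_transpose]
  have hHR : H = Rᵀ * R := by
    rw [hH, hQR.eq_mul, Matrix.transpose_mul, Matrix.mul_assoc, ← Matrix.mul_assoc Qᵀ,
      hQR.orthonormal, Matrix.one_mul]
  have hN : Bᵀ * B = (Rᵀ)⁻¹ * G * R⁻¹ := by
    rw [hB, hG, Matrix.transpose_mul, Matrix.transpose_nonsing_inv]
    simp only [Matrix.mul_assoc]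
  have hNT : (Bᵀ * B)ᵀ = Bᵀ * B := by rw [Matrix.transpose_mul, Matrix.transpose_transpose]
  constructor
  · by_cases hinj : Function.Injective (S * A).mulVec
    · have hGu : IsUnit G.det := isUnit_det_gram hinj
      have hNu := isUnit_det_gram_mul_inv hR hinj
      obtain ⟨hs, hop⟩ := opNorm_inv_gram hd hNu
      have hconj : G⁻¹ * H = R⁻¹ * (Bᵀ * B)⁻¹ * R := by
        rw [hN, Matrix.mul_inv_rev, Matrix.mul_inv_rev, Matrix.nonsing_inv_nonsing_inv _ hR,
          Matrix.nonsing_inv_nonsing_inv _ hRt, ← Matrix.mul_assoc R⁻¹, Matrix.nonsing_inv_mul _ hR,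
          Matrix.one_mul, hHR, Matrix.mul_assoc]
      rw [hconj, rootTrace_conj hR]
      obtain ⟨h1, h2⟩ := rootTrace_mem (k := r) (η := η) (M := (Bᵀ * B)⁻¹)
        (by rw [Matrix.transpose_nonsing_inv, hNT]) hr hη.le hdr
      rw [← hB] at hs hop
      rw [hop] at h1 h2
      set σ := sigmaMin B ^ 2 with hσ
      have hρ : 0 < rootTrace r (Bᵀ * B)⁻¹ := (inv_pos.2 hs).trans_le h1
      have h3 : (rootTrace r (Bᵀ * B)⁻¹)⁻¹ ≤ σ := (inv_le_comm₀ hs hρ).1 h1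
      have h4 : σ ≤ (1 + η) * (rootTrace r (Bᵀ * B)⁻¹)⁻¹ := by
        rw [← div_eq_mul_inv, le_div_iff₀ hρ]
        calc σ * rootTrace r (Bᵀ * B)⁻¹ ≤ σ * ((1 + η) * σ⁻¹) := by gcongr
          _ = 1 + η := by field_simp
      rw [abs_le]
      constructor <;> nlinarith
    · have hGu : ¬ IsUnit G.det := fun h => hinj (injective_of_isUnit_det_gram h)
      have hs : sigmaMin B = 0 := by
        by_contra hne
        exact hinj (injective_of_sigmaMin_ne_zero hR hne)
      have h0 : rootTrace r (0 : Matrix (Fin d) (Fin d) ℝ) = 0 := by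
        rw [rootTrace, zero_pow (by positivity), Matrix.trace_zero]
        exact Function.iterate_fixed Real.sqrt_zero r
      rw [Matrix.nonsing_inv_apply_not_isUnit _ hGu, Matrix.zero_mul, h0, hs]
      simp
  · have hconj : H⁻¹ * G - 1 = R⁻¹ * (Bᵀ * B - 1) * R := by
      rw [Matrix.mul_sub, Matrix.sub_mul, Matrix.mul_one, Matrix.nonsing_inv_mul _ hR, hN, hHR,
        Matrix.mul_inv_rev]
      congr 1
      rw [Matrix.mul_assoc _ _ R, Matrix.mul_assoc _ R⁻¹ R, Matrix.nonsing_inv_mul _ hR,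
        Matrix.mul_one, Matrix.mul_assoc]
    rw [hconj, rootTrace_conj hR]
    obtain ⟨h1, h2⟩ := rootTrace_mem (k := r) (η := η) (M := Bᵀ * B - 1)
      (by rw [Matrix.transpose_sub, hNT, Matrix.transpose_one]) hr hη.le hdr
    have := mul_nonneg hη.le (opNorm_nonneg (Bᵀ * B - 1))
    rw [abs_le]
    constructor <;> linarith

/-- With at least `d / η` squarings, the factor `d` disappears in the root. -/
lemma natCast_le_one_add_pow (hη : 0 < η) (hk : (d : ℝ) / η ≤ k) :
    (d : ℝ) ≤ (1 + η) ^ 2 ^ k := by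
  have h1 := one_add_mul_le_pow (a := η) (by linarith) (2 ^ k)
  have h2 : (k : ℝ) ≤ ((2 ^ k : ℕ) : ℝ) := by exact_mod_cast (Nat.lt_two_pow_self).le
  rw [div_le_iff₀ hη] at hk
  have h3 : (k : ℝ) * η ≤ ((2 ^ k : ℕ) : ℝ) * η := by gcongr
  linarith

end Numerics

end HessianSketch

namespace HessianSketch

/-! ### Structured programs on the machine -/

section Machine

variable {d : ℕ} {sol : Solver d} {e B : ℕ}

/-- Total correctness with a time bound: started in `s`, the program `p` halts within
`c (B + 1)^n` steps, in a memory that satisfies `Q`. -/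
def Runs (sol : Solver d) (e B : ℕ) (p : Prog) (s : Mem) (c n : ℕ) (Q : Mem → Prop) : Prop :=
  ∃ t s', Exec sol e p s t s' ∧ t ≤ c * (B + 1) ^ n ∧ Q s'

lemma cost_mono {c c' n n' : ℕ} (hc : c ≤ c') (hn : n ≤ n') :
    c * (B + 1) ^ n ≤ c' * (B + 1) ^ n' :=
  Nat.mul_le_mul hc (Nat.pow_le_pow_right (Nat.succ_pos B) hn)

lemma Runs.mono {p : Prog} {s : Mem} {c c' n n' : ℕ} {Q Q' : Mem → Prop}
    (h : Runs sol e B p s c n Q) (hc : c ≤ c') (hn : n ≤ n') (hQ : ∀ s', Q s' → Q' s') :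
    Runs sol e B p s c' n' Q' := by
  obtain ⟨t, s', hex, ht, hq⟩ := h
  exact ⟨t, s', hex, ht.trans (cost_mono hc hn), hQ s' hq⟩

lemma Runs.post {p : Prog} {s : Mem} {c n : ℕ} {Q Q' : Mem → Prop}
    (h : Runs sol e B p s c n Q) (hQ : ∀ s', Q s' → Q' s') : Runs sol e B p s c n Q' :=
  h.mono le_rfl le_rfl hQ

lemma Runs.seq {p q : Prog} {s : Mem} {c₁ c₂ n₁ n₂ : ℕ} {Q Q' : Mem → Prop}
    (h : Runs sol e B p s c₁ n₁ Q) (h' : ∀ s', Q s' → Runs sol e B q s' c₂ n₂ Q') :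
    Runs sol e B (.seq p q) s (c₁ + c₂) (max n₁ n₂) Q' := by
  obtain ⟨t, s', hex, ht, hq⟩ := h
  obtain ⟨t', s'', hex', ht', hq'⟩ := h' s' hq
  refine ⟨t + t', s'', hex.seq hex', ?_, hq'⟩
  rw [add_mul]
  exact Nat.add_le_add (ht.trans (cost_mono le_rfl (le_max_left _ _)))
    (ht'.trans (cost_mono le_rfl (le_max_right _ _)))

lemma Runs.op (o : Op) (s : Mem) : Runs sol e B (.op o) s 1 0 (· = o.eval s) :=
  ⟨1, _, Exec.op o s, by simp, rfl⟩

lemma Runs.ite {t : Test} {p q : Prog} {s : Mem} {c n : ℕ} {Q : Mem → Prop}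
    (hp : t.holds s → Runs sol e B p s c n Q) (hq : ¬ t.holds s → Runs sol e B q s c n Q) :
    Runs sol e B (.ite t p q) s (c + 1) n Q := by
  have h1 : 1 ≤ (B + 1) ^ n := Nat.one_le_pow _ _ (Nat.succ_pos B)
  by_cases ht : t.holds s
  · obtain ⟨u, s', hex, hu, hQ⟩ := hp ht
    exact ⟨1 + u, s', Exec.ite_true ht hex, by rw [add_mul]; omega, hQ⟩
  · obtain ⟨u, s', hex, hu, hQ⟩ := hq ht
    exact ⟨1 + u, s', Exec.ite_false ht hex, by rw [add_mul]; omega, hQ⟩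

/-- The two memories agree on the integer arrays and on the integer variables below `b`. -/
structure Keep (b : ℕ) (s s' : Mem) : Prop where
  na : s'.na = s.na
  nv : ∀ v < b, s'.nv v = s.nv v

lemma Keep.trans {b : ℕ} {s s' s'' : Mem} (h : Keep b s s') (h' : Keep b s' s'') : Keep b s s'' :=
  ⟨h'.na.trans h.na, fun v hv => (h'.nv v hv).trans (h.nv v hv)⟩

lemma Keep.mono {b b' : ℕ} {s s' : Mem} (h : Keep b s s') (hb : b' ≤ b) : Keep b' s s' :=
  ⟨h.na, fun v hv => h.nv v (hv.trans_le hb)⟩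

/-- The counting loop `for v := 0, …, bnd - 1 do body`; the integer variable `7` is expected to
hold the number `1`. -/
def forLoop (v bnd : ℕ) (body : Prog) : Prog :=
  .seq (.op (.const v 0)) (.while (.lt v bnd) (.seq body (.op (.add v v 7))))

/-- The rule for counting loops, with an invariant about the real arrays. -/
lemma Runs.forLoop {v bnd : ℕ} {body : Prog} {s : Mem} {N c n : ℕ}
    (Inv : ℕ → (ℕ → ℕ → ℕ → ℝ) → Prop) (hv : 7 < v) (hbv : bnd < v) (h7 : s.nv 7 = 1)
    (hN : s.nv bnd = N) (hNB : N ≤ B) (h0 : Inv 0 s.ra)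
    (hstep : ∀ i < N, ∀ s', Keep v s s' → s'.nv v = i → Inv i s'.ra →
      Runs sol e B body s' c n fun s'' => Keep (v + 1) s' s'' ∧ Inv (i + 1) s''.ra) :
    Runs sol e B (forLoop v bnd body) s (c + 2) (n + 1)
      fun s' => Keep v s s' ∧ Inv N s'.ra := by
  have key : ∀ r i, i + r = N → ∀ s', Keep v s s' → s'.nv v = i → Inv i s'.ra →
      ∃ t s'', Exec sol e (.while (.lt v bnd) (.seq body (.op (.add v v 7)))) s' t s'' ∧
        t ≤ r * (c * (B + 1) ^ n + 2) + 1 ∧ Keep v s s'' ∧ Inv N s''.ra := by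
    intro r
    induction r with
    | zero =>
      intro i hi s' hk hvi hinv
      have hiN : i = N := by omega
      refine ⟨1, s', Exec.while_false ?_, by omega, hk, hiN ▸ hinv⟩
      show ¬ s'.nv v < s'.nv bnd
      rw [hvi, hk.nv bnd hbv, hN]
      omega
    | succ r ih =>
      intro i hi s' hk hvi hinv
      obtain ⟨t, s₁, hex, ht, hk₁, hinv₁⟩ := hstep i (by omega) s' hk hvi hinv
      have hs₁v : s₁.nv v = i := by rw [hk₁.nv v (by omega), hvi]
      have hs₁7 : s₁.nv 7 = 1 := by rw [hk₁.nv 7 (by omega), hk.nv 7 hv, h7]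
      obtain ⟨t', s₂, hex', ht', hk₂, hinv₂⟩ := ih (i + 1) (by omega)
        ((Op.add v v 7).eval s₁)
        ⟨hk₁.na.trans hk.na, fun u hu => by
          have : u ≠ v := by omega
          simp only [Op.eval, Mem.setVar, Function.update_of_ne this]
          rw [hk₁.nv u (by omega), hk.nv u hu]⟩
        (by simp [Op.eval, Mem.setVar, hs₁v, hs₁7]) hinv₁
      refine ⟨1 + (t + 1) + t', s₂, Exec.while_true ?_ (hex.seq (Exec.op _ _)) hex', ?_, hk₂,
        hinv₂⟩
      · show s'.nv v < s'.nv bnd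
        rw [hvi, hk.nv bnd hbv, hN]
        omega
      · rw [add_mul]
        omega
  obtain ⟨t, s', hex, ht, hk, hinv⟩ := key N 0 (zero_add N) ((Op.const v 0).eval s)
    ⟨rfl, fun u hu => by
      have : u ≠ v := by omega
      simp [Op.eval, Mem.setVar, Function.update_of_ne this]⟩
    (by simp [Op.eval, Mem.setVar]) h0
  refine ⟨1 + t, s', (Exec.op _ _).seq hex, ?_, hk, hinv⟩
  have h1 : N * (c * (B + 1) ^ n + 2) ≤ B * (c * (B + 1) ^ n + 2) := Nat.mul_le_mul_right _ hNB
  have h2 : 1 ≤ (B + 1) ^ n := Nat.one_le_pow _ _ (Nat.succ_pos B)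
  have h3 : B * 1 ≤ B * (B + 1) ^ n := Nat.mul_le_mul_left _ h2
  have h4 : (c + 2) * (B + 1) ^ (n + 1) =
      B * (c * (B + 1) ^ n) + c * (B + 1) ^ n + 2 * (B * (B + 1) ^ n) + 2 * (B + 1) ^ n := by ring
  have h5 : B * (c * (B + 1) ^ n + 2) = B * (c * (B + 1) ^ n) + 2 * B := by ring
  rw [h4]
  omega

/-! ### Evaluation of real expressions -/

/-- Real expressions over array cells. Inversion stands for `x⁻¹` with `0⁻¹ = 0`, which is compiled
to a test and a division by a nonzero number. -/
inductive RExp where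
  | ref (r : Ref)
  | nat (k : ℕ)
  | add (x y : RExp)
  | sub (x y : RExp)
  | mul (x y : RExp)
  | inv (x : RExp)
  | sqrt (x : RExp)

/-- The value of an expression. -/
noncomputable def RExp.eval : RExp → Mem → ℝ
  | .ref r, s => s.get r
  | .nat k, _ => k
  | .add x y, s => x.eval s + y.eval s
  | .sub x y, s => x.eval s - y.eval s
  | .mul x y, s => x.eval s * y.eval s
  | .inv x, s => (x.eval s)⁻¹
  | .sqrt x, s => Real.sqrt (x.eval s)

/-- The arrays from number `30` on are scratch space; expressions must not refer to them. -/
def RExp.Proper : RExp → Prop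
  | .ref r => r.arr < 30
  | .nat _ => True
  | .add x y => x.Proper ∧ y.Proper
  | .sub x y => x.Proper ∧ y.Proper
  | .mul x y => x.Proper ∧ y.Proper
  | .inv x => x.Proper
  | .sqrt x => x.Proper

/-- A bound for the number of steps that the evaluation of an expression takes. -/
def RExp.cost : RExp → ℕ
  | .ref _ => 2
  | .nat _ => 1
  | .add x y => x.cost + (y.cost + 1)
  | .sub x y => x.cost + (y.cost + 1)
  | .mul x y => x.cost + (y.cost + 1)
  | .inv x => x.cost + 5
  | .sqrt x => x.cost + 1

/-- The `k`-th scratch cell. -/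
def scratch (k : ℕ) : Ref := ⟨30 + k, 6, 6⟩

/-- A program that evaluates an expression into the `k`-th scratch cell. -/
def RExp.compile : RExp → ℕ → Prog
  | .ref r, k => .seq (.op (.rconst (scratch k) 0)) (.op (.radd (scratch k) r (scratch k)))
  | .nat c, k => .op (.rconst (scratch k) c)
  | .add x y, k => .seq (x.compile k) (.seq (y.compile (k + 1))
      (.op (.radd (scratch k) (scratch k) (scratch (k + 1)))))
  | .sub x y, k => .seq (x.compile k) (.seq (y.compile (k + 1))
      (.op (.rsub (scratch k) (scratch k) (scratch (k + 1)))))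
  | .mul x y, k => .seq (x.compile k) (.seq (y.compile (k + 1))
      (.op (.rmul (scratch k) (scratch k) (scratch (k + 1)))))
  | .inv x, k => .seq (x.compile k) (.seq (.op (.rmul (scratch (k + 1)) (scratch k) (scratch k)))
      (.seq (.op (.rconst (scratch (k + 2)) 0))
        (.ite (.rlt (scratch (k + 2)) (scratch (k + 1)))
          (.seq (.op (.rconst (scratch (k + 1)) 1))
            (.op (.rdiv (scratch k) (scratch (k + 1)) (scratch k))))
          (.op (.rconst (scratch k) 0)))))
  | .sqrt x, k => .seq (x.compile k) (.op (.rsqrt (scratch k) (scratch k)))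

lemma Mem.get_set_self (s : Mem) (r : Ref) (v : ℝ) : (s.set r v).get r = v := by
  simp [Mem.get, Mem.set]

lemma Mem.ra_set_of_ne (s : Mem) {r : Ref} (v : ℝ) {a : ℕ} (h : a ≠ r.arr) :
    (s.set r v).ra a = s.ra a := by
  simp [Mem.set, h]

lemma Mem.get_set_of_ne (s : Mem) {r r' : Ref} (v : ℝ) (h : r'.arr ≠ r.arr) :
    (s.set r v).get r' = s.get r' := by
  simp [Mem.get, Mem.set, h]

lemma RExp.eval_congr {x : RExp} (hx : x.Proper) {s s' : Mem} (hnv : s'.nv = s.nv)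
    (hra : ∀ a < 30, s'.ra a = s.ra a) : x.eval s' = x.eval s := by
  induction x with
  | ref r => simp only [RExp.eval, Mem.get, hnv, hra r.arr hx]
  | nat k => rfl
  | add x y ihx ihy => simp only [RExp.eval, ihx hx.1, ihy hx.2]
  | sub x y ihx ihy => simp only [RExp.eval, ihx hx.1, ihy hx.2]
  | mul x y ihx ihy => simp only [RExp.eval, ihx hx.1, ihy hx.2]
  | inv x ih => simp only [RExp.eval, ih hx]
  | sqrt x ih => simp only [RExp.eval, ih hx]

/-- The effect of an evaluation into the `k`-th scratch cell: only scratch cells from the `k`-th on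
change. -/
structure Evaluated (k : ℕ) (v : ℝ) (s s' : Mem) : Prop where
  na : s'.na = s.na
  nv : s'.nv = s.nv
  ra : ∀ a < 30 + k, s'.ra a = s.ra a
  get : s'.get (scratch k) = v

lemma Runs.compile_binary {x y : RExp} {k : ℕ} {s : Mem} {f : ℝ → ℝ → ℝ} {o : Op} (hy : y.Proper)
    (ho : ∀ s, o.eval s = s.set (scratch k) (f (s.get (scratch k)) (s.get (scratch (k + 1)))))
    (ihx : Runs sol e B (x.compile k) s x.cost 0 (Evaluated k (x.eval s) s))
    (ihy : ∀ s, Runs sol e B (y.compile (k + 1)) s y.cost 0 (Evaluated (k + 1) (y.eval s) s)) :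
    Runs sol e B (.seq (x.compile k) (.seq (y.compile (k + 1)) (.op o))) s
      (x.cost + (y.cost + 1)) 0 (Evaluated k (f (x.eval s) (y.eval s)) s) := by
  refine (ihx.seq fun s₁ h₁ => (ihy s₁).seq fun s₂ h₂ => (Runs.op o s₂).post ?_).mono le_rfl
    (by simp) fun _ h => h
  rintro s₃ rfl
  rw [ho]
  have e1 : s₂.get (scratch k) = x.eval s := by
    rw [← h₁.get, Mem.get, Mem.get, h₂.nv, h₂.ra _ (by simp [scratch])]
  have e2 : s₂.get (scratch (k + 1)) = y.eval s := by
    rw [h₂.get, RExp.eval_congr hy h₁.nv fun a ha => h₁.ra a (by omega)]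
  rw [e1, e2]
  refine ⟨h₂.na.trans h₁.na, h₂.nv.trans h₁.nv, fun a ha => ?_, Mem.get_set_self _ _ _⟩
  rw [Mem.ra_set_of_ne _ _ (by simp [scratch]; omega), h₂.ra a (by omega), h₁.ra a ha]

lemma Runs.compile {x : RExp} (hx : x.Proper) (k : ℕ) (s : Mem) :
    Runs sol e B (x.compile k) s x.cost 0 (Evaluated k (x.eval s) s) := by
  induction x generalizing k s with
  | ref r =>
    have hr : r.arr < 30 := hx
    refine ((Runs.op _ s).seq fun s₁ h₁ => (Runs.op _ s₁).post ?_).mono le_rfl (by simp)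
      fun _ h => h
    rintro s₂ rfl
    subst h₁
    have hne : r.arr ≠ (scratch k).arr := by simp [scratch]; omega
    refine ⟨rfl, rfl, fun a ha => ?_, ?_⟩
    · have : a ≠ (scratch k).arr := by simp [scratch]; omega
      simp only [Op.eval, Mem.ra_set_of_ne _ _ this]
    · simp only [Op.eval, Mem.get_set_self, Mem.get_set_of_ne _ _ hne, RExp.eval]
      simp
  | nat c =>
    refine (Runs.op _ s).post ?_
    rintro s₁ rfl
    refine ⟨rfl, rfl, fun a ha => ?_, ?_⟩
    · exact Mem.ra_set_of_ne _ _ (by simp [scratch]; omega)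
    · exact Mem.get_set_self _ _ _
  | add x y ihx ihy =>
    exact Runs.compile_binary hx.2 (fun _ => rfl) (ihx hx.1 k s) (ihy hx.2 (k + 1))
  | sub x y ihx ihy =>
    exact Runs.compile_binary hx.2 (fun _ => rfl) (ihx hx.1 k s) (ihy hx.2 (k + 1))
  | mul x y ihx ihy =>
    exact Runs.compile_binary hx.2 (fun _ => rfl) (ihx hx.1 k s) (ihy hx.2 (k + 1))
  | sqrt x ih =>
    refine ((ih hx k s).seq fun s₁ h₁ => (Runs.op _ s₁).post ?_).mono le_rfl (by simp)
      fun _ h => h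
    rintro s₂ rfl
    refine ⟨h₁.na, h₁.nv, fun a ha => ?_, ?_⟩
    · rw [← h₁.ra a ha]
      exact Mem.ra_set_of_ne _ _ (by simp [scratch]; omega)
    · simp only [Op.eval, Mem.get_set_self, RExp.eval, h₁.get]
  | inv x ih =>
    have n1 : (scratch k).arr ≠ (scratch (k + 1)).arr := by simp [scratch]
    have n2 : (scratch k).arr ≠ (scratch (k + 2)).arr := by simp [scratch]
    have n3 : (scratch (k + 1)).arr ≠ (scratch (k + 2)).arr := by simp [scratch]
    refine ((ih hx k s).seq fun s₁ h₁ => (Runs.op _ s₁).seq fun s₂ h₂ =>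
      (Runs.op _ s₂).seq fun s₃ h₃ => Runs.ite (c := 2) (n := 0) (fun ht => ?_) (fun ht => ?_)).mono
      le_rfl (by simp) fun _ h => h
    · refine ((Runs.op _ s₃).seq fun s₄ h₄ => (Runs.op _ s₄).post ?_).mono le_rfl (by simp)
        fun _ h => h
      rintro s₅ rfl
      subst h₄ h₃ h₂
      refine ⟨h₁.na, h₁.nv, fun a ha => ?_, ?_⟩
      · have m1 : a ≠ (scratch k).arr := by simp [scratch]; omega
        have m2 : a ≠ (scratch (k + 1)).arr := by simp [scratch]; omega
        have m3 : a ≠ (scratch (k + 2)).arr := by simp [scratch]; omega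
        simp only [Op.eval, Mem.ra_set_of_ne _ _ m1, Mem.ra_set_of_ne _ _ m2,
          Mem.ra_set_of_ne _ _ m3, h₁.ra a ha]
      · simp only [Op.eval, Mem.get_set_self, Mem.get_set_of_ne _ _ n1, Mem.get_set_of_ne _ _ n2,
          RExp.eval, h₁.get]
        simp
    · refine (Runs.op _ s₃).mono (by norm_num) le_rfl ?_
      rintro s₅ rfl
      subst h₃ h₂
      refine ⟨h₁.na, h₁.nv, fun a ha => ?_, ?_⟩
      · have m1 : a ≠ (scratch k).arr := by simp [scratch]; omega
        have m2 : a ≠ (scratch (k + 1)).arr := by simp [scratch]; omega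
        have m3 : a ≠ (scratch (k + 2)).arr := by simp [scratch]; omega
        simp only [Op.eval, Mem.ra_set_of_ne _ _ m1, Mem.ra_set_of_ne _ _ m2,
          Mem.ra_set_of_ne _ _ m3, h₁.ra a ha]
      · simp only [Test.holds, Op.eval, Mem.get_set_self, Mem.get_set_of_ne _ _ n3, h₁.get,
          not_lt, Nat.cast_zero] at ht
        have : x.eval s = 0 := mul_self_eq_zero.1 (le_antisymm ht (mul_self_nonneg _))
        simp only [Op.eval, Mem.get_set_self, RExp.eval, this]
        simp

/-- `s'` arises from `s` by giving the real array `C` the new content `g`, up to integer variables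
from `b` on and scratch arrays. -/
structure Upd (b C : ℕ) (g : ℕ → ℕ → ℝ) (s s' : Mem) : Prop extends Keep b s s' where
  frame : ∀ a < 30, a ≠ C → s'.ra a = s.ra a
  val : s'.ra C = g

/-- The assignment of an expression to a cell. -/
def assign (r : Ref) (x : RExp) : Prog :=
  .seq (x.compile 0) (.seq (.op (.rconst (scratch 1) 0)) (.op (.radd r (scratch 0) (scratch 1))))

lemma Runs.assign {r : Ref} {x : RExp} (b : ℕ) (s : Mem) (hx : x.Proper) (hr : r.arr < 30) :
    Runs sol e B (assign r x) s (x.cost + 2) 0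
      (Upd b r.arr (fun i j => if i = s.nv r.i ∧ j = s.nv r.j then x.eval s else s.ra r.arr i j)
        s) := by
  refine ((Runs.compile hx 0 s).seq fun s₁ h₁ => (Runs.op _ s₁).seq fun s₂ h₂ =>
    (Runs.op _ s₂).post ?_).mono le_rfl (by simp) fun _ h => h
  rintro s₃ rfl
  subst h₂
  have n1 : (scratch 0).arr ≠ (scratch 1).arr := by simp [scratch]
  have n2 : r.arr ≠ (scratch 1).arr := by simp [scratch]; omega
  refine ⟨⟨h₁.na, fun v _ => by rw [← h₁.nv]; rfl⟩, fun a ha hac => ?_, ?_⟩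
  · have m1 : a ≠ (scratch 1).arr := by simp [scratch]; omega
    simp only [Op.eval, Mem.ra_set_of_ne _ _ hac, Mem.ra_set_of_ne _ _ m1, h₁.ra a (by omega)]
  · have hval : ((Op.rconst (scratch 1) 0).eval s₁).get (scratch 0) +
        ((Op.rconst (scratch 1) 0).eval s₁).get (scratch 1) = x.eval s := by
      simp only [Op.eval, Mem.get_set_self, Mem.get_set_of_ne _ _ n1, h₁.get]
      simp
    have hra : ((Op.rconst (scratch 1) 0).eval s₁).ra r.arr = s.ra r.arr := by
      simp only [Op.eval, Mem.ra_set_of_ne _ _ n2, h₁.ra r.arr (by omega)]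
    have hnv : ((Op.rconst (scratch 1) 0).eval s₁).nv = s.nv := h₁.nv
    show ((((Op.rconst (scratch 1) 0).eval s₁).set r (_ + _)).ra r.arr) = _
    rw [hval]
    funext i j
    simp only [Mem.set, hnv, hra, true_and]

/-! ### Loops over matrices -/

/-- A double loop that treats every cell of an array once. -/
def elementwise (v p q : ℕ) (body : Prog) : Prog := forLoop v p (forLoop (v + 1) q body)

lemma Runs.elementwise {v p q C : ℕ} {body : Prog} {s : Mem} {P Q c n : ℕ} (f : ℕ → ℕ → ℝ)
    (hv : 7 < v) (hpv : p < v) (hqv : q < v) (h7 : s.nv 7 = 1) (hP : s.nv p = P) (hQ : s.nv q = Q)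
    (hPB : P ≤ B) (hQB : Q ≤ B)
    (hbody : ∀ i < P, ∀ j < Q, ∀ s', Keep v s s' → s'.nv v = i → s'.nv (v + 1) = j →
      (∀ a < 30, a ≠ C → s'.ra a = s.ra a) → s'.ra C i j = s.ra C i j →
      Runs sol e B body s' c n
        (Upd (v + 2) C (fun x y => if x = i ∧ y = j then f i j else s'.ra C x y) s')) :
    Runs sol e B (elementwise v p q body) s (c + 4) (n + 2)
      (Upd v C (fun x y => if x < P ∧ y < Q then f x y else s.ra C x y) s) := by
  refine (Runs.forLoop (c := c + 2) (n := n + 1) (fun i ra => (∀ a < 30, a ≠ C → ra a = s.ra a) ∧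
    ra C = fun x y => if x < i ∧ y < Q then f x y else s.ra C x y) hv hpv h7 hP hPB
    ⟨fun _ _ _ => rfl, by simp⟩ fun i hi s₁ hk₁ hv₁ hI₁ => ?_).post fun s' hs' =>
      ⟨hs'.1, hs'.2.1, hs'.2.2⟩
  refine (Runs.forLoop (fun j ra => (∀ a < 30, a ≠ C → ra a = s.ra a) ∧
    ra C = fun x y => if x < i ∧ y < Q ∨ x = i ∧ y < j then f x y else s.ra C x y)
    (by omega) (by omega) (by rw [hk₁.nv 7 hv, h7]) (by rw [hk₁.nv q hqv, hQ]) hQB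
    ⟨hI₁.1, by simpa using hI₁.2⟩ fun j hj s₂ hk₂ hv₂ hI₂ => ?_).post fun s' hs' =>
      ⟨hs'.1, hs'.2.1, ?_⟩
  · refine (hbody i hi j hj s₂ (hk₁.trans (hk₂.mono (by omega)))
      (by rw [hk₂.nv v (by omega), hv₁]) hv₂ hI₂.1 (by rw [hI₂.2]; simp)).post fun s₃ h₃ =>
        ⟨h₃.toKeep, fun a ha hac => (h₃.frame a ha hac).trans (hI₂.1 a ha hac), ?_⟩
    rw [h₃.val, hI₂.2]
    funext x y
    by_cases hxy : x = i ∧ y = j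
    · obtain ⟨rfl, rfl⟩ := hxy
      simp
    · have : (x < i ∧ y < Q ∨ x = i ∧ y < j + 1) ↔ (x < i ∧ y < Q ∨ x = i ∧ y < j) := by omega
      simp only [hxy, if_false, this]
  · rw [hs'.2.2]
    funext x y
    have : (x < i ∧ y < Q ∨ x = i ∧ y < Q) ↔ (x < i + 1 ∧ y < Q) := by omega
    simp only [this]

/-- `r := ∑_{w < bnd} x`, where the expression `x` depends on the integer variable `w`. -/
def sumInto (r : Ref) (w bnd : ℕ) (x : RExp) : Prog :=
  .seq (assign r (.nat 0)) (forLoop w bnd (assign r (.add (.ref r) x)))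

lemma Runs.sumInto {r : Ref} {w bnd : ℕ} {x : RExp} {s : Mem} {N : ℕ} (g : ℕ → ℝ)
    (hw : 7 < w) (hbw : bnd < w) (h7 : s.nv 7 = 1) (hN : s.nv bnd = N) (hNB : N ≤ B)
    (hx : x.Proper) (hr : r.arr < 30) (hri : r.i < w) (hrj : r.j < w)
    (hg : ∀ l < N, ∀ s', Keep w s s' → s'.nv w = l → (∀ a < 30, a ≠ r.arr → s'.ra a = s.ra a) →
      x.eval s' = g l) :
    Runs sol e B (sumInto r w bnd x) s (x.cost + 10) 1
      (Upd w r.arr (fun i j => if i = s.nv r.i ∧ j = s.nv r.j then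
        ∑ l ∈ Finset.range N, g l else s.ra r.arr i j) s) := by
  refine ((Runs.assign w s (x := .nat 0) trivial hr).seq fun s₁ h₁ =>
    (Runs.forLoop (n := 0) (fun l ra => (∀ a < 30, a ≠ r.arr → ra a = s.ra a) ∧
      ra r.arr = fun i j => if i = s.nv r.i ∧ j = s.nv r.j then
        ∑ l ∈ Finset.range l, g l else s.ra r.arr i j) hw hbw
      (by rw [h₁.nv 7 hw, h7]) (by rw [h₁.nv bnd hbw, hN]) hNB ⟨h₁.frame, ?_⟩ ?_).post fun s' hs' =>
        (⟨h₁.toKeep.trans hs'.1, hs'.2.1, hs'.2.2⟩ : Upd w r.arr _ s s')).mono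
          (c := (RExp.nat 0).cost + 2 + ((RExp.add (.ref r) x).cost + 2 + 2)) ?_ (by simp)
          fun _ h => h
  · rw [h₁.val]
    simp [RExp.eval]
  · intro l hl s₂ hk₂ hw₂ hI₂
    have hk : Keep w s s₂ := h₁.toKeep.trans hk₂
    refine (Runs.assign (w + 1) s₂ (x := .add (.ref r) x) ⟨hr, hx⟩ hr).post fun s₃ h₃ =>
      ⟨h₃.toKeep, fun a ha hac => (h₃.frame a ha hac).trans (hI₂.1 a ha hac), ?_⟩
    rw [h₃.val]
    have e1 := hg l hl s₂ hk hw₂ hI₂.1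
    funext i j
    simp only [RExp.eval, e1, Mem.get, hI₂.2, hk.nv _ hri, hk.nv _ hrj, Finset.sum_range_succ]
    by_cases hij : i = s.nv r.i ∧ j = s.nv r.j
    · simp [hij]
    · simp [hij]
  · simp only [RExp.cost]
    omega

end Machine

end HessianSketch

namespace HessianSketch

/-! ### Matrix programs -/

section MatrixPrograms

variable {d : ℕ} {sol : Solver d} {e B : ℕ}

/-- The upper left corner of the array `X` holds the matrix `M`. -/
def Rep {p q : ℕ} (X : ℕ → ℕ → ℝ) (M : Matrix (Fin p) (Fin q) ℝ) : Prop :=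
  ∀ (i : Fin p) (j : Fin q), X i j = M i j

/-- At most the real arrays in the list `L`, integer variables from `b` on and scratch arrays have
changed. -/
structure Post (b : ℕ) (L : List ℕ) (s s' : Mem) : Prop extends Keep b s s' where
  frame : ∀ a < 30, a ∉ L → s'.ra a = s.ra a

lemma Upd.toPost {b C : ℕ} {g : ℕ → ℕ → ℝ} {s s' : Mem} (h : Upd b C g s s') : Post b [C] s s' :=
  ⟨h.toKeep, fun a ha hL => h.frame a ha (by simpa using hL)⟩

lemma Post.trans {b b' : ℕ} {L L' L'' : List ℕ} {s s' s'' : Mem} (h : Post b L s s')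
    (h' : Post b' L' s' s'') (hb : b ≤ b') (hL : L ⊆ L'') (hL' : L' ⊆ L'') : Post b L'' s s'' :=
  ⟨h.toKeep.trans (h'.toKeep.mono hb), fun a ha hn =>
    (h'.frame a ha fun hm => hn (hL' hm)).trans (h.frame a ha fun hm => hn (hL hm))⟩

/-- The conventions for the integer variables: `6` and `7` hold the constants `0` and `1`, `1` the
number of columns, `5` the number of rows of the embeddings. -/
structure Ready (d k : ℕ) (s : Mem) : Prop where
  dim : s.nv 1 = d
  rows : s.nv 5 = k
  zero : s.nv 6 = 0
  one : s.nv 7 = 1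

lemma Ready.keep {d k b : ℕ} {s s' : Mem} (h : Ready d k s) (hk : Keep b s s') (hb : 7 < b) :
    Ready d k s' :=
  ⟨by rw [hk.nv 1 (by omega), h.dim], by rw [hk.nv 5 (by omega), h.rows],
    by rw [hk.nv 6 (by omega), h.zero], by rw [hk.nv 7 hb, h.one]⟩

/-- `C[i, j] := x` for all `i < p` and `j < q`; the expression `x` finds `i` and `j` in the integer
variables `v` and `v + 1`. -/
def entrywise (v C p q : ℕ) (x : RExp) : Prog := elementwise v p q (assign ⟨C, v, v + 1⟩ x)

lemma Runs.entrywise {v C p q : ℕ} {x : RExp} {s : Mem} {P Q : ℕ} (f : ℕ → ℕ → ℝ)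
    (hv : 7 < v) (hpv : p < v) (hqv : q < v) (h7 : s.nv 7 = 1) (hP : s.nv p = P) (hQ : s.nv q = Q)
    (hPB : P ≤ B) (hQB : Q ≤ B) (hx : x.Proper) (hC : C < 30)
    (hf : ∀ i < P, ∀ j < Q, ∀ s', Keep v s s' → s'.nv v = i → s'.nv (v + 1) = j →
      (∀ a < 30, a ≠ C → s'.ra a = s.ra a) → s'.ra C i j = s.ra C i j → x.eval s' = f i j) :
    Runs sol e B (entrywise v C p q x) s (x.cost + 6) 2
      (Upd v C (fun i j => if i < P ∧ j < Q then f i j else s.ra C i j) s) := by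
  refine Runs.elementwise (c := x.cost + 2) (n := 0) f hv hpv hqv h7 hP hQ hPB hQB
    fun i hi j hj s' hk hvi hvj hfr hC' => ?_
  have := Runs.assign (sol := sol) (e := e) (B := B) (r := ⟨C, v, v + 1⟩) (v + 2) s' hx hC
  rwa [hf i hi j hj s' hk hvi hvj hfr hC', hvi, hvj] at this

/-- `C[i, j] := ∑_{l < r} x` for all `i < p` and `j < q`; the expression `x` finds `i`, `j` and `l`
in the integer variables `v`, `v + 1` and `v + 2`. -/
def entrywiseSum (v C p q r : ℕ) (x : RExp) : Prog :=
  elementwise v p q (sumInto ⟨C, v, v + 1⟩ (v + 2) r x)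

lemma Runs.entrywiseSum {v C p q r : ℕ} {x : RExp} {s : Mem} {P Q N : ℕ} (f : ℕ → ℕ → ℕ → ℝ)
    (hv : 7 < v) (hpv : p < v) (hqv : q < v) (hrv : r < v) (h7 : s.nv 7 = 1) (hP : s.nv p = P)
    (hQ : s.nv q = Q) (hN : s.nv r = N) (hPB : P ≤ B) (hQB : Q ≤ B) (hNB : N ≤ B) (hx : x.Proper)
    (hC : C < 30)
    (hf : ∀ i < P, ∀ j < Q, ∀ l < N, ∀ s', s'.nv v = i → s'.nv (v + 1) = j →
      s'.nv (v + 2) = l → (∀ a < 30, a ≠ C → s'.ra a = s.ra a) → x.eval s' = f i j l) :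
    Runs sol e B (entrywiseSum v C p q r x) s (x.cost + 14) 3
      (Upd v C (fun i j => if i < P ∧ j < Q then ∑ l ∈ Finset.range N, f i j l else s.ra C i j)
        s) := by
  refine Runs.elementwise (c := x.cost + 10) (n := 1) (fun i j => ∑ l ∈ Finset.range N, f i j l)
    hv hpv hqv h7 hP hQ hPB hQB fun i hi j hj s' hk hvi hvj hfr _ => ?_
  have := Runs.sumInto (sol := sol) (e := e) (r := ⟨C, v, v + 1⟩) (w := v + 2) (bnd := r)
    (x := x) (s := s') (N := N) (f i j) (by omega) (by omega) (by rw [hk.nv 7 hv, h7])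
    (by rw [hk.nv r hrv, hN]) hNB hx hC (by simp) (by simp)
    (fun l hl s'' hk' hl' hfr' => hf i hi j hj l hl s'' (by rw [hk'.nv v (by omega), hvi])
      (by rw [hk'.nv (v + 1) (by omega), hvj]) hl' fun a ha hac =>
        (hfr' a ha hac).trans (hfr a ha hac))
  rwa [hvi, hvj] at this

/-- The product of two `d × d` matrices. -/
def mulProg (v C X Y : ℕ) : Prog :=
  entrywiseSum v C 1 1 1 (.mul (.ref ⟨X, v, v + 2⟩) (.ref ⟨Y, v + 2, v + 1⟩))

lemma Runs.mulProg {v C X Y k : ℕ} {s : Mem} {M N : Matrix (Fin d) (Fin d) ℝ} (hv : 7 < v)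
    (hs : Ready d k s) (hdB : d ≤ B) (hC : C < 30) (hX : X < 30) (hY : Y < 30) (hCX : X ≠ C)
    (hCY : Y ≠ C) (hM : Rep (s.ra X) M) (hN : Rep (s.ra Y) N) :
    Runs sol e B (mulProg v C X Y) s 19 3 fun s' => Post v [C] s s' ∧ Rep (s'.ra C) (M * N) := by
  refine Runs.mono (Runs.entrywiseSum (P := d) (Q := d) (N := d)
    (fun i j l => s.ra X i l * s.ra Y l j) hv (by omega) (by omega) (by omega) hs.one
    hs.dim hs.dim hs.dim hdB hdB hdB ⟨hX, hY⟩ hC ?_)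
    (by simp [RExp.cost]) le_rfl fun s' h => ⟨h.toPost, fun i j => ?_⟩
  · intro i _ j _ l _ s' hi hj hl hfr
    simp only [RExp.eval, Mem.get, hi, hj, hl, hfr X hX hCX, hfr Y hY hCY]
  · rw [h.val]
    simp only [i.2, j.2, and_self, if_true]
    rw [Finset.sum_range, Matrix.mul_apply]
    exact Finset.sum_congr rfl fun l _ => by rw [hM i l, hN l j]

/-- The Gram matrix of a matrix with `d` columns, whose number of rows is in the integer variable
`r`. -/
def gramProg (v C X r : ℕ) : Prog :=
  entrywiseSum v C 1 1 r (.mul (.ref ⟨X, v + 2, v⟩) (.ref ⟨X, v + 2, v + 1⟩))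

lemma Runs.gramProg {v C X r k m : ℕ} {s : Mem} {M : Matrix (Fin m) (Fin d) ℝ} (hv : 7 < v)
    (hs : Ready d k s) (hr : r < v) (hsr : s.nv r = m) (hdB : d ≤ B) (hmB : m ≤ B) (hC : C < 30)
    (hX : X < 30) (hCX : X ≠ C) (hM : Rep (s.ra X) M) :
    Runs sol e B (gramProg v C X r) s 19 3
      fun s' => Post v [C] s s' ∧ Rep (s'.ra C) (Mᵀ * M) := by
  refine Runs.mono (Runs.entrywiseSum (P := d) (Q := d) (N := m)
    (fun i j l => s.ra X l i * s.ra X l j) hv (by omega) (by omega) hr hs.one hs.dim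
    hs.dim hsr hdB hdB hmB ⟨hX, hX⟩ hC ?_)
    (by simp [RExp.cost]) le_rfl fun s' h => ⟨h.toPost, fun i j => ?_⟩
  · intro i _ j _ l _ s' hi hj hl hfr
    simp only [RExp.eval, Mem.get, hi, hj, hl, hfr X hX hCX]
  · rw [h.val]
    simp only [i.2, j.2, and_self, if_true]
    rw [Finset.sum_range, Matrix.mul_apply]
    exact Finset.sum_congr rfl fun l _ => by rw [hM l i, hM l j, Matrix.transpose_apply]

/-- A copy of a `d × d` matrix. -/
def copyProg (v C X : ℕ) : Prog := entrywise v C 1 1 (.ref ⟨X, v, v + 1⟩)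

lemma Runs.copyProg {v C X k : ℕ} {s : Mem} {M : Matrix (Fin d) (Fin d) ℝ} (hv : 7 < v)
    (hs : Ready d k s) (hdB : d ≤ B) (hC : C < 30) (hX : X < 30) (hCX : X ≠ C)
    (hM : Rep (s.ra X) M) :
    Runs sol e B (copyProg v C X) s 8 2 fun s' => Post v [C] s s' ∧ Rep (s'.ra C) M := by
  refine Runs.mono (Runs.entrywise (P := d) (Q := d) (fun i j => s.ra X i j) hv (by omega)
    (by omega) hs.one hs.dim hs.dim hdB hdB hX hC ?_) (by simp [RExp.cost]) le_rfl
    fun s' h => ⟨h.toPost, fun i j => ?_⟩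
  · intro i _ j _ s' _ hi hj hfr _
    simp only [RExp.eval, Mem.get, hi, hj, hfr X hX hCX]
  · rw [h.val]
    simp only [i.2, j.2, and_self, if_true]
    exact hM i j

/-- `X := X - 1`, where the array `14` holds the identity matrix. -/
def subOneProg (v X : ℕ) : Prog :=
  entrywise v X 1 1 (.sub (.ref ⟨X, v, v + 1⟩) (.ref ⟨14, v, v + 1⟩))

lemma Runs.subOneProg {v X k : ℕ} {s : Mem} {M : Matrix (Fin d) (Fin d) ℝ} (hv : 7 < v)
    (hs : Ready d k s) (hdB : d ≤ B) (hX : X < 30) (hIX : 14 ≠ X)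
    (hI : Rep (s.ra 14) (1 : Matrix (Fin d) (Fin d) ℝ)) (hM : Rep (s.ra X) M) :
    Runs sol e B (subOneProg v X) s 11 2 fun s' => Post v [X] s s' ∧ Rep (s'.ra X) (M - 1) := by
  refine Runs.mono (Runs.entrywise (P := d) (Q := d) (fun i j => s.ra X i j - s.ra 14 i j) hv
    (by omega) (by omega) hs.one hs.dim hs.dim hdB hdB ⟨hX, by simp [RExp.Proper]⟩ hX ?_)
    (by simp [RExp.cost]) le_rfl fun s' h => ⟨h.toPost, fun i j => ?_⟩
  · intro i _ j _ s' _ hi hj hfr hself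
    simp only [RExp.eval, Mem.get, hi, hj, hfr 14 (by norm_num) hIX, hself]
  · rw [h.val]
    simp only [i.2, j.2, and_self, if_true]
    rw [hM i j, hI i j, Matrix.sub_apply]

/-- The expression for an entry of the matrix after an elimination step on column `w`: the array
`20` holds the product of the matrix `X` and the given matrix. -/
def pivotExp (w X : ℕ) : RExp :=
  .sub (.mul (.mul (.ref ⟨20, w, w⟩) (.inv (.ref ⟨20, w, w⟩))) (.ref ⟨X, w + 1, w + 2⟩))
    (.mul (.mul (.sub (.ref ⟨20, w + 1, w⟩) (.ref ⟨14, w + 1, w⟩)) (.inv (.ref ⟨20, w, w⟩)))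
      (.ref ⟨X, w, w + 2⟩))

/-- Gauss–Jordan inversion of the array `G` into the array `X`. -/
def invProg (v X G : ℕ) : Prog :=
  .seq (copyProg v X 14) (forLoop v 1 (.seq (mulProg (v + 1) 20 X G)
    (.seq (entrywise (v + 1) 21 1 1 (pivotExp v X)) (copyProg (v + 1) X 21))))

lemma Runs.invProg {v X G k : ℕ} {s : Mem} {M : Matrix (Fin d) (Fin d) ℝ} (hv : 7 < v)
    (hs : Ready d k s) (hdB : d ≤ B) (hX : X < 20) (hG : G < 20) (hXG : X ≠ G) (hX14 : X ≠ 14)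
    (hI : Rep (s.ra 14) (1 : Matrix (Fin d) (Fin d) ℝ)) (hM : Rep (s.ra G) M) :
    Runs sol e B (invProg v X G) s 73 4
      fun s' => Post v [X, 20, 21] s s' ∧ Rep (s'.ra X) (gaussJordan M d) := by
  refine Runs.mono ((Runs.copyProg hv hs hdB (by omega) (by omega) hX14.symm hI).seq fun s₁ h₁ =>
    (Runs.forLoop (c := 63) (n := 3) (fun t ra => (∀ a < 30, a ∉ [X, 20, 21] → ra a = s.ra a) ∧
      Rep (ra X) (gaussJordan M t)) hv (by omega) (hs.keep h₁.1.toKeep hv).one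
      (hs.keep h₁.1.toKeep hv).dim hdB ⟨fun a ha hn => h₁.1.frame a ha (by simp_all), h₁.2⟩
      ?_).post fun s' h => ⟨⟨h₁.1.toKeep.trans h.1, h.2.1⟩, h.2.2⟩) (by simp) (by simp)
        fun _ h => h
  intro t ht s₂ hk₂ hv₂ ⟨hfr₂, hX₂⟩
  have hr₂ := (hs.keep h₁.1.toKeep hv).keep hk₂ hv
  have hG₂ : Rep (s₂.ra G) M := by
    rw [hfr₂ G (by omega) (by simp; omega)]
    exact hM
  have hI₂ : Rep (s₂.ra 14) (1 : Matrix (Fin d) (Fin d) ℝ) := by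
    rw [hfr₂ 14 (by omega) (by simp; omega)]
    exact hI
  set Y := gaussJordan M t with hY
  refine Runs.mono ((Runs.mulProg (k := k) (v := v + 1) (by omega) hr₂ hdB (by omega) (by omega)
    (by omega) (by omega) (by omega) hX₂ hG₂).seq fun s₃ h₃ =>
    (Runs.entrywise (P := d) (Q := d) (fun i l => s₃.ra 20 t t * (s₃.ra 20 t t)⁻¹ * s₃.ra X i l -
      (s₃.ra 20 i t - s₃.ra 14 i t) * (s₃.ra 20 t t)⁻¹ * s₃.ra X t l) (by omega) (by omega)
      (by omega) (hr₂.keep h₃.1.toKeep (by omega)).one (hr₂.keep h₃.1.toKeep (by omega)).dim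
      (hr₂.keep h₃.1.toKeep (by omega)).dim hdB hdB ?_ (by omega) ?_).seq fun s₄ h₄ =>
    (Runs.copyProg (k := k) (M := gaussJordanStep M ⟨t, ht⟩ Y) (by omega)
      ((hr₂.keep h₃.1.toKeep (by omega)).keep h₄.toKeep (by omega)) hdB (by omega) (by omega)
      (by omega) ?_).post fun s₅ h₅ => ⟨h₃.1.toKeep.trans (h₄.toKeep.trans h₅.1.toKeep), ?_, ?_⟩)
    (by simp [RExp.cost, pivotExp]) (by simp) fun _ h => h
  · have : X < 30 := by omega
    simp [RExp.Proper, pivotExp, this]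
  · intro i hi l hl s' hk' hi' hl' hfr' _
    have hvt : s'.nv v = t := by rw [hk'.nv v (by omega), h₃.1.nv v (by omega), hv₂]
    simp only [pivotExp, RExp.eval, Mem.get, hvt, hi', hl', hfr' 20 (by omega) (by omega),
      hfr' 14 (by omega) (by omega), hfr' X (by omega) (by omega)]
  · intro i l
    have e14 : s₃.ra 14 = s₂.ra 14 := h₃.1.frame 14 (by omega) (by simp)
    have eX : s₃.ra X = s₂.ra X := h₃.1.frame X (by omega) (by simp; omega)
    have h20 := h₃.2 i ⟨t, ht⟩
    have h20' := h₃.2 ⟨t, ht⟩ ⟨t, ht⟩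
    have h14 := hI₂ i ⟨t, ht⟩
    have hXi := hX₂ i l
    have hXt := hX₂ ⟨t, ht⟩ l
    rw [h₄.val]
    simp only [i.2, l.2, and_self, if_true, e14, eX, gaussJordanStep]
    simp only at h20 h20' h14 hXi hXt
    rw [h20, h20', h14, hXi, hXt]
  · intro a ha hn
    have hn' : a ≠ X ∧ a ≠ 20 ∧ a ≠ 21 := by simpa using hn
    rw [h₅.1.frame a ha (by simpa using hn'.1), h₄.frame a ha hn'.2.2,
      h₃.1.frame a ha (by simpa using hn'.2.1), hfr₂ a ha hn]
  · rw [gaussJordan, dif_pos ht]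
    exact h₅.2

/-- Repeated squaring: `M := M ^ (2 ^ k)`, where `k` is the content of the integer variable `5`. -/
def powerProg (v M : ℕ) : Prog :=
  forLoop v 5 (.seq (mulProg (v + 1) 21 M M) (copyProg (v + 1) M 21))

lemma Runs.powerProg {v X k : ℕ} {s : Mem} {M : Matrix (Fin d) (Fin d) ℝ} (hv : 7 < v)
    (hs : Ready d k s) (hdB : d ≤ B) (hkB : k ≤ B) (hX : X < 20) (hM : Rep (s.ra X) M) :
    Runs sol e B (powerProg v X) s 29 4
      fun s' => Post v [X, 21] s s' ∧ Rep (s'.ra X) (M ^ 2 ^ k) := by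
  refine (Runs.forLoop (c := 27) (n := 3) (fun t ra => (∀ a < 30, a ∉ [X, 21] → ra a = s.ra a) ∧
      Rep (ra X) (M ^ 2 ^ t)) hv (by omega) hs.one hs.rows hkB ⟨fun _ _ _ => rfl, by simpa using hM⟩
      ?_).post fun s' h => ⟨⟨h.1, h.2.1⟩, h.2.2⟩
  intro t ht s₂ hk₂ hv₂ ⟨hfr₂, hX₂⟩
  have hr₂ := hs.keep hk₂ hv
  refine Runs.mono ((Runs.mulProg (k := k) (v := v + 1) (by omega) hr₂ hdB (by omega) (by omega)
    (by omega) (by omega) (by omega) hX₂ hX₂).seq fun s₃ h₃ =>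
    (Runs.copyProg (k := k) (by omega) (hr₂.keep h₃.1.toKeep (by omega)) hdB (by omega) (by omega)
      (by omega) h₃.2).post fun s₅ h₅ => ⟨h₃.1.toKeep.trans h₅.1.toKeep, ?_, ?_⟩)
    (by simp) (by simp) fun _ h => h
  · intro a ha hn
    have hn' : a ≠ X ∧ a ≠ 21 := by simpa using hn
    rw [h₅.1.frame a ha (by simpa using hn'.1), h₃.1.frame a ha (by simpa using hn'.2),
      hfr₂ a ha hn]
  · rw [pow_succ, pow_mul, sq]
    exact h₅.2

/-- The norm estimate `rootTrace` of the matrix in the array `M`, into the cell `[0, 0]` of the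
array `22`. -/
def rootTraceProg (v M : ℕ) : Prog :=
  .seq (powerProg v M) (.seq (sumInto ⟨22, 6, 6⟩ v 1 (.ref ⟨M, v, v⟩))
    (forLoop v 5 (assign ⟨22, 6, 6⟩ (.sqrt (.ref ⟨22, 6, 6⟩)))))

lemma Runs.rootTraceProg {v X k : ℕ} {s : Mem} {M : Matrix (Fin d) (Fin d) ℝ} (hv : 7 < v)
    (hs : Ready d k s) (hdB : d ≤ B) (hkB : k ≤ B) (hX : X < 20) (hM : Rep (s.ra X) M) :
    Runs sol e B (rootTraceProg v X) s 48 4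
      fun s' => Post v [X, 21, 22] s s' ∧ s'.ra 22 0 0 = rootTrace k M := by
  refine Runs.mono ((Runs.powerProg hv hs hdB hkB hX hM).seq fun s₁ h₁ =>
    (Runs.sumInto (fun l => s₁.ra X l l) hv (by omega) (hs.keep h₁.1.toKeep hv).one
      (hs.keep h₁.1.toKeep hv).dim hdB ?_ (by simp) (by simp; omega) (by simp; omega) ?_).seq
      fun s₂ h₂ =>
    (Runs.forLoop (c := 5) (n := 0) (fun t ra => (∀ a < 30, a ∉ [22] → ra a = s₂.ra a) ∧
      ra 22 0 0 = Real.sqrt^[t] (M ^ 2 ^ k).trace) hv (by omega)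
      ((hs.keep h₁.1.toKeep hv).keep h₂.toKeep hv).one
      ((hs.keep h₁.1.toKeep hv).keep h₂.toKeep hv).rows hkB ⟨fun _ _ _ => rfl, ?_⟩ ?_).post
      fun s' h => ⟨⟨h₁.1.toKeep.trans (h₂.toKeep.trans h.1), ?_⟩, h.2.2⟩)
    (by simp [RExp.cost]) (by simp) fun _ h => h
  · show X < 30
    omega
  · intro l _ s' _ hl hfr
    simp only [RExp.eval, Mem.get, hl, hfr X (by omega) (by simp; omega)]
  · have hr₁ := hs.keep h₁.1.toKeep hv
    have := h₂.val
    simp only [hr₁.zero] at this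
    simp only [this, and_self, if_true, Function.iterate_zero, id]
    rw [Finset.sum_range]
    exact Finset.sum_congr rfl fun l _ => h₁.2 l l
  · intro t ht s₃ hk₃ hv₃ ⟨hfr₃, h22⟩
    have hr₃ := ((hs.keep h₁.1.toKeep hv).keep h₂.toKeep hv).keep hk₃ hv
    refine Runs.mono (Runs.assign (v + 1) s₃ ?_ ?_) (by simp [RExp.cost]) le_rfl fun s₄ h₄ =>
      ⟨h₄.toKeep, fun a ha hn => (h₄.frame a ha (by simpa using hn)).trans (hfr₃ a ha hn), ?_⟩
    · simp [RExp.Proper]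
    · simp
    · have := h₄.val
      simp only [hr₃.zero] at this
      simp only [this, and_self, if_true, RExp.eval, Mem.get, hr₃.zero, h22]
      rw [Function.iterate_succ_apply']
  · intro a ha hn
    have hn' : a ≠ X ∧ a ≠ 21 ∧ a ≠ 22 := by simpa using hn
    rw [h.2.1 a ha (by simpa using hn'.2.2), h₂.frame a ha hn'.2.2,
      h₁.1.frame a ha (by simp [hn'.1, hn'.2.1])]

/-- The two estimates for the sketched matrix in the array `S`, with the embedded matrix in the
array `T`: they are written to the row of the array `8` that the integer variable `z` says. The
integer variable `r` holds the number of rows of `S`. The Gram matrices go to the arrays `15` and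
`16`, their inverses to `17` and `18`, and `19` is used for the matrices whose norms are
estimated. -/
def estimateProg (S r T z : ℕ) : Prog :=
  .seq (gramProg 8 15 S r) (.seq (gramProg 8 16 T 5) (.seq (invProg 8 17 15) (.seq (invProg 8 18 16)
    (.seq (mulProg 8 19 17 16) (.seq (rootTraceProg 8 19)
      (.seq (assign ⟨8, z, 6⟩ (.inv (.ref ⟨22, 6, 6⟩)))
        (.seq (mulProg 8 19 18 15) (.seq (subOneProg 8 19) (.seq (rootTraceProg 8 19)
          (assign ⟨8, z, 7⟩ (.ref ⟨22, 6, 6⟩)))))))))))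

lemma gaussJordan_gram {m : ℕ} (M : Matrix (Fin m) (Fin d) ℝ) :
    gaussJordan (Mᵀ * M) d = (Mᵀ * M)⁻¹ := by
  refine gaussJordan_eq_inv ?_
  have := Matrix.posSemidef_conjTranspose_mul_self M
  rwa [Matrix.conjTranspose_eq_transpose_of_trivial] at this

lemma Runs.estimateProg {S r T z m k : ℕ} {s : Mem} {M : Matrix (Fin m) (Fin d) ℝ}
    {N : Matrix (Fin k) (Fin d) ℝ} (hs : Ready d k s) (hr : r < 8) (hsr : s.nv r = m) (hdB : d ≤ B)
    (hkB : k ≤ B) (hmB : m ≤ B) (hS : S < 14) (hT : T < 14) (hz : z < 8)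
    (hI : Rep (s.ra 14) (1 : Matrix (Fin d) (Fin d) ℝ)) (hM : Rep (s.ra S) M)
    (hN : Rep (s.ra T) N) :
    Runs sol e B (estimateProg S r T z) s 353 4 fun s' =>
      Post 8 [8, 15, 16, 17, 18, 19, 20, 21, 22] s s' ∧
      s'.ra 8 (s.nv z) 0 = (rootTrace k ((Mᵀ * M)⁻¹ * (Nᵀ * N)))⁻¹ ∧
      s'.ra 8 (s.nv z) 1 = rootTrace k ((Nᵀ * N)⁻¹ * (Mᵀ * M) - 1) ∧
      ∀ i, i ≠ s.nv z → s'.ra 8 i = s.ra 8 i := by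
  have h8 : 7 < 8 := by norm_num
  refine Runs.mono ((Runs.gramProg h8 hs hr hsr hdB hmB (by omega) (by omega) (by omega) hM).seq
    (c₂ := 334) (n₂ := 4) fun s₁ ⟨p₁, g₁⟩ => ?_) (by simp) (by simp) fun _ h => h
  have r₁ := hs.keep p₁.toKeep h8
  have T₁ : Rep (s₁.ra T) N := by rw [p₁.frame T (by omega) (by simp; omega)]; exact hN
  refine Runs.mono ((Runs.gramProg h8 r₁ (by omega) r₁.rows hdB hkB (by omega) (by omega) (by omega)
    T₁).seq (c₂ := 315) (n₂ := 4) fun s₂ ⟨p₂, g₂⟩ => ?_) (by simp) (by simp) fun _ h => h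
  have q₂ := p₁.trans (L'' := [15, 16]) p₂ le_rfl (by simp) (by simp)
  have r₂ := hs.keep q₂.toKeep h8
  have I₂ : Rep (s₂.ra 14) (1 : Matrix (Fin d) (Fin d) ℝ) := by
    rw [q₂.frame 14 (by omega) (by simp)]; exact hI
  have G₂ : Rep (s₂.ra 15) (Mᵀ * M) := by rw [p₂.frame 15 (by omega) (by simp)]; exact g₁
  refine Runs.mono ((Runs.invProg h8 r₂ hdB (by omega) (by omega) (by omega) (by omega) I₂ G₂).seq
    (c₂ := 242) (n₂ := 4) fun s₃ ⟨p₃, g₃⟩ => ?_) (by simp) (by simp) fun _ h => h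
  rw [gaussJordan_gram] at g₃
  have r₃ := r₂.keep p₃.toKeep h8
  have I₃ : Rep (s₃.ra 14) (1 : Matrix (Fin d) (Fin d) ℝ) := by
    rw [p₃.frame 14 (by omega) (by simp)]; exact I₂
  have H₃ : Rep (s₃.ra 16) (Nᵀ * N) := by rw [p₃.frame 16 (by omega) (by simp)]; exact g₂
  refine Runs.mono ((Runs.invProg h8 r₃ hdB (by omega) (by omega) (by omega) (by omega) I₃ H₃).seq
    (c₂ := 169) (n₂ := 4) fun s₄ ⟨p₄, g₄⟩ => ?_) (by simp) (by simp) fun _ h => h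
  rw [gaussJordan_gram] at g₄
  have q₄ := q₂.trans (L'' := [15, 16, 17, 18, 20, 21])
    (p₃.trans (L'' := [17, 18, 20, 21]) p₄ le_rfl (by simp) (by simp)) le_rfl (by simp) (by simp)
  have r₄ := r₃.keep p₄.toKeep h8
  have I₄ : Rep (s₄.ra 14) (1 : Matrix (Fin d) (Fin d) ℝ) := by
    rw [p₄.frame 14 (by omega) (by simp)]; exact I₃
  have H₄ : Rep (s₄.ra 16) (Nᵀ * N) := by rw [p₄.frame 16 (by omega) (by simp)]; exact H₃
  have G₄ : Rep (s₄.ra 15) (Mᵀ * M) := by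
    rw [p₄.frame 15 (by omega) (by simp), p₃.frame 15 (by omega) (by simp)]; exact G₂
  have g₃' : Rep (s₄.ra 17) (Mᵀ * M)⁻¹ := by rw [p₄.frame 17 (by omega) (by simp)]; exact g₃
  refine Runs.mono ((Runs.mulProg h8 r₄ hdB (by omega) (by omega) (by omega) (by omega) (by omega)
    g₃' H₄).seq (c₂ := 150) (n₂ := 4) fun s₅ ⟨p₅, g₅⟩ => ?_) (by simp) (by simp) fun _ h => h
  have r₅ := r₄.keep p₅.toKeep h8
  refine Runs.mono ((Runs.rootTraceProg h8 r₅ hdB hkB (by omega) g₅).seq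
    (c₂ := 102) (n₂ := 4) fun s₆ ⟨p₆, g₆⟩ => ?_) (by simp) (by simp) fun _ h => h
  have r₆ := r₅.keep p₆.toKeep h8
  refine Runs.mono ((Runs.assign 8 s₆ (by simp [RExp.Proper]) (by simp)).seq
    (c₂ := 82) (n₂ := 4) fun s₇ p₇ => ?_) (by simp [RExp.cost]) (by simp) fun _ h => h
  have r₇ := r₆.keep p₇.toKeep h8
  have q₇ := (p₅.trans (L'' := [19, 21, 22]) p₆ le_rfl (by simp) (by simp)).trans
    (L'' := [8, 19, 21, 22]) p₇.toPost le_rfl (by simp) (by simp)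
  have I₇ : Rep (s₇.ra 14) (1 : Matrix (Fin d) (Fin d) ℝ) := by
    rw [q₇.frame 14 (by omega) (by simp)]; exact I₄
  have G₇ : Rep (s₇.ra 15) (Mᵀ * M) := by rw [q₇.frame 15 (by omega) (by simp)]; exact G₄
  have g₄' : Rep (s₇.ra 18) (Nᵀ * N)⁻¹ := by rw [q₇.frame 18 (by omega) (by simp)]; exact g₄
  refine Runs.mono ((Runs.mulProg h8 r₇ hdB (by omega) (by omega) (by omega) (by omega) (by omega)
    g₄' G₇).seq (c₂ := 63) (n₂ := 4) fun s₈ ⟨p₈, g₈⟩ => ?_) (by simp) (by simp) fun _ h => h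
  have r₈ := r₇.keep p₈.toKeep h8
  have I₈ : Rep (s₈.ra 14) (1 : Matrix (Fin d) (Fin d) ℝ) := by
    rw [p₈.frame 14 (by omega) (by simp)]; exact I₇
  refine Runs.mono ((Runs.subOneProg h8 r₈ hdB (by omega) (by omega) I₈ g₈).seq
    (c₂ := 52) (n₂ := 4) fun s₉ ⟨p₉, g₉⟩ => ?_) (by simp) (by simp) fun _ h => h
  have r₉ := r₈.keep p₉.toKeep h8
  refine Runs.mono ((Runs.rootTraceProg h8 r₉ hdB hkB (by omega) g₉).seq
    (c₂ := 4) (n₂ := 0) fun s₁₀ ⟨p₁₀, g₁₀⟩ => ?_) (by simp) (by simp) fun _ h => h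
  have r₁₀ := r₉.keep p₁₀.toKeep h8
  have q₁₀ := (p₈.trans (L'' := [19]) p₉ le_rfl (by simp) (by simp)).trans
    (L'' := [19, 21, 22]) p₁₀ le_rfl (by simp) (by simp)
  refine Runs.mono (Runs.assign 8 s₁₀ (by simp [RExp.Proper]) (by simp)) (by simp [RExp.cost])
    le_rfl fun s₁₁ p₁₁ => ?_
  have k₆ : s₆.nv z = s.nv z := by
    rw [p₆.nv z hz, p₅.nv z hz, q₄.nv z hz]
  have k₁₀ : s₁₀.nv z = s.nv z := by
    rw [q₁₀.nv z hz, q₇.nv z hz, q₄.nv z hz]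
  have e₆ : s₆.ra 8 = s.ra 8 := by
    rw [p₆.frame 8 (by omega) (by simp), p₅.frame 8 (by omega) (by simp),
      q₄.frame 8 (by omega) (by simp)]
  have v₇ := p₇.val
  have v₁₁ := p₁₁.val
  simp only [RExp.eval, Mem.get, r₆.zero, r₁₀.zero, r₁₀.one, k₆, k₁₀, g₆, g₁₀, e₆,
    q₁₀.frame 8 (by omega) (by simp)] at v₇ v₁₁
  refine ⟨?_, ?_, ?_, ?_⟩
  · exact q₄.trans (L'' := [8, 15, 16, 17, 18, 19, 20, 21, 22])
      (q₇.trans (L'' := [8, 19, 21, 22]) (q₁₀.trans (L'' := [8, 19, 21, 22]) p₁₁.toPost le_rfl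
        (by simp) (by simp)) le_rfl (by simp) (by simp)) le_rfl (by simp) (by simp)
  · rw [v₁₁, v₇]; simp
  · rw [v₁₁]; simp
  · intro i hi
    rw [v₁₁, v₇]
    funext j
    simp [hi]

end MatrixPrograms

end HessianSketch

namespace HessianSketch

open Matrix

/-! ### Sketching in input-sparsity time -/

section Scatter

variable {d : ℕ} {sol : Solver d} {e : ℕ}

/-- One pass over the list of nonzero entries of `A`: the entry `a` in row `i` adds `w[i] a` to a
cell `dst`, where `w` is the list in column `0` of the real array `val`. Row and column of the
entry are in the integer variables `9` and `10`, and variable `11` holds the cell `i` of the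
integer array `q`. -/
def scatterProg (q val : ℕ) (dst : Ref) : Prog :=
  forLoop 8 2 (.seq (.op (.load 9 0 8)) (.seq (.op (.load 10 1 8)) (.seq (.op (.load 11 q 9))
    (assign dst (.add (.ref dst) (.mul (.ref ⟨val, 9, 6⟩) (.ref ⟨0, 8, 6⟩)))))))

lemma Runs.scatterProg {k q val N : ℕ} {dst : Ref} {s : Mem} (X Y : ℕ → ℕ) (hs : Ready d k s)
    (hN : s.nv 2 = N) (hval : val < 30) (hdst : dst.arr < 30) (hne : val ≠ dst.arr)
    (h0 : 0 ≠ dst.arr)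
    (hXY : ∀ l < N, ∀ s' : Mem, s'.nv 6 = 0 → s'.nv 10 = s.na 1 l →
      s'.nv 11 = s.na q (s.na 0 l) → s'.nv dst.i = X l ∧ s'.nv dst.j = Y l) :
    Runs sol e N (HessianSketch.scatterProg q val dst) s 15 1
      (Upd 8 dst.arr (fun i j => s.ra dst.arr i j + ∑ l ∈ Finset.range N,
        if i = X l ∧ j = Y l then s.ra val (s.na 0 l) 0 * s.ra 0 l 0 else 0) s) := by
  refine (Runs.forLoop (c := 13) (n := 0) (fun t ra => (∀ a < 30, a ≠ dst.arr → ra a = s.ra a) ∧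
    ra dst.arr = fun i j => s.ra dst.arr i j + ∑ l ∈ Finset.range t,
      if i = X l ∧ j = Y l then s.ra val (s.na 0 l) 0 * s.ra 0 l 0 else 0) (by norm_num)
    (by norm_num) hs.one hN le_rfl ⟨fun _ _ _ => rfl, by simp⟩ ?_).post
    fun s' h => ⟨h.1, h.2.1, h.2.2⟩
  intro t ht s₁ hk₁ hv₁ ⟨hfr₁, hd₁⟩
  refine Runs.mono ((Runs.op _ s₁).seq fun s₂ h₂ => (Runs.op _ s₂).seq fun s₃ h₃ =>
    (Runs.op _ s₃).seq fun s₄ h₄ => (Runs.assign 9 s₄ ?_ hdst).post fun s₅ h₅ => ⟨?_, ?_, ?_⟩)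
    (by simp [RExp.cost]) (by simp) fun _ h => h
  · exact ⟨hdst, hval, by simp [RExp.Proper]⟩
  · subst h₄ h₃ h₂
    refine ⟨h₅.na, fun u hu => ?_⟩
    rw [h₅.nv u hu]
    have e1 : u ≠ 9 := by omega
    have e2 : u ≠ 10 := by omega
    have e3 : u ≠ 11 := by omega
    simp [Op.eval, Mem.setVar, Function.update_of_ne, e1, e2, e3]
  · subst h₄ h₃ h₂
    intro a ha hn
    exact (h₅.frame a ha hn).trans (hfr₁ a ha hn)
  · have a6 : s₄.nv 6 = 0 := by
      subst h₄ h₃ h₂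
      simp [Op.eval, Mem.setVar, Function.update_of_ne, hk₁.nv 6 (by norm_num), hs.zero]
    have a8 : s₄.nv 8 = t := by
      subst h₄ h₃ h₂
      simp [Op.eval, Mem.setVar, Function.update_of_ne, hv₁]
    have a9 : s₄.nv 9 = s.na 0 t := by
      subst h₄ h₃ h₂
      simp [Op.eval, Mem.setVar, Function.update_of_ne, hv₁, hk₁.na]
    have a10 : s₄.nv 10 = s.na 1 t := by
      subst h₄ h₃ h₂
      simp [Op.eval, Mem.setVar, Function.update_of_ne, hv₁, hk₁.na]
    have a11 : s₄.nv 11 = s.na q (s.na 0 t) := by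
      subst h₄ h₃ h₂
      simp [Op.eval, Mem.setVar, Function.update_of_ne, hv₁, hk₁.na]
    have ra₄ : s₄.ra = s₁.ra := by subst h₄ h₃ h₂; rfl
    obtain ⟨aX, aY⟩ := hXY t ht s₄ a6 a10 a11
    rw [h₅.val]
    funext i j
    simp only [RExp.eval, Mem.get, ra₄, aX, aY, a6, a8, a9, hd₁, hfr₁ val hval hne,
      hfr₁ 0 (by norm_num) h0, Finset.sum_range_succ]
    by_cases hij : i = X t ∧ j = Y t
    · obtain ⟨rfl, rfl⟩ := hij
      simp only [and_self, if_true]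
      ring
    · simp [hij]

variable {n m : ℕ}

lemma sum_entries {A : Matrix (Fin n) (Fin d) ℝ}
    (ent : Fin (nnz A) ≃ {q : Fin n × Fin d // A q.1 q.2 ≠ 0}) (F : Fin n → Fin d → ℝ)
    (hF : ∀ i j, A i j = 0 → F i j = 0) :
    ∑ l, F (ent l).1.1 (ent l).1.2 = ∑ i, ∑ j, F i j := by
  classical
  rw [Equiv.sum_comp ent fun q => F q.1.1 q.1.2, ← Fintype.sum_prod_type',
    ← Fintype.sum_subtype_add_sum_subtype (fun q : Fin n × Fin d => A q.1 q.2 ≠ 0)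
      fun q => F q.1 q.2, left_eq_add]
  exact Finset.sum_eq_zero fun q _ => hF _ _ (not_not.1 q.2)

lemma fill_val {α : Type} [Zero α] {k : ℕ} (f : Fin k → α) (i : Fin k) : fill f i = f i := by
  simp [fill]

lemma fillCol_val {k : ℕ} (f : Fin k → ℝ) (i : Fin k) : fillCol f i 0 = f i := by
  simp [fillCol, fill_val]

/-- The sum that a pass over the entries accumulates, in terms of the matrix. The condition `E i j`
says which entries contribute to a given cell. -/
lemma sum_range_entries {A : Matrix (Fin n) (Fin d) ℝ}
    (ent : Fin (nnz A) ≃ {q : Fin n × Fin d // A q.1 q.2 ≠ 0}) (w : Fin n → ℝ)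
    (E : ℕ → ℕ → Prop) [∀ i j, Decidable (E i j)] :
    ∑ l ∈ Finset.range (nnz A), (if E (fill (fun l => ((ent l).1.1 : ℕ)) l)
        (fill (fun l => ((ent l).1.2 : ℕ)) l) then
      fillCol w (fill (fun l => ((ent l).1.1 : ℕ)) l) 0 *
        fillCol (fun l => A (ent l).1.1 (ent l).1.2) l 0 else 0) =
      ∑ i : Fin n, ∑ j : Fin d, if E i j then w i * A i j else 0 := by
  rw [Finset.sum_range, ← sum_entries ent (fun i j => if E i j then w i * A i j else 0)]
  · refine Finset.sum_congr rfl fun l _ => ?_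
    simp only [fill_val, fillCol_val]
  · intro i j h
    simp [h]

end Scatter

/-! ### The program -/

section Algorithm

variable {n d m m₁ m₂ k : ℕ} {sol : Solver d} {e : ℕ} {η : ℝ}

/-- The part of the program that reads the input: the sketched matrices `S₁A`, `S₂A`, `T₁A`, `T₂A`
and the vector `Aᵀb`, in `O(nnz(A))` steps. They go to the arrays `10`, `11`, `12`, `13` and `9`. -/
def sketchProg : Prog :=
  .seq (.op (.const 6 0)) (.seq (.op (.const 7 1)) (.seq (scatterProg 2 2 ⟨10, 11, 10⟩)
    (.seq (scatterProg 3 3 ⟨11, 11, 10⟩) (.seq (scatterProg 4 4 ⟨12, 11, 10⟩)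
      (.seq (scatterProg 5 5 ⟨13, 11, 10⟩) (scatterProg 0 1 ⟨9, 10, 6⟩))))))

/-- The memory after the sketching phase. -/
structure Sketched (A : Matrix (Fin n) (Fin d) ℝ) (b : Fin n → ℝ) (S₁ : CSType m₁ n)
    (S₂ : CSType m₂ n) (T₁ T₂ : CSType k n) (s : Mem) : Prop where
  ready : Ready d k s
  rows₁ : s.nv 3 = m₁
  rows₂ : s.nv 4 = m₂
  sketch₁ : Rep (s.ra 10) (S₁.mat * A)
  sketch₂ : Rep (s.ra 11) (S₂.mat * A)
  embed₁ : Rep (s.ra 12) (T₁.mat * A)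
  embed₂ : Rep (s.ra 13) (T₂.mat * A)
  linear : ∀ j : Fin d, s.ra 9 j 0 = (Aᵀ *ᵥ b) j
  blank : s.ra 14 = fun _ _ => 0

/-- The input of the program, with the conventions for the integer variables in force. -/
structure Input (A : Matrix (Fin n) (Fin d) ℝ) (b : Fin n → ℝ)
    (ent : Fin (nnz A) ≃ {q : Fin n × Fin d // A q.1 q.2 ≠ 0}) (S₁ : CSType m₁ n)
    (S₂ : CSType m₂ n) (T₁ T₂ : CSType k n) (s : Mem) : Prop where
  ready : Ready d k s
  entries : s.nv 2 = nnz A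
  rows₁ : s.nv 3 = m₁
  rows₂ : s.nv 4 = m₂
  row : s.na 0 = fill fun l => ((ent l).1.1 : ℕ)
  col : s.na 1 = fill fun l => ((ent l).1.2 : ℕ)
  pos₁ : s.na 2 = fill fun i => (S₁.pos i : ℕ)
  pos₂ : s.na 3 = fill fun i => (S₂.pos i : ℕ)
  pos₃ : s.na 4 = fill fun i => (T₁.pos i : ℕ)
  pos₄ : s.na 5 = fill fun i => (T₂.pos i : ℕ)
  entry : s.ra 0 = fillCol fun l => A (ent l).1.1 (ent l).1.2
  rhs : s.ra 1 = fillCol b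
  val₁ : s.ra 2 = fillCol S₁.val
  val₂ : s.ra 3 = fillCol S₂.val
  val₃ : s.ra 4 = fillCol T₁.val
  val₄ : s.ra 5 = fillCol T₂.val

variable {A : Matrix (Fin n) (Fin d) ℝ} {b : Fin n → ℝ}
  {ent : Fin (nnz A) ≃ {q : Fin n × Fin d // A q.1 q.2 ≠ 0}} {S₁ : CSType m₁ n} {S₂ : CSType m₂ n}
  {T₁ T₂ : CSType k n}

lemma Input.post {s s' : Mem} {L : List ℕ} (h : Input A b ent S₁ S₂ T₁ T₂ s) (hp : Post 8 L s s')
    (hL : ∀ a ∈ L, 7 ≤ a) : Input A b ent S₁ S₂ T₁ T₂ s' := by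
  have hn : ∀ a < 7, a ∉ L := fun a ha hm => absurd (hL a hm) (by omega)
  exact
    { ready := h.ready.keep hp.toKeep (by norm_num)
      entries := by rw [hp.nv 2 (by norm_num), h.entries]
      rows₁ := by rw [hp.nv 3 (by norm_num), h.rows₁]
      rows₂ := by rw [hp.nv 4 (by norm_num), h.rows₂]
      row := by rw [hp.na, h.row]
      col := by rw [hp.na, h.col]
      pos₁ := by rw [hp.na, h.pos₁]
      pos₂ := by rw [hp.na, h.pos₂]
      pos₃ := by rw [hp.na, h.pos₃]
      pos₄ := by rw [hp.na, h.pos₄]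
      entry := by rw [hp.frame 0 (by norm_num) (hn 0 (by norm_num)), h.entry]
      rhs := by rw [hp.frame 1 (by norm_num) (hn 1 (by norm_num)), h.rhs]
      val₁ := by rw [hp.frame 2 (by norm_num) (hn 2 (by norm_num)), h.val₁]
      val₂ := by rw [hp.frame 3 (by norm_num) (hn 3 (by norm_num)), h.val₂]
      val₃ := by rw [hp.frame 4 (by norm_num) (hn 4 (by norm_num)), h.val₃]
      val₄ := by rw [hp.frame 5 (by norm_num) (hn 5 (by norm_num)), h.val₄] }

/-- One pass over the entries accumulates the sketched matrix. -/
lemma Runs.scatter_sketch {s : Mem} (hin : Input A b ent S₁ S₂ T₁ T₂ s) (S : CSType m n) {q D : ℕ}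
    (hq : q < 7) (hD : 7 ≤ D) (hD' : D < 30) (hpos : s.na q = fill fun i => (S.pos i : ℕ))
    (hval : s.ra q = fillCol S.val) (hblank : s.ra D = fun _ _ => 0) :
    Runs sol e (nnz A) (HessianSketch.scatterProg q q ⟨D, 11, 10⟩) s 15 1 fun s' =>
      Post 8 [D] s s' ∧ Rep (s'.ra D) (S.mat * A) := by
  refine (Runs.scatterProg (dst := ⟨D, 11, 10⟩) (fun l => s.na q (s.na 0 l)) (fun l => s.na 1 l)
    hin.ready hin.entries (by omega) hD' (by simp; omega) (by simp; omega)
    fun l _ s' _ h10 h11 => ⟨h11, h10⟩).post fun s' h => ⟨h.toPost, fun x y => ?_⟩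
  rw [h.val]
  simp only [hblank, zero_add, hpos, hval, hin.row, hin.col, hin.entry]
  rw [sum_range_entries ent S.val
    (fun i j => (x : ℕ) = fill (fun i => (S.pos i : ℕ)) i ∧ (y : ℕ) = j), mat_mul_apply]
  refine Finset.sum_congr rfl fun i _ => ?_
  simp only [fill_val, Fin.val_inj]
  by_cases hx : x = S.pos i
  · simp [hx]
  · simp [hx, Ne.symm hx]

lemma Runs.scatter_linear {s : Mem} (hin : Input A b ent S₁ S₂ T₁ T₂ s)
    (hblank : s.ra 9 = fun _ _ => 0) :
    Runs sol e (nnz A) (HessianSketch.scatterProg 0 1 ⟨9, 10, 6⟩) s 15 1 fun s' =>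
      Post 8 [9] s s' ∧ ∀ j : Fin d, s'.ra 9 j 0 = (Aᵀ *ᵥ b) j := by
  refine (Runs.scatterProg (dst := ⟨9, 10, 6⟩) (fun l => s.na 1 l) (fun _ => 0)
    hin.ready hin.entries (by omega) (by simp) (by simp) (by simp)
    fun l _ s' h6 h10 _ => ⟨h10, h6⟩).post fun s' h => ⟨h.toPost, fun y => ?_⟩
  rw [h.val]
  simp only [hblank, zero_add, hin.row, hin.col, hin.entry, hin.rhs, and_true]
  rw [sum_range_entries ent b (fun _ j => (y : ℕ) = j), Matrix.mulVec, dotProduct]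
  refine Finset.sum_congr rfl fun i _ => ?_
  simp [Fin.val_inj, mul_comm]

lemma Runs.sketchProg :
    Runs sol e (nnz A) HessianSketch.sketchProg (initMem η A b ent S₁ S₂ T₁ T₂) 77 1
      (Sketched A b S₁ S₂ T₁ T₂) := by
  refine Runs.mono ((Runs.op _ _).seq fun s₀ h₀ => (Runs.op _ s₀).seq (c₂ := 75) (n₂ := 1)
    fun s₁ h₁ => ?_) (by simp) (by simp) fun _ h => h
  have i₁ : Input A b ent S₁ S₂ T₁ T₂ s₁ := by
    subst h₁ h₀
    exact ⟨⟨rfl, rfl, rfl, rfl⟩, rfl, rfl, rfl, rfl, rfl, rfl, rfl, rfl, rfl, rfl, rfl, rfl, rfl,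
      rfl, rfl⟩
  have b₉ : s₁.ra 9 = fun _ _ => 0 := by subst h₁ h₀; rfl
  have b₁₀ : s₁.ra 10 = fun _ _ => 0 := by subst h₁ h₀; rfl
  have b₁₁ : s₁.ra 11 = fun _ _ => 0 := by subst h₁ h₀; rfl
  have b₁₂ : s₁.ra 12 = fun _ _ => 0 := by subst h₁ h₀; rfl
  have b₁₃ : s₁.ra 13 = fun _ _ => 0 := by subst h₁ h₀; rfl
  have b₁₄ : s₁.ra 14 = fun _ _ => 0 := by subst h₁ h₀; rfl
  clear h₀ h₁
  refine Runs.mono ((Runs.scatter_sketch i₁ S₁ (by norm_num) (by norm_num) (by norm_num) i₁.pos₁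
    i₁.val₁ b₁₀).seq (c₂ := 60) (n₂ := 1) fun s₂ ⟨p₂, r₂⟩ => ?_) (by simp) (by simp) fun _ h => h
  have i₂ := i₁.post p₂ (by simp)
  refine Runs.mono ((Runs.scatter_sketch i₂ S₂ (by norm_num) (by norm_num) (by norm_num) i₂.pos₂
    i₂.val₂ (by rw [p₂.frame 11 (by norm_num) (by simp), b₁₁])).seq (c₂ := 45) (n₂ := 1)
    fun s₃ ⟨p₃, r₃⟩ => ?_) (by simp) (by simp) fun _ h => h
  have i₃ := i₂.post p₃ (by simp)
  have q₃ := p₂.trans (L'' := [10, 11]) p₃ le_rfl (by simp) (by simp)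
  refine Runs.mono ((Runs.scatter_sketch i₃ T₁ (by norm_num) (by norm_num) (by norm_num) i₃.pos₃
    i₃.val₃ (by rw [q₃.frame 12 (by norm_num) (by simp), b₁₂])).seq (c₂ := 30) (n₂ := 1)
    fun s₄ ⟨p₄, r₄⟩ => ?_) (by simp) (by simp) fun _ h => h
  have i₄ := i₃.post p₄ (by simp)
  have q₄ := q₃.trans (L'' := [10, 11, 12]) p₄ le_rfl (by simp) (by simp)
  refine Runs.mono ((Runs.scatter_sketch i₄ T₂ (by norm_num) (by norm_num) (by norm_num) i₄.pos₄
    i₄.val₄ (by rw [q₄.frame 13 (by norm_num) (by simp), b₁₃])).seq (c₂ := 15) (n₂ := 1)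
    fun s₅ ⟨p₅, r₅⟩ => ?_) (by simp) (by simp) fun _ h => h
  have i₅ := i₄.post p₅ (by simp)
  have q₅ := q₄.trans (L'' := [10, 11, 12, 13]) p₅ le_rfl (by simp) (by simp)
  refine (Runs.scatter_linear i₅ (by rw [q₅.frame 9 (by norm_num) (by simp), b₉])).post
    fun s₆ ⟨p₆, r₆⟩ => ?_
  have i₆ := i₅.post p₆ (by simp)
  refine ⟨i₆.ready, i₆.rows₁, i₆.rows₂, ?_, ?_, ?_, ?_, r₆, ?_⟩
  · rw [p₆.frame 10 (by norm_num) (by simp), p₅.frame 10 (by norm_num) (by simp),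
      p₄.frame 10 (by norm_num) (by simp), p₃.frame 10 (by norm_num) (by simp)]
    exact r₂
  · rw [p₆.frame 11 (by norm_num) (by simp), p₅.frame 11 (by norm_num) (by simp),
      p₄.frame 11 (by norm_num) (by simp)]
    exact r₃
  · rw [p₆.frame 12 (by norm_num) (by simp), p₅.frame 12 (by norm_num) (by simp)]
    exact r₄
  · rw [p₆.frame 13 (by norm_num) (by simp)]
    exact r₅
  · rw [p₆.frame 14 (by norm_num) (by simp), q₅.frame 14 (by norm_num) (by simp), b₁₄]

/-- The estimates for both sketches, and the two products that are to be compared. The array `14`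
receives the identity matrix. -/
def estimatesProg : Prog :=
  .seq (forLoop 8 1 (assign ⟨14, 8, 8⟩ (.nat 1)))
    (.seq (estimateProg 10 3 12 6) (.seq (estimateProg 11 4 13 7)
      (.seq (assign ⟨22, 6, 6⟩ (.mul (.ref ⟨8, 6, 7⟩) (.ref ⟨8, 7, 6⟩)))
        (assign ⟨23, 6, 6⟩ (.mul (.ref ⟨8, 7, 7⟩) (.ref ⟨8, 6, 6⟩))))))

/-- The memory after the estimation phase. -/
structure Estimated (s₀ s : Mem) (M₁ : Matrix (Fin m₁) (Fin d) ℝ) (M₂ : Matrix (Fin m₂) (Fin d) ℝ)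
    (N₁ N₂ : Matrix (Fin k) (Fin d) ℝ) : Prop
    extends Post 8 [8, 14, 15, 16, 17, 18, 19, 20, 21, 22, 23] s₀ s where
  z₁₁ : s.ra 8 0 0 = (rootTrace k ((M₁ᵀ * M₁)⁻¹ * (N₁ᵀ * N₁)))⁻¹
  z₁₂ : s.ra 8 0 1 = rootTrace k ((N₁ᵀ * N₁)⁻¹ * (M₁ᵀ * M₁) - 1)
  z₂₁ : s.ra 8 1 0 = (rootTrace k ((M₂ᵀ * M₂)⁻¹ * (N₂ᵀ * N₂)))⁻¹
  z₂₂ : s.ra 8 1 1 = rootTrace k ((N₂ᵀ * N₂)⁻¹ * (M₂ᵀ * M₂) - 1)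
  left : s.ra 22 0 0 = s.ra 8 0 1 * s.ra 8 1 0
  right : s.ra 23 0 0 = s.ra 8 1 1 * s.ra 8 0 0

lemma Runs.identity {B : ℕ} {s : Mem} (hs : Ready d k s) (hdB : d ≤ B)
    (hblank : s.ra 14 = fun _ _ => 0) :
    Runs sol e B (HessianSketch.forLoop 8 1 (HessianSketch.assign ⟨14, 8, 8⟩ (.nat 1))) s 5 1
      fun s' => Post 8 [14] s s' ∧ Rep (s'.ra 14) (1 : Matrix (Fin d) (Fin d) ℝ) := by
  refine (Runs.forLoop (c := 3) (n := 0) (fun t ra => (∀ a < 30, a ∉ [14] → ra a = s.ra a) ∧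
    ra 14 = fun i j => if i = j ∧ i < t then 1 else 0) (by norm_num) (by norm_num) hs.one hs.dim hdB
    ⟨fun _ _ _ => rfl, by simp [hblank]⟩ ?_).post fun s' h => ⟨⟨h.1, h.2.1⟩, fun i j => ?_⟩
  · intro t _ s₁ hk₁ hv₁ ⟨hfr₁, h14⟩
    refine Runs.mono (Runs.assign 9 s₁ trivial (by simp)) (by simp [RExp.cost]) le_rfl fun s₂ h₂ =>
      ⟨h₂.toKeep, fun a ha hn => (h₂.frame a ha (by simpa using hn)).trans (hfr₁ a ha hn), ?_⟩
    have := h₂.val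
    simp only at this
    rw [this, hv₁, h14]
    funext i j
    simp only [RExp.eval, Nat.cast_one]
    split_ifs <;> first | rfl | (exfalso; omega)
  · rw [h.2.2]
    simp [Matrix.one_apply, Fin.val_inj]

lemma Runs.estimatesProg {B : ℕ} {s : Mem} (hs : Sketched A b S₁ S₂ T₁ T₂ s) (hdB : d ≤ B)
    (hkB : k ≤ B) (h₁B : m₁ ≤ B) (h₂B : m₂ ≤ B) :
    Runs sol e B estimatesProg s 725 4 fun s' =>
      Estimated s s' (S₁.mat * A) (S₂.mat * A) (T₁.mat * A) (T₂.mat * A) := by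
  have h8 : 7 < 8 := by norm_num
  refine Runs.mono ((Runs.identity hs.ready hdB hs.blank).seq (c₂ := 720) (n₂ := 4)
    fun s₁ ⟨p₁, I₁⟩ => ?_) (by simp) (by simp) fun _ h => h
  have r₁ := hs.ready.keep p₁.toKeep h8
  refine Runs.mono ((Runs.estimateProg (M := S₁.mat * A) (N := T₁.mat * A) r₁ (by norm_num)
    (by rw [p₁.nv 3 (by norm_num)]; exact hs.rows₁) hdB hkB h₁B (by norm_num) (by norm_num)
    (by norm_num) I₁ (by rw [p₁.frame 10 (by norm_num) (by simp)]; exact hs.sketch₁)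
    (by rw [p₁.frame 12 (by norm_num) (by simp)]; exact hs.embed₁)).seq (c₂ := 367) (n₂ := 4)
    fun s₂ ⟨p₂, u₂, v₂, _⟩ => ?_) (by simp) (by simp) fun _ h => h
  have r₂ := r₁.keep p₂.toKeep h8
  have q₂ := p₁.trans (L'' := [8, 14, 15, 16, 17, 18, 19, 20, 21, 22]) p₂ le_rfl (by simp)
    (by simp)
  have I₂ : Rep (s₂.ra 14) (1 : Matrix (Fin d) (Fin d) ℝ) := by
    rw [p₂.frame 14 (by norm_num) (by simp)]; exact I₁
  refine Runs.mono ((Runs.estimateProg (M := S₂.mat * A) (N := T₂.mat * A) r₂ (by norm_num)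
    (by rw [q₂.nv 4 (by norm_num)]; exact hs.rows₂) hdB hkB h₂B (by norm_num) (by norm_num)
    (by norm_num) I₂ (by rw [q₂.frame 11 (by norm_num) (by simp)]; exact hs.sketch₂)
    (by rw [q₂.frame 13 (by norm_num) (by simp)]; exact hs.embed₂)).seq (c₂ := 14) (n₂ := 0)
    fun s₃ ⟨p₃, u₃, v₃, w₃⟩ => ?_) (by simp) (by simp) fun _ h => h
  have r₃ := r₂.keep p₃.toKeep h8
  have q₃ := q₂.trans (L'' := [8, 14, 15, 16, 17, 18, 19, 20, 21, 22]) p₃ le_rfl (by simp)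
    (by simp)
  rw [r₁.zero] at u₂ v₂
  rw [r₂.one] at u₃ v₃ w₃
  have w₀ := w₃ 0 (by norm_num)
  refine Runs.mono ((Runs.assign 8 s₃ (by simp [RExp.Proper]) (by simp)).seq fun s₄ p₄ =>
    (Runs.assign 8 s₄ (by simp [RExp.Proper]) (by simp)).post fun s₅ p₅ => ?_)
    (by simp [RExp.cost]) (by simp) fun _ h => h
  have r₄ := r₃.keep p₄.toKeep h8
  have q₅ := q₃.trans (L'' := [8, 14, 15, 16, 17, 18, 19, 20, 21, 22, 23])
    (p₄.toPost.trans (L'' := [22, 23]) p₅.toPost le_rfl (by simp) (by simp)) le_rfl (by simp)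
    (by simp)
  have e₄ : s₄.ra 8 = s₃.ra 8 := p₄.frame 8 (by norm_num) (by simp)
  have e₅ : s₅.ra 8 = s₃.ra 8 := by rw [p₅.frame 8 (by norm_num) (by simp), e₄]
  have l₄ := p₄.val
  have l₅ := p₅.val
  simp only [RExp.eval, Mem.get, r₃.zero, r₃.one, r₄.zero, r₄.one, e₄] at l₄ l₅
  exact
    { toPost := q₅
      z₁₁ := by rw [e₅, w₀, u₂]
      z₁₂ := by rw [e₅, w₀, v₂]
      z₂₁ := by rw [e₅, u₃]
      z₂₂ := by rw [e₅, v₃]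
      left := by rw [p₅.frame 22 (by norm_num) (by simp), l₄, e₅]; simp
      right := by rw [l₅, e₅]; simp }

/-- The program of the algorithm. The better sketch is selected by comparing `ẑ₁₂ ẑ₂₁` and
`ẑ₂₂ ẑ₁₁`, which avoids quotients with denominator zero. -/
def algorithmProg : Prog :=
  .seq sketchProg (.seq estimatesProg
    (.ite (.rlt ⟨22, 6, 6⟩ ⟨23, 6, 6⟩) (.solve 10 3 9 7) (.solve 11 4 9 7)))

lemma isSolution_call {𝒞 : Set (Fin d → ℝ)} (hcor : sol.CorrectFor 𝒞) {s : Mem} {X r c x : ℕ}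
    {M : Matrix (Fin m) (Fin d) ℝ} {w : Fin d → ℝ} (hr : s.nv r = m) (hM : Rep (s.ra X) M)
    (hw : ∀ j : Fin d, s.ra c j 0 = w j) (hex : ∃ y, IsSolution 𝒞 M w y) :
    IsSolution 𝒞 M w fun i => (sol.call X r c x s).ra x i 0 := by
  subst hr
  have h1 : (fun (i : Fin (s.nv r)) (j : Fin d) => s.ra X i j) = M := by
    funext i j
    exact hM i j
  have h2 : (fun j : Fin d => s.ra c j 0) = w := funext hw
  have : (fun i : Fin d => (sol.call X r c x s).ra x i 0) = sol (s.nv r) M w := by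
    funext i
    simp only [Solver.call, i.2, dif_pos, and_self, if_true]
    rw [h1, h2]
  rw [this]
  exact hcor _ _ _ hex

lemma ra_call_of_ne {s : Mem} {X r c x a : ℕ} (h : a ≠ x) :
    (sol.call X r c x s).ra a = s.ra a := by
  funext i j
  simp [Solver.call, h]

/-- The embedding used for an estimate is injective on the column space. -/
lemma IsEstimate.injective {S : Matrix (Fin m) (Fin n) ℝ} {T : Matrix (Fin k) (Fin n) ℝ}
    {z₁ z₂ : ℝ} (h : IsEstimate η A S T z₁ z₂) : Function.Injective (T * A).mulVec := by
  obtain ⟨Q, R, hQR, hR, -⟩ := h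
  refine injective_of_isUnit_det_gram ?_
  rw [hQR.eq_mul, Matrix.transpose_mul, Matrix.mul_assoc, ← Matrix.mul_assoc Qᵀ, hQR.orthonormal,
    Matrix.one_mul, Matrix.det_mul, Matrix.det_transpose]
  exact hR.mul hR

/-- The two estimates are nonnegative and do not vanish together, so that their ratio is never the
undefined `0 / 0`. -/
lemma IsEstimate.sign (hd : 0 < d) (hη : 0 < η) (hη3 : η < 1 / 3) {S : Matrix (Fin m) (Fin n) ℝ}
    {T : Matrix (Fin k) (Fin n) ℝ} {z₁ z₂ : ℝ} (h : IsEstimate η A S T z₁ z₂) :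
    0 ≤ z₁ ∧ 0 ≤ z₂ ∧ (z₁ = 0 → 0 < z₂) := by
  obtain ⟨Q, R, -, -, h1, h2⟩ := h
  have hnn := opNorm_nonneg ((S * A * R⁻¹)ᵀ * (S * A * R⁻¹) - 1)
  have hsum := one_le_sigmaMin_sq_add_opNorm hd (S * A * R⁻¹)
  have hsq := sq_nonneg (sigmaMin (S * A * R⁻¹))
  rw [abs_le] at h1 h2
  refine ⟨by nlinarith, by nlinarith, fun h0 => ?_⟩
  rw [h0] at h1
  have : sigmaMin (S * A * R⁻¹) ^ 2 = 0 := by nlinarith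
  nlinarith

/-- Ratios are compared by cross multiplication, also if one or both of them are infinite. -/
lemma ratio_lt_ratio_iff {a b a' b' : ℝ} (ha : 0 ≤ a) (hb : 0 ≤ b) (hb' : 0 ≤ b')
    (h : b = 0 → 0 < a) (h' : b' = 0 → 0 < a') : ratio a b < ratio a' b' ↔ a * b' < a' * b := by
  have htop : ∀ {x y : ℝ}, y = 0 → 0 < x → ratio x y = ⊤ := fun {x y} hy hx => by
    rw [ratio, hy, ENNReal.ofReal_zero, ENNReal.div_zero]
    simpa using hx
  rcases hb.eq_or_lt with h0 | h0
  · rw [htop h0.symm (h h0.symm), ← h0, mul_zero]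
    simp only [not_top_lt, false_iff, not_lt]
    exact mul_nonneg ha hb'
  · have hr : ratio a b = ENNReal.ofReal (a / b) := (ENNReal.ofReal_div_of_pos h0).symm
    rcases hb'.eq_or_lt with h0' | h0'
    · rw [htop h0'.symm (h' h0'.symm), hr, ← h0', mul_zero]
      exact iff_of_true ENNReal.ofReal_lt_top (mul_pos (h' h0'.symm) h0)
    · have hr' : ratio a' b' = ENNReal.ofReal (a' / b') := (ENNReal.ofReal_div_of_pos h0').symm
      rw [hr, hr', ENNReal.ofReal_lt_ofReal_iff_of_nonneg (div_nonneg ha hb),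
        div_lt_div_iff₀ h0 h0']

/-- If the algorithm can be carried out at all, then the program selected by any valid estimates
has a solution: a finite ratio certifies full rank, and if both ratios are infinite, then every run
selects the second sketch. -/
lemma exists_isSolution_of_isRun (hd : 0 < d) (hη : 0 < η) (hη3 : η < 1 / 3)
    {S₁ : Matrix (Fin m₁) (Fin n) ℝ} {S₂ : Matrix (Fin m₂) (Fin n) ℝ}
    {T₁ T₂ : Matrix (Fin k) (Fin n) ℝ} {𝒞 : Set (Fin d → ℝ)} (hclosed : IsClosed 𝒞)
    {x₀ : Fin d → ℝ} (hx₀ : x₀ ∈ 𝒞) {o : Output d} (ho : IsRun η A b 𝒞 S₁ S₂ T₁ T₂ o)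
    {z₁₁ z₁₂ z₂₁ z₂₂ : ℝ} (h₁ : IsEstimate η A S₁ T₁ z₁₁ z₁₂) (h₂ : IsEstimate η A S₂ T₂ z₂₁ z₂₂) :
    (ratio z₁₂ z₁₁ < ratio z₂₂ z₂₁ → ∃ x, IsSolution 𝒞 (S₁ * A) (Aᵀ *ᵥ b) x) ∧
    (¬ ratio z₁₂ z₁₁ < ratio z₂₂ z₂₁ → ∃ x, IsSolution 𝒞 (S₂ * A) (Aᵀ *ᵥ b) x) := by
  refine ⟨fun h => h₁.exists_isSolution hd hη hη3 h.ne_top hclosed hx₀ _, fun h => ?_⟩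
  by_cases ht : ratio z₂₂ z₂₁ = ⊤
  · have ht₁ : ratio z₁₂ z₁₁ = ⊤ := by
      rw [ht, not_lt] at h
      exact top_le_iff.1 h
    have ho₁ := (ho.1.ratio_eq_top_iff hd hη hη3).2 ((h₁.ratio_eq_top_iff hd hη hη3).1 ht₁)
    exact ⟨o.x, ho.2.2.2 (by rw [ho₁]; exact not_top_lt)⟩
  · exact h₂.exists_isSolution hd hη hη3 ht hclosed hx₀ _

/-- Correctness and running time of the program. -/
lemma exec_algorithmProg (hd : 0 < d) (hη : 0 < η) (hη3 : η < 1 / 3) (hk : 0 < k)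
    (hkd : (d : ℝ) / η ≤ k) {𝒞 : Set (Fin d → ℝ)} (hclosed : IsClosed 𝒞) {x₀ : Fin d → ℝ}
    (hx₀ : x₀ ∈ 𝒞) (hcor : sol.CorrectFor 𝒞) {B : ℕ} (hdB : B = d + k + m₁ + m₂) :
    ∃ t s, Exec sol e algorithmProg (initMem η A b ent S₁ S₂ T₁ T₂) t s ∧
      t ≤ 77 * (nnz A + 1) + 725 * (B + 1) ^ 4 + 1 + (B + 1) ^ e ∧
      ((∃ o : Output d, IsRun η A b 𝒞 S₁.mat S₂.mat T₁.mat T₂.mat o) →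
        IsRun η A b 𝒞 S₁.mat S₂.mat T₁.mat T₂.mat (s.output d)) := by
  obtain ⟨t₁, s₁, hex₁, ht₁, hs₁⟩ := Runs.sketchProg (sol := sol) (e := e) (η := η) (A := A)
    (b := b) (ent := ent) (S₁ := S₁) (S₂ := S₂) (T₁ := T₁) (T₂ := T₂)
  obtain ⟨t₂, s₂, hex₂, ht₂, hs₂⟩ := Runs.estimatesProg (sol := sol) (e := e) (B := B) hs₁
    (by omega) (by omega) (by omega) (by omega)
  have r₂ := hs₁.ready.keep hs₂.toKeep (by norm_num)
  have n₁ : s₂.nv 3 = m₁ := by rw [hs₂.nv 3 (by norm_num), hs₁.rows₁]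
  have n₂ : s₂.nv 4 = m₂ := by rw [hs₂.nv 4 (by norm_num), hs₁.rows₂]
  have M₁ : Rep (s₂.ra 10) (S₁.mat * A) := by
    rw [hs₂.frame 10 (by norm_num) (by simp)]; exact hs₁.sketch₁
  have M₂ : Rep (s₂.ra 11) (S₂.mat * A) := by
    rw [hs₂.frame 11 (by norm_num) (by simp)]; exact hs₁.sketch₂
  have w₂ : ∀ j : Fin d, s₂.ra 9 j 0 = (Aᵀ *ᵥ b) j := by
    rw [hs₂.frame 9 (by norm_num) (by simp)]; exact hs₁.linear
  have htest : (Test.rlt ⟨22, 6, 6⟩ ⟨23, 6, 6⟩).holds s₂ ↔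
      s₂.ra 8 0 1 * s₂.ra 8 1 0 < s₂.ra 8 1 1 * s₂.ra 8 0 0 := by
    simp only [Test.holds, Mem.get, r₂.zero, hs₂.left, hs₂.right]
  have hrun : ∀ o : Output d, IsRun η A b 𝒞 S₁.mat S₂.mat T₁.mat T₂.mat o →
      IsEstimate η A S₁.mat T₁.mat (s₂.ra 8 0 0) (s₂.ra 8 0 1) ∧
      IsEstimate η A S₂.mat T₂.mat (s₂.ra 8 1 0) (s₂.ra 8 1 1) := by
    intro o ho
    have hdk := natCast_le_one_add_pow hη hkd
    rw [hs₂.z₁₁, hs₂.z₁₂, hs₂.z₂₁, hs₂.z₂₂]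
    exact ⟨isEstimate_rootTrace hd hη hk hdk ho.1.injective,
      isEstimate_rootTrace hd hη hk hdk ho.2.1.injective⟩
  have hiff : ∀ o : Output d, IsRun η A b 𝒞 S₁.mat S₂.mat T₁.mat T₂.mat o →
      (ratio (s₂.ra 8 0 1) (s₂.ra 8 0 0) < ratio (s₂.ra 8 1 1) (s₂.ra 8 1 0) ↔
        (Test.rlt ⟨22, 6, 6⟩ ⟨23, 6, 6⟩).holds s₂) := by
    intro o ho
    obtain ⟨e₁, e₂⟩ := hrun o ho
    have g₁ := e₁.sign hd hη hη3
    have g₂ := e₂.sign hd hη hη3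
    rw [htest]
    exact ratio_lt_ratio_iff g₁.2.1 g₁.1 g₂.1 g₁.2.2 g₂.2.2
  rw [pow_one] at ht₁
  by_cases hc : (Test.rlt ⟨22, 6, 6⟩ ⟨23, 6, 6⟩).holds s₂
  · refine ⟨_, _, hex₁.seq (hex₂.seq (Exec.ite_true hc (Exec.solve 10 3 9 7 s₂))), ?_, ?_⟩
    · have : (s₂.nv 3 + d) ^ e ≤ (B + 1) ^ e := Nat.pow_le_pow_left (by omega) e
      omega
    · rintro ⟨o, ho⟩
      obtain ⟨e₁, e₂⟩ := hrun o ho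
      have hlt := (hiff o ho).2 hc
      have h8 : (sol.call 10 3 9 7 s₂).ra 8 = s₂.ra 8 := ra_call_of_ne (by norm_num)
      have hsol := isSolution_call (x := 7) hcor n₁ M₁ w₂
        ((exists_isSolution_of_isRun hd hη hη3 hclosed hx₀ ho e₁ e₂).1 hlt)
      simp only [IsRun, Mem.output, h8]
      exact ⟨e₁, e₂, fun _ => hsol, fun h => absurd hlt h⟩
  · refine ⟨_, _, hex₁.seq (hex₂.seq (Exec.ite_false hc (Exec.solve 11 4 9 7 s₂))), ?_, ?_⟩
    · have : (s₂.nv 4 + d) ^ e ≤ (B + 1) ^ e := Nat.pow_le_pow_left (by omega) e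
      omega
    · rintro ⟨o, ho⟩
      obtain ⟨e₁, e₂⟩ := hrun o ho
      have hge := fun h => hc ((hiff o ho).1 h)
      have h8 : (sol.call 11 4 9 7 s₂).ra 8 = s₂.ra 8 := ra_call_of_ne (by norm_num)
      have hsol := isSolution_call (x := 7) hcor n₂ M₂ w₂
        ((exists_isSolution_of_isRun hd hη hη3 hclosed hx₀ ho e₁ e₂).2 hge)
      simp only [IsRun, Mem.output, h8]
      exact ⟨e₁, e₂, fun h => absurd h hge, fun _ => hsol⟩

/-- The step count in terms of `nnz(A) log(1/η)` and `d / η`, if the numbers of rows are bounded as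
in the algorithm. -/
lemma time_le {K N t : ℕ} {x L : ℝ} (hx : 1 ≤ x) (hL : 1 ≤ L) (hd : (d : ℝ) ≤ x)
    (h₁ : m₁ ≤ K * d ^ 2) (h₂ : m₂ ≤ K * d ^ 2) (hk : (k : ℝ) ≤ K * x ^ K)
    (ht : t ≤ 77 * (N + 1) + 725 * (d + k + m₁ + m₂ + 1) ^ 4 + 1 + (d + k + m₁ + m₂ + 1) ^ e) :
    (t : ℝ) ≤ ((78 + 725 * (3 * K + 2) ^ 4 + (3 * K + 2) ^ e : ℕ) : ℝ) * (N * L) +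
      ((78 + 725 * (3 * K + 2) ^ 4 + (3 * K + 2) ^ e : ℕ) : ℝ) * x ^ ((K + 2) * (e + 4)) := by
  have hsq : ∀ {m : ℕ}, m ≤ K * d ^ 2 → (m : ℝ) ≤ K * x ^ (K + 2) := fun {m} hm => by
    have : (m : ℝ) ≤ K * (d : ℝ) ^ 2 := by exact_mod_cast hm
    refine this.trans ?_
    have : (d : ℝ) ^ 2 ≤ x ^ 2 := by gcongr
    have : x ^ 2 ≤ x ^ (K + 2) := pow_le_pow_right₀ hx (by omega)
    gcongr
    linarith
  have hB : ((d + k + m₁ + m₂ + 1 : ℕ) : ℝ) ≤ ((3 * K + 2 : ℕ) : ℝ) * x ^ (K + 2) := by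
    have e1 := hsq h₁
    have e2 := hsq h₂
    have e3 : (k : ℝ) ≤ K * x ^ (K + 2) := hk.trans (by gcongr; omega)
    have e4 : (1 : ℝ) ≤ x ^ (K + 2) := one_le_pow₀ hx
    have e5 : (d : ℝ) ≤ x ^ (K + 2) := hd.trans (le_self_pow₀ hx (by omega))
    push_cast
    linarith
  have hp4 : ((d + k + m₁ + m₂ + 1 : ℕ) : ℝ) ^ 4 ≤
      ((3 * K + 2 : ℕ) : ℝ) ^ 4 * x ^ ((K + 2) * (e + 4)) := by
    refine (pow_le_pow_left₀ (Nat.cast_nonneg _) hB 4).trans ?_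
    rw [mul_pow, ← pow_mul]
    gcongr
    omega
  have hpe : ((d + k + m₁ + m₂ + 1 : ℕ) : ℝ) ^ e ≤
      ((3 * K + 2 : ℕ) : ℝ) ^ e * x ^ ((K + 2) * (e + 4)) := by
    refine (pow_le_pow_left₀ (Nat.cast_nonneg _) hB e).trans ?_
    rw [mul_pow, ← pow_mul]
    gcongr
    omega
  have hp0 : (1 : ℝ) ≤ x ^ ((K + 2) * (e + 4)) := one_le_pow₀ hx
  have htR : (t : ℝ) ≤ 77 * ((N : ℝ) + 1) + 725 * ((d + k + m₁ + m₂ + 1 : ℕ) : ℝ) ^ 4 + 1 +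
      ((d + k + m₁ + m₂ + 1 : ℕ) : ℝ) ^ e := by exact_mod_cast ht
  have hNL : (N : ℝ) ≤ N * L := le_mul_of_one_le_right (Nat.cast_nonneg N) hL
  have hNL0 : (0 : ℝ) ≤ N * L := by positivity
  push_cast at hp4 hpe htR ⊢
  have e1 : (0 : ℝ) ≤ (1 + 725 * (3 * K + 2) ^ 4 + (3 * K + 2) ^ e) * (N * L) := by positivity
  linarith

end Algorithm

end HessianSketch

open HessianSketch in
theorem theorem1 :
    -- the program and the constant in the numbers of rows of the random sketches are absolute;
    -- the constants in the running time depend on the bounds `K` for the numbers of rows and on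
    -- the exponent `e` in the price of a call of the solver
    ∃ (P : Prog) (C : ℕ), ∀ K e : ℕ, ∃ c q : ℕ,
      ∀ (n d : ℕ) (A : Matrix (Fin n) (Fin d) ℝ) (b : Fin n → ℝ) (𝒞 : Set (Fin d → ℝ))
        (xs : Fin d → ℝ) (η : ℝ) (m₁ m₂ k : ℕ) (S₁ : CSType m₁ n) (sol : Solver d)
        (ent : Fin (nnz A) ≃ {q : Fin n × Fin d // A q.1 q.2 ≠ 0}),
      0 < d → A.rank = d → Convex ℝ 𝒞 → IsClosed 𝒞 →
      xs ∈ 𝒞 → (∀ x ∈ 𝒞, l2norm (A *ᵥ xs - b) ≤ l2norm (A *ᵥ x - b)) →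
      0 < η → η < 1 / 3 →
      m₁ ≤ K * d ^ 2 → C * d ^ 2 ≤ m₂ → m₂ ≤ K * d ^ 2 → 0 < m₂ →
      (C : ℝ) * (d / η) ^ 2 ≤ k → (k : ℝ) ≤ K * (d / η) ^ K → 0 < k →
      sol.CorrectFor 𝒞 →
      -- the error bound, with probability at least `0.98` over `S₂`, `T₁` and `T₂`
      ENNReal.ofReal 0.98 ≤ ProbabilityTheory.uniformOn Set.univ
        {ω : CSRand m₂ n × CSRand k n × CSRand k n |
          (∃ o : Output d, IsRun η A b 𝒞 S₁.mat ω.1.sketch.mat ω.2.1.sketch.mat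
            ω.2.2.sketch.mat o) ∧
          ∀ o : Output d, IsRun η A b 𝒞 S₁.mat ω.1.sketch.mat ω.2.1.sketch.mat
              ω.2.2.sketch.mat o →
            min (ratio o.z₁₂ o.z₁₁) (ratio o.z₂₂ o.z₂₁) ≠ ⊤ ∧
            l2norm (A *ᵥ (o.x - xs)) ≤
              (1 + η) ^ 4 * ((min (ratio o.z₁₂ o.z₁₁) (ratio o.z₂₂ o.z₂₁)).toReal + 4 * η) *
                l2norm (A *ᵥ xs)} ∧
      -- the program carries out the algorithm, within the stated time for every outcome
      ∀ ω : CSRand m₂ n × CSRand k n × CSRand k n, ∃ (t : ℕ) (s : Mem),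
        Exec sol e P (initMem η A b ent S₁ ω.1.sketch ω.2.1.sketch ω.2.2.sketch) t s ∧
        (t : ℝ) ≤ c * (nnz A * Real.log (1 / η)) + c * (d / η) ^ q ∧
        ((∃ o : Output d, IsRun η A b 𝒞 S₁.mat ω.1.sketch.mat ω.2.1.sketch.mat
            ω.2.2.sketch.mat o) →
          IsRun η A b 𝒞 S₁.mat ω.1.sketch.mat ω.2.1.sketch.mat ω.2.2.sketch.mat (s.output d)) := by
  refine ⟨algorithmProg, 30000, fun K e => ⟨78 + 725 * (3 * K + 2) ^ 4 + (3 * K + 2) ^ e,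
    (K + 2) * (e + 4), ?_⟩⟩
  intro n d A b 𝒞 xs η m₁ m₂ k S₁ sol ent hd hrank hconv hclosed hxs hopt hη hη3 hm₁ hCm₂ hm₂ hm₂0
    hCk hkK hk0 hcor
  have hA := injective_of_rank_eq hrank
  have hd1 : (1 : ℝ) ≤ d := by exact_mod_cast hd
  have hdx : (d : ℝ) ≤ d / η := by
    rw [le_div_iff₀ hη]
    nlinarith
  have hkd : (d : ℝ) / η ≤ k := by
    push_cast at hCk
    nlinarith [hd1.trans hdx]
  refine ⟨?_, fun ω => ?_⟩
  · refine uniformOn_isEmbedding_ge hd hη hA hm₂0 hk0 hCm₂ (by exact_mod_cast hCk) ?_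
    intro ω h₁ h₂ h₃
    exact isRun_of_isEmbedding hd hη hη3 hA h₁ h₂ h₃ hconv hclosed hxs hopt
  · obtain ⟨t, s, hex, ht, hrun⟩ := exec_algorithmProg (e := e) (A := A) (b := b) (ent := ent)
      (S₁ := S₁) (S₂ := ω.1.sketch) (T₁ := ω.2.1.sketch) (T₂ := ω.2.2.sketch) hd hη hη3 hk0 hkd
      hclosed hxs hcor rfl
    refine ⟨t, s, hex, time_le (hd1.trans hdx) ?_ hdx hm₁ hm₂ hkK ht, hrun⟩
    -- `η < 1/3 < 1/e`
    rw [Real.le_log_iff_exp_le (by positivity)]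
    have h3 : (3 : ℝ) ≤ 1 / η := by
      rw [le_div_iff₀ hη]
      linarith
    linarith [Real.exp_one_lt_d9]
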